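/- **Setting.** Let $F$ be a finite-dimensional Euclidean space with inner product $\langle\cdot,\cdot\rangle$. Identify functions on $S^1$ with $2\pi$-periodic functions of the angle $\theta$, and let $\mathcal H_{0,F}$ be the completion of $C^\infty(S^1,F)/F$ (loops modulo constants) for $\|f\|^2=\sum_{k\ge 1}k\,\|\hat f_k\|^2$, where $\hat f_k=\int_0^{2\pi} f(\theta)e^{-ik\theta}\frac{d\theta}{2\pi}$, with the complex structure $\hat f_k\mapsto -i\,\mathrm{sign}(k)\hat f_k$ and the inner product linear in the second variable, $\langle [f],[g]\rangle=\sum_{k\ge1}k\,\hat f_k\cdot\hat g_{-k}$ (so $\operatorname{Im}\langle [f],[g]\rangle=\frac12\int_0^{2\pi}\langle f,g'\rangle\frac{d\theta}{2\pi}$). On the bosonic Fock space $e^{\mathcal H_{0,F}}$ with coherent vectors $e^\eta$, let $W(\xi)$ be the Weyl unitaries, $W(\xi)e^\eta=e^{-\frac12\|\xi\|^2-\langle\xi,\eta\rangle}e^{\xi+\eta}$. For a proper (open, connected, non-empty, non-dense) interval $I\subset S^1$ put $$\mathcal A_F(I)=\{W([f]): f\in C^\infty(S^1,F),\ \operatorname{supp}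 f\subset I\}''.$$ Supports are closed supports. Subintervals of a fixed proper interval $I$ are ordered by increasing angle $\theta$: $I_1<I_2$ means that $I_1,I_2$ are disjoint and every angle of $I_1$ in $I$ is smaller than every angle of $I_2$. The charge of $\ell$ is $q(\ell)=\int_0^{2\pi}\ell(\theta)\frac{d\theta}{2\pi}$. For normal unital $*$-endomorphisms $\rho,\sigma$ of $\mathcal A_F(I)$ let $(\rho,\sigma)=\{t\in\mathcal A_F(I): t\rho(x)=\sigma(x)t\ \text{for all }x\in\mathcal A_F(I)\}$, and call $\rho$ localized in a subinterval $J\subset I$ if it acts trivially on $\mathcal A_F(K)$ for every subinterval $K\subset I$ disjoint from $J$. The Fredenhagen–Rehren–Schroer braiding is $$\varepsilon(\rho,\sigma)=\sigma(u^*)\,v^*\,u\,\rho(v),$$ where $u\in(\rho,\hat\rho)$ and $v\in(\sigma,\hat\sigma)$ are unitaries, and $\hat\rho$, $\hat\sigma$ are localized in subintervals $J_1$, $J_2$ of $I$ with $J_2<J_1$ (that is, $J_1$ precedes $J_2$ clockwise). **Theorem.** Let $I$ be a proper interval. 1. For every smooth $\ell\colon S^1\to F$ with $\operatorname{supp}\ell\subset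 I$ there is exactly one normal $*$-automorphism $\rho_\ell$ of $\mathcal A_F(I)$ with $$\rho_\ell(W([f]))=e^{i\int_0^{2\pi}\langle f(\theta),\ell(\theta)\rangle\frac{d\theta}{2\pi}}\,W([f])\qquad\text{whenever }\operatorname{supp} f\subset I.$$ 2. Let $I_1<I_2$ be subintervals of $I$, let $\ell_1,\ell_2\colon S^1\to F$ be smooth with $\operatorname{supp}\ell_i\subset I_i$, and let $\rho_i=\rho_{\ell_i}$. Then the braidings below exist, i.e. admissible $J_1,J_2,\hat\rho,\hat\sigma,u,v$ exist and $\varepsilon$ does not depend on their choice, and $$\varepsilon(\rho_1,\rho_2)=e^{2\pi i\langle q(\ell_1),q(\ell_2)\rangle}\cdot 1_{\mathcal A_F(I)},\qquad \varepsilon(\rho_2,\rho_1)=1_{\mathcal A_F(I)}.$$ 3. Let $\ell\colon S^1\to\mathbb R$ be smooth with $\operatorname{supp}\ell\subset I$ and $q(\ell)=1$. Then $q(p\ell)=p$ for all $p\in F$, and for all $p,q\in F$ the braiding of $\rho_{p\ell}$ and $\rho_{q\ell}$ exists in the same sense and $$\varepsilon(\rho_{p\ell},\rho_{q\ell})=e^{i\pi\langle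 p,q\rangle}\cdot 1_{\mathcal A_F(I)}.$$ The case $F=\mathbb R$ is the statement for the $\mathsf U(1)$-current net. -/

import Mathlib

open scoped ContDiff InnerProductSpace
noncomputable section
namespace FreeBoson

/-- The complex Hilbert space `ℓ²(ι)`. -/
abbrev HilbertSeq (ι : Type) : Type := lp (fun _ : ι => ℂ) 2

/-- The full Fock space `⨁ₙ H^{⊗n}` over `H = ℓ²(ι)`, where `H^{⊗n}` is realised as `ℓ²(ιⁿ)`:
an element is a square-summable family of `n`-particle wave functions `ψ(n, (i₁, …, iₙ))`. -/
abbrev FullFock (ι : Type) : Type := lp (fun _ : (Σ n : ℕ, (Fin n → ι)) => ℂ) 2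

/-- The range of the symmetrisation projections: wave functions invariant under permutations. -/
def symmetricSubspace (ι : Type) : Submodule ℂ (FullFock ι) where
  carrier := {ψ | ∀ (n : ℕ) (i : Fin n → ι) (σ : Equiv.Perm (Fin n)), ψ ⟨n, i ∘ σ⟩ = ψ ⟨n, i⟩}
  add_mem' := by
    intro a b ha hb n i σ
    simp [ha n i σ, hb n i σ]
  zero_mem' := by
    intro n i σ
    simp
  smul_mem' := by
    intro c a ha n i σ
    simp [ha n i σ]

/-- The bosonic (symmetric) Fock space `e^H = ⨁ₙ Pₙ H^{⊗n}` over `H = ℓ²(ι)`. -/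
def Fock (ι : Type) : Type := symmetricSubspace ι

instance (ι : Type) : NormedAddCommGroup (Fock ι) :=
  inferInstanceAs (NormedAddCommGroup (symmetricSubspace ι))

instance (ι : Type) : InnerProductSpace ℂ (Fock ι) :=
  inferInstanceAs (InnerProductSpace ℂ (symmetricSubspace ι))

theorem isClosed_symmetricSubspace (ι : Type) :
    IsClosed (symmetricSubspace ι : Set (FullFock ι)) := by
  have hc : ∀ j, Continuous fun ψ : FullFock ι => ψ j := fun j =>
    (continuous_apply j).comp (lp.uniformContinuous_coe.continuous)
  have : (symmetricSubspace ι : Set (FullFock ι)) =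
      ⋂ (n : ℕ) (i : Fin n → ι) (σ : Equiv.Perm (Fin n)),
        {ψ : FullFock ι | ψ ⟨n, i ∘ σ⟩ = ψ ⟨n, i⟩} := by
    ext ψ
    simp only [Set.mem_iInter]
    rfl
  rw [this]
  exact isClosed_iInter fun n => isClosed_iInter fun i => isClosed_iInter fun σ =>
    isClosed_eq (hc _) (hc _)

instance (ι : Type) : CompleteSpace (Fock ι) :=
  (isClosed_symmetricSubspace ι).completeSpace_coe

/-- Expansion of the `n`-th power of a sum. -/
theorem hasSum_prod_fin {ι : Type} (a : ι → ℂ) (s : ℂ) (hs : Summable fun i => ‖a i‖)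
    (ha : HasSum a s) (n : ℕ) :
    HasSum (fun i : Fin n → ι => ∏ j, a (i j)) (s ^ n) ∧
      Summable fun i : Fin n → ι => ‖∏ j, a (i j)‖ := by
  induction n with
  | zero =>
    refine ⟨?_, (hasSum_fintype _).summable⟩
    simp
  | succ n ih =>
    obtain ⟨h1, h2⟩ := ih
    have hn : Summable fun x : ι × (Fin n → ι) => ‖a x.1 * ∏ j, a (x.2 j)‖ :=
      Summable.mul_norm (f := a) (g := fun i : Fin n → ι => ∏ j, a (i j)) hs h2
    have hm : HasSum (fun x : ι × (Fin n → ι) => a x.1 * ∏ j, a (x.2 j)) (s * s ^ n) :=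
      HasSum.mul (f := a) (g := fun i : Fin n → ι => ∏ j, a (i j)) ha h1 hn.of_norm
    let e : ι × (Fin n → ι) ≃ (Fin (n + 1) → ι) := Fin.consEquiv fun _ => ι
    have he : ∀ x : ι × (Fin n → ι), ∏ j, a (e x j) = a x.1 * ∏ j, a (x.2 j) := by
      intro x
      simp [e, Fin.prod_univ_succ]
    constructor
    · rw [pow_succ', ← e.hasSum_iff]
      exact hm.congr_fun he
    · rw [← e.summable_iff]
      exact hn.congr fun x => by simp only [Function.comp, he]

/-- Multinomial expansion of the exponential of a sum. -/
theorem hasSum_exp {ι : Type} (a : ι → ℂ) (s : ℂ) (hs : Summable fun i => ‖a i‖)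
    (ha : HasSum a s) :
    HasSum (fun p : (Σ n : ℕ, (Fin n → ι)) => ((p.1.factorial : ℂ)⁻¹ * ∏ j, a (p.2 j)))
      (Complex.exp s) := by
  have hfac : ∀ n : ℕ, ‖((n.factorial : ℂ)⁻¹)‖ = (n.factorial : ℝ)⁻¹ := by
    intro n; simp
  have hsum : Summable
      (fun p : (Σ n : ℕ, (Fin n → ι)) => ‖((p.1.factorial : ℂ)⁻¹ * ∏ j, a (p.2 j))‖) := by
    rw [summable_sigma_of_nonneg (fun _ => norm_nonneg _)]
    constructor
    · intro n
      simp only [norm_mul]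
      exact ((hasSum_prod_fin a s hs ha n).2).mul_left _
    · have hA : HasSum (fun i => (‖a i‖ : ℂ)) ((∑' i, ‖a i‖ : ℝ) : ℂ) :=
        (Complex.hasSum_ofReal).2 hs.hasSum
      have key : ∀ n : ℕ, (∑' i : Fin n → ι, ‖((n.factorial : ℂ)⁻¹ * ∏ j, a (i j))‖)
          = (∑' i, ‖a i‖) ^ n / n.factorial := by
        intro n
        have := (hasSum_prod_fin (fun i => (‖a i‖ : ℂ)) _ (by simpa using hs) hA n).1
        have h2 : HasSum (fun i : Fin n → ι => ‖∏ j, a (i j)‖) ((∑' i, ‖a i‖) ^ n) := by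
          rw [← Complex.hasSum_ofReal, Complex.ofReal_pow]
          exact this.congr_fun fun i => by rw [norm_prod]; push_cast; rfl
        simp only [norm_mul, hfac]
        rw [tsum_mul_left, h2.tsum_eq]
        field_simp
      simp only [key]
      exact Real.summable_pow_div_factorial _
  have hexp : HasSum (fun n : ℕ => (n.factorial : ℂ)⁻¹ * s ^ n) (Complex.exp s) := by
    have h := NormedSpace.expSeries_div_hasSum_exp (𝔸 := ℂ) s
    rw [← Complex.exp_eq_exp_ℂ] at h
    exact h.congr_fun fun n => by rw [div_eq_inv_mul]
  have hin : ∀ n : ℕ, HasSum (fun i : Fin n → ι => (n.factorial : ℂ)⁻¹ * ∏ j, a (i j))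
      ((n.factorial : ℂ)⁻¹ * s ^ n) := fun n =>
    ((hasSum_prod_fin a s hs ha n).1).mul_left _
  exact HasSum.sigma_of_hasSum hexp hin hsum.of_norm

/-- The wave functions of `e^ξ = ⨁ₙ (n!)^{-1/2} ξ^{⊗n}`. -/
def coherentFun {ι : Type} (ξ : ι → ℂ) (p : Σ n : ℕ, (Fin n → ι)) : ℂ :=
  ((Real.sqrt (p.1.factorial : ℝ) : ℝ) : ℂ)⁻¹ * ∏ j, ξ (p.2 j)

theorem coherentFun_mul {ι : Type} (ξ η : ι → ℂ) (p : Σ n : ℕ, (Fin n → ι)) :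
    inner ℂ (coherentFun ξ p) (coherentFun η p) =
      (p.1.factorial : ℂ)⁻¹ * ∏ j, inner ℂ (ξ (p.2 j)) (η (p.2 j)) := by
  have h : (((Real.sqrt (p.1.factorial : ℝ) : ℝ) : ℂ)⁻¹) * ((Real.sqrt (p.1.factorial : ℝ) : ℝ) : ℂ)⁻¹
      = (p.1.factorial : ℂ)⁻¹ := by
    rw [← mul_inv, ← Complex.ofReal_mul, Real.mul_self_sqrt (by positivity)]
    simp
  simp only [RCLike.inner_apply, coherentFun, map_mul, map_inv₀, Complex.conj_ofReal, map_prod,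
    Finset.prod_mul_distrib]
  rw [← h]; ring

theorem memℓp_coherentFun {ι : Type} (ξ : HilbertSeq ι) : Memℓp (coherentFun ξ) 2 := by
  have hs : Summable fun i => ‖inner ℂ (ξ i) (ξ i)‖ :=
    (lp.summable_inner (𝕜 := ℂ) ξ ξ).norm
  have h := (hasSum_exp (fun i => inner ℂ (ξ i) (ξ i)) _ hs
    (lp.hasSum_inner (𝕜 := ℂ) ξ ξ)).summable.norm
  refine memℓp_gen ?_
  refine h.congr fun p => ?_
  rw [← coherentFun_mul, inner_self_eq_norm_sq_to_K]
  simp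

/-- The coherent vector `e^ξ`. -/
def coherent {ι : Type} (ξ : HilbertSeq ι) : Fock ι :=
  ⟨⟨coherentFun ξ, memℓp_coherentFun ξ⟩, by
    intro n i σ
    change coherentFun ξ ⟨n, i ∘ σ⟩ = coherentFun ξ ⟨n, i⟩
    simp only [coherentFun, Function.comp]
    rw [Equiv.prod_comp σ (fun j => ξ (i j))]⟩

theorem inner_coherent {ι : Type} (ξ η : HilbertSeq ι) :
    inner ℂ (coherent ξ) (coherent η) = Complex.exp (inner ℂ ξ η) := by
  have hs : Summable fun i => ‖inner ℂ (ξ i) (η i)‖ :=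
    (lp.summable_inner (𝕜 := ℂ) ξ η).norm
  have h := hasSum_exp (fun i => inner ℂ (ξ i) (η i)) _ hs (lp.hasSum_inner (𝕜 := ℂ) ξ η)
  rw [← h.tsum_eq]
  change inner ℂ (coherent ξ).1 (coherent η).1 = _
  rw [lp.inner_eq_tsum]
  exact tsum_congr fun p => coherentFun_mul _ _ p

theorem exists_perm_of_sum_single_eq {α : Type} {n : ℕ} (i k : Fin n → α)
    (h : ∑ j, Finsupp.single (k j) 1 = (∑ j, Finsupp.single (i j) 1 : α →₀ ℕ)) :
    ∃ σ : Equiv.Perm (Fin n), k = i ∘ σ := by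
  classical
  have hc : ∀ c, Nonempty ({a // k a = c} ≃ {b // i b = c}) := by
    intro c
    have h1 := DFunLike.congr_fun h c
    simp only [Finsupp.coe_finsetSum, Finset.sum_apply, Finsupp.single_apply,
      Finset.sum_boole, Nat.cast_id] at h1
    refine Fintype.card_eq.1 ?_
    rw [Fintype.card_subtype, Fintype.card_subtype]
    exact h1
  refine ⟨Equiv.ofFiberEquiv fun c => (hc c).some, ?_⟩
  funext a
  exact (Equiv.ofFiberEquiv_map (fun c => (hc c).some) a).symm

theorem eq_zero_of_symmetric_of_forall {n : ℕ} {S : Type} [Fintype S] (v : (Fin n → S) → ℂ)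
    (hv : ∀ i (σ : Equiv.Perm (Fin n)), v (i ∘ σ) = v i)
    (h0 : ∀ x : S → ℂ, ∑ i, v i * ∏ j, x (i j) = 0) : v = 0 := by
  classical
  let p : MvPolynomial S ℂ :=
    ∑ i : Fin n → S, MvPolynomial.monomial (∑ j, Finsupp.single (i j) 1) (v i)
  have hp : p = 0 := by
    refine MvPolynomial.funext fun x => ?_
    rw [map_zero, ← h0 x]
    simp only [p, map_sum, MvPolynomial.eval_monomial]
    refine Finset.sum_congr rfl fun i _ => ?_
    congr 1
    rw [Finsupp.prod_fintype _ _ (by simp)]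
    simp only [Finsupp.coe_finsetSum, Finset.sum_apply, ← Finset.prod_pow_eq_pow_sum]
    rw [Finset.prod_comm]
    refine Finset.prod_congr rfl fun j _ => ?_
    rw [Finset.prod_eq_single (i j)]
    · simp
    · intro b _ hb
      simp [hb.symm]
    · simp
  funext i
  have hc : MvPolynomial.coeff (∑ j, Finsupp.single (i j) 1) p = 0 := by rw [hp]; simp
  simp only [p, MvPolynomial.coeff_sum, MvPolynomial.coeff_monomial] at hc
  rw [← Finset.sum_filter] at hc
  rw [Finset.sum_congr rfl (g := fun _ => v i)] at hc
  · rw [Finset.sum_const, smul_eq_zero] at hc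
    refine hc.resolve_left (Finset.card_ne_zero.2 ⟨i, by simp⟩)
  · intro k hk
    obtain ⟨σ, rfl⟩ := exists_perm_of_sum_single_eq i k (Finset.mem_filter.1 hk).2
    exact hv i σ

/-- The coherent vectors are total in the Fock space. -/
theorem coherent_total {ι : Type} :
    Dense (Submodule.span ℂ (Set.range (coherent (ι := ι))) : Set (Fock ι)) := by
  classical
  rw [Submodule.dense_iff_topologicalClosure_eq_top, Submodule.topologicalClosure_eq_top_iff,
    Submodule.eq_bot_iff]
  intro v hv
  have hv0 : ∀ ξ, inner ℂ (coherent ξ) v = 0 := fun ξ =>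
    hv _ (Submodule.subset_span ⟨ξ, rfl⟩)
  have hsym : ∀ (n : ℕ) (i : Fin n → ι) (σ : Equiv.Perm (Fin n)),
      v.1 ⟨n, i ∘ σ⟩ = v.1 ⟨n, i⟩ := v.2
  have key : ∀ (n : ℕ) (i : Fin n → ι), v.1 ⟨n, i⟩ = 0 := by
    intro n i
    let S : Type := {s : ι // s ∈ Set.range i}
    have : Fintype S := (Set.finite_range i).fintype
    -- the vector with coordinates `conj (x s)` on `S` and `0` elsewhere
    let ext : (S → ℂ) → ι → ℂ := fun x s => if h : s ∈ Set.range i then star (x ⟨s, h⟩) else 0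
    have hmem : ∀ x, Memℓp (ext x) 2 := by
      intro x
      refine memℓp_gen (summable_of_hasFiniteSupport ?_)
      refine (Set.finite_range i).subset fun s hs => ?_
      by_contra h
      exact hs (by simp only [ext, dif_neg h]; simp)
    let A : (S → ℂ) → ℕ → ℂ := fun x m =>
      ((Real.sqrt (m.factorial : ℝ) : ℝ) : ℂ)⁻¹ *
        ∑ k : Fin m → S, v.1 ⟨m, fun j => (k j).1⟩ * ∏ j, x (k j)
    have hfib : ∀ x (m : ℕ), HasSum
        (fun k : Fin m → ι => inner ℂ (coherentFun (ext x) ⟨m, k⟩) (v.1 ⟨m, k⟩))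
        (A x m) := by
      intro x m
      have hinj : Function.Injective (fun (k : Fin m → S) (j : Fin m) => (k j).1) := by
        intro k k' h
        funext j
        exact Subtype.ext (congrFun h j)
      rw [← hinj.hasSum_iff]
      · have h := hasSum_fintype fun k : Fin m → S =>
          ((Real.sqrt (m.factorial : ℝ) : ℝ) : ℂ)⁻¹ *
            (v.1 ⟨m, fun j => (k j).1⟩ * ∏ j, x (k j))
        rw [← Finset.mul_sum] at h
        refine h.congr_fun fun k => ?_
        have hx : ∀ j, ext x (k j).1 = star (x (k j)) := fun j => dif_pos (k j).2
        simp only [Function.comp, coherentFun, RCLike.inner_apply, map_mul, map_inv₀,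
          Complex.conj_ofReal, map_prod, hx]
        simp only [starRingEnd_apply, star_star]
        ring
      · intro k hk
        have : ∃ j, k j ∉ Set.range i := by
          by_contra hcon
          push Not at hcon
          exact hk ⟨fun j => ⟨k j, hcon j⟩, rfl⟩
        obtain ⟨j, hj⟩ := this
        have h0 : ∏ j, ext x (k j) = 0 :=
          Finset.prod_eq_zero (Finset.mem_univ j) (dif_neg hj)
        simp [coherentFun, h0]
    have hsum : ∀ x, HasSum (A x) 0 := by
      intro x
      have h := lp.hasSum_inner (𝕜 := ℂ) (coherent ⟨ext x, hmem x⟩).1 v.1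
      have h0 : inner ℂ (coherent ⟨ext x, hmem x⟩).1 v.1 = 0 := hv0 _
      rw [h0] at h
      exact h.sigma (hfib x)
    have hhom : ∀ x m (t : ℂ), A (t • x) m = t ^ m * A x m := by
      intro x m t
      simp only [A, Pi.smul_apply, smul_eq_mul, Finset.prod_mul_distrib, Finset.prod_const,
        Finset.card_univ, Fintype.card_fin]
      rw [mul_left_comm, Finset.mul_sum (a := t ^ m)]
      congr 1
      exact Finset.sum_congr rfl fun k _ => by ring
    have hA0 : ∀ x m, A x m = 0 := by
      intro x m
      let p : FormalMultilinearSeries ℂ ℂ ℂ := fun m =>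
        ContinuousMultilinearMap.mkPiRing ℂ (Fin m) (A x m)
      have hpc : ∀ m, p.coeff m = A x m := fun m => by
        simp [p, FormalMultilinearSeries.coeff]
      have hp : HasFPowerSeriesAt (0 : ℂ → ℂ) p 0 := by
        rw [hasFPowerSeriesAt_iff]
        refine Filter.Eventually.of_forall fun t => ?_
        have h := hsum (t • x)
        refine h.congr_fun fun m => ?_
        rw [hpc, hhom, smul_eq_mul]
      rw [← hpc m, hp.eq_zero]
      rfl
    have hz := eq_zero_of_symmetric_of_forall
      (fun k : Fin n → S => v.1 ⟨n, fun j => (k j).1⟩)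
      (fun k σ => hsym n (fun j => (k j).1) σ) (fun x => by
        have h := hA0 x n
        simp only [A] at h
        refine (mul_eq_zero.1 h).resolve_left (inv_ne_zero ?_)
        rw [Ne, Complex.ofReal_eq_zero, Real.sqrt_eq_zero (by positivity)]
        positivity)
    exact congrFun hz fun j => ⟨i j, j, rfl⟩
  refine Subtype.ext (lp.ext (funext fun p => ?_))
  exact key p.1 p.2

theorem norm_linearCombination_eq {α E : Type*} [NormedAddCommGroup E] [InnerProductSpace ℂ E]
    (a b : α → E) (h : ∀ x y, inner ℂ (a x) (a y) = inner ℂ (b x) (b y)) (c : α →₀ ℂ) :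
    ‖Finsupp.linearCombination ℂ a c‖ = ‖Finsupp.linearCombination ℂ b c‖ := by
  have key : inner ℂ (Finsupp.linearCombination ℂ a c) (Finsupp.linearCombination ℂ a c) =
      inner ℂ (Finsupp.linearCombination ℂ b c) (Finsupp.linearCombination ℂ b c) := by
    simp only [Finsupp.linearCombination_apply, Finsupp.sum, sum_inner, inner_sum,
      inner_smul_left, inner_smul_right, h]
  rw [@norm_eq_sqrt_re_inner ℂ, @norm_eq_sqrt_re_inner ℂ _ _ _ _ (Finsupp.linearCombination ℂ b c),
    key]

/-- The vector `exp(-‖ξ‖²/2 - ⟨ξ, η⟩) e^{ξ+η}`; the inner product is linear in its second variable. -/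
def weylCoherent {ι : Type} (ξ η : HilbertSeq ι) : Fock ι :=
  Complex.exp (-((‖ξ‖ ^ 2 / 2 : ℝ) : ℂ) - inner ℂ ξ η) • coherent (ξ + η)

/-- The Weyl operator `W(ξ)`: the bounded operator on the Fock space with
`W(ξ) e^η = exp(-‖ξ‖²/2 - ⟨ξ, η⟩) e^{ξ+η}` for all `η` (see `weyl_coherent`), in particular
`W(ξ) e^0 = exp(-‖ξ‖²/2) e^ξ` and `W(ξ) W(η) = exp(-i Im ⟨ξ, η⟩) W(ξ + η)`. It is obtained by
linear and continuous extension from the total set of coherent vectors. -/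
def weyl {ι : Type} (ξ : HilbertSeq ι) : Fock ι →L[ℂ] Fock ι :=
  (Finsupp.linearCombination ℂ (weylCoherent ξ)).extendOfNorm
    (Finsupp.linearCombination ℂ (coherent (ι := ι)))

/-- The Gram matrix of coherent vectors is preserved, so that `W(ξ)` is well defined. -/
theorem inner_weylCoherent {ι : Type} (ξ η η' : HilbertSeq ι) :
    inner ℂ (weylCoherent ξ η) (weylCoherent ξ η') = inner ℂ (coherent η) (coherent η') := by
  have hn : inner ℂ ξ ξ = ((‖ξ‖ ^ 2 : ℝ) : ℂ) := by
    rw [inner_self_eq_norm_sq_to_K]; simp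
  rw [weylCoherent, weylCoherent, inner_smul_left, inner_smul_right, inner_coherent,
    inner_coherent, ← Complex.exp_conj, ← Complex.exp_add, ← Complex.exp_add]
  congr 1
  simp only [map_sub, map_neg, Complex.conj_ofReal, inner_conj_symm, inner_add_left,
    inner_add_right, hn]
  push_cast
  ring

theorem weyl_coherent {ι : Type} (ξ η : HilbertSeq ι) :
    weyl ξ (coherent η) =
      Complex.exp (-((‖ξ‖ ^ 2 / 2 : ℝ) : ℂ) - inner ℂ ξ η) • coherent (ξ + η) := by
  have hd : DenseRange (Finsupp.linearCombination ℂ (coherent (ι := ι))) := by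
    have h := coherent_total (ι := ι)
    rw [← Finsupp.range_linearCombination] at h
    exact h
  have h := LinearMap.extendOfNorm_eq (f := Finsupp.linearCombination ℂ (weylCoherent ξ)) hd
    ⟨1, fun c => by
      rw [one_mul]
      exact (norm_linearCombination_eq _ _ (inner_weylCoherent ξ) c).le⟩ (Finsupp.single η 1)
  rw [Finsupp.linearCombination_single, Finsupp.linearCombination_single, one_smul, one_smul] at h
  exact h

/-- The smooth functions `S¹ → F`, as smooth `2π`-periodic functions of the angle. -/
structure Loop (F : Type*) [NormedAddCommGroup F] [NormedSpace ℝ F] where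
  toFun : ℝ → F
  smooth : ContDiff ℝ ∞ toFun
  periodic : Function.Periodic toFun (2 * Real.pi)

instance (F : Type*) [NormedAddCommGroup F] [NormedSpace ℝ F] :
    CoeFun (Loop F) (fun _ => ℝ → F) := ⟨Loop.toFun⟩

/-- The loop `θ ↦ ℓ(θ) p`. -/
def Loop.smulVec {F : Type*} [NormedAddCommGroup F] [NormedSpace ℝ F] (ℓ : Loop ℝ) (p : F) :
    Loop F where
  toFun θ := ℓ θ • p
  smooth := ℓ.smooth.smul contDiff_const
  periodic θ := by simp only [ℓ.periodic θ]

/-- The charge `q(ℓ) = ∫ ℓ(θ) dθ/2π`. -/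
def charge {F : Type*} [NormedAddCommGroup F] [NormedSpace ℝ F] (ℓ : Loop F) : F :=
  (2 * Real.pi)⁻¹ • ∫ θ in (0 : ℝ)..(2 * Real.pi), ℓ θ

section Net

variable (F : Type*) [NormedAddCommGroup F] [InnerProductSpace ℝ F] [FiniteDimensional ℝ F]

/-- Labels `(k, j)` of the `j`-th component (in a fixed orthonormal basis of `F`) of the
`(k+1)`-st Fourier mode. -/
abbrev ModeIndex : Type := ℕ × Fin (Module.finrank ℝ F)

/-- The one-particle space `ℋ_{0,F}`, the completion of `C^∞(S¹, F)/F` for the norm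
`‖f‖² = ∑_{k ≥ 1} k ‖f̂_k‖²` with the complex structure `f̂_k ↦ -i sign(k) f̂_k`, realised as
`ℓ²(ℕ_{≥1}) ⊗ F_ℂ` through the map `Loop.oneParticle` below. -/
abbrev OneParticle : Type := HilbertSeq (ModeIndex F)

variable {F}

/-- The `j`-th component of the Fourier coefficient `f̂_k = ∫ f(θ) e^{-ikθ} dθ/2π ∈ F_ℂ`. -/
def Loop.fourierComp (f : Loop F) (k : ℤ) (j : Fin (Module.finrank ℝ F)) : ℂ :=
  fourierCoeffOn Real.two_pi_pos
    (fun θ => ((inner ℝ (stdOrthonormalBasis ℝ F j) (f θ) : ℝ) : ℂ)) k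

theorem summable_sq_fourierComp (f : Loop F) (j : Fin (Module.finrank ℝ F)) :
    Summable fun k : ℤ => (k : ℝ) ^ 2 * ‖f.fourierComp k j‖ ^ 2 := by
  let e : F →L[ℝ] ℂ := Complex.ofRealCLM.comp (innerSL ℝ (stdOrthonormalBasis ℝ F j))
  let g : ℝ → ℂ := fun θ => e (f θ)
  have hg : ContDiff ℝ ∞ g := e.contDiff.comp f.smooth
  have hper : g (2 * Real.pi) = g 0 := by
    have := f.periodic 0
    rw [zero_add] at this
    simp only [g, this]
  have hd : ∀ x, HasDerivAt g (deriv g x) x := fun x =>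
    ((hg.differentiable (by simp)) x).hasDerivAt
  have hc : Continuous (deriv g) := hg.continuous_deriv (by simp)
  have hL2 : MeasureTheory.MemLp (deriv g) 2
      (MeasureTheory.volume.restrict (Set.Ioc 0 (2 * Real.pi))) := by
    rw [MeasureTheory.memLp_two_iff_integrable_sq_norm hc.aestronglyMeasurable]
    exact ((hc.norm.pow 2).integrableOn_Icc).mono_set Set.Ioc_subset_Icc_self
  have hs := (hasSum_sq_fourierCoeffOn Real.two_pi_pos hL2).summable
  refine hs.congr fun k => ?_
  by_cases hk : k = 0
  · subst hk
    rw [fourierCoeffOn_eq_integral]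
    simp only [Int.cast_zero, neg_zero, fourier_zero, one_smul]
    rw [intervalIntegral.integral_eq_sub_of_hasDerivAt (fun x _ => hd x)
      (hc.intervalIntegrable _ _), hper]
    simp
  · have h := fourierCoeffOn_of_hasDerivAt Real.two_pi_pos hk (f := g) (f' := deriv g)
      (fun x _ => hd x) (hc.intervalIntegrable _ _)
    have h' : f.fourierComp k j = fourierCoeffOn Real.two_pi_pos g k := rfl
    rw [h', h, hper]
    have hk' : (k : ℝ) ≠ 0 := by exact_mod_cast hk
    have hpi := Real.pi_ne_zero
    simp only [sub_self, mul_zero, zero_sub, norm_mul, norm_neg, norm_div, norm_one, mul_pow,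
      Complex.norm_I, Complex.norm_real, Complex.norm_intCast, Complex.norm_ofNat, sub_zero,
      Complex.ofReal_zero, Complex.ofReal_mul, Complex.ofReal_ofNat, Real.norm_eq_abs, div_pow,
      sq_abs, one_pow, mul_one]
    field_simp

theorem Loop.memℓp_oneParticle (f : Loop F) :
    Memℓp (fun x : ModeIndex F =>
      ((Real.sqrt (x.1 + 1) : ℝ) : ℂ) * f.fourierComp (-(x.1 + 1)) x.2) 2 := by
  refine memℓp_gen ?_
  have hj : ∀ j, Summable fun n : ℕ =>
      ‖((Real.sqrt (n + 1) : ℝ) : ℂ) * f.fourierComp (-(n + 1)) j‖ ^ (2 : ℝ) := by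
    intro j
    have hinj : Function.Injective fun n : ℕ => (-(n + 1) : ℤ) := fun a b h => by
      simpa using h
    have h := (summable_sq_fourierComp f j).comp_injective hinj
    refine Summable.of_nonneg_of_le (fun n => by positivity) (fun n => ?_) h
    simp only [Function.comp, norm_mul, Complex.norm_real, Real.rpow_two, mul_pow]
    rw [Real.norm_of_nonneg (Real.sqrt_nonneg _), Real.sq_sqrt (by positivity)]
    refine mul_le_mul_of_nonneg_right ?_ (by positivity)
    push_cast
    nlinarith [(Nat.cast_nonneg n : (0 : ℝ) ≤ n)]
  have hs : Summable fun y : (Σ _ : Fin (Module.finrank ℝ F), ℕ) =>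
      ‖((Real.sqrt (y.2 + 1) : ℝ) : ℂ) * f.fourierComp (-(y.2 + 1)) y.1‖ ^ (2 : ℝ) := by
    rw [summable_sigma_of_nonneg fun _ => by positivity]
    exact ⟨hj, (hasSum_fintype _).summable⟩
  let e : (Σ _ : Fin (Module.finrank ℝ F), ℕ) ≃ ModeIndex F :=
    (Equiv.sigmaEquivProd _ _).trans (Equiv.prodComm _ _)
  rw [← e.summable_iff]
  simpa using! hs

/-- The class `[f]` of a loop in the one-particle space: the vector with components
`√k f̂_{-k}`, `k ≥ 1`. The kernel of `f ↦ [f]` consists of the constants, the range is dense, and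
`⟨[f], [g]⟩ = ∑_{k ≥ 1} k f̂_k · ĝ_{-k}`, with imaginary part `(1/2) ∫ ⟨f, g'⟩ dθ/2π`. The negative
modes are used because multiplication by `i` has to be `f̂_k ↦ -i sign(k) f̂_k`. -/
def Loop.oneParticle (f : Loop F) : OneParticle F :=
  ⟨fun x => ((Real.sqrt (x.1 + 1) : ℝ) : ℂ) * f.fourierComp (-(x.1 + 1)) x.2, f.memℓp_oneParticle⟩

/-- A proper interval of `S¹` (open, connected, non-empty, not dense), given by the angles of its
end points: `{e^{iθ} : lo < θ < hi}` with `lo < hi < lo + 2π`. -/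
structure Arc where
  lo : ℝ
  hi : ℝ
  lo_lt_hi : lo < hi
  hi_lt : hi < lo + 2 * Real.pi

/-- The preimage of the interval under `θ ↦ e^{iθ}`. -/
def Arc.angles (I : Arc) : Set ℝ :=
  {θ | ∃ k : ℤ, θ + k * (2 * Real.pi) ∈ Set.Ioo I.lo I.hi}

/-- `J` is a subinterval of `I`, with its angles chosen in `(I.lo, I.hi)`. -/
def Arc.Sub (J I : Arc) : Prop := I.lo ≤ J.lo ∧ J.hi ≤ I.hi

/-- For subintervals `J`, `K` of an interval `I`: all angles of `J` are smaller than those of `K`.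
In particular `J` and `K` are disjoint. -/
def Arc.Before (J K : Arc) : Prop := J.hi ≤ K.lo

/-- `supp f ⊆ I`, for the closed support. -/
def Loop.SupportedIn {F : Type*} [NormedAddCommGroup F] [NormedSpace ℝ F] (f : Loop F)
    (I : Arc) : Prop :=
  tsupport f.toFun ⊆ I.angles

variable (F) in
/-- The Weyl unitaries `W([f])` of loops supported in `I`. -/
def localWeyl (I : Arc) : Set (Fock (ModeIndex F) →L[ℂ] Fock (ModeIndex F)) :=
  {T | ∃ f : Loop F, f.SupportedIn I ∧ T = weyl f.oneParticle}

variable (F) in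
/-- The local von Neumann algebra `𝒜_F(I) = {W([f]) : supp f ⊆ I}''` (the bicommutant of the set
and of its adjoints). -/
def localAlgebra (I : Arc) : VonNeumannAlgebra (Fock (ModeIndex F)) where
  toStarSubalgebra := StarSubalgebra.centralizer ℂ
    (StarSubalgebra.centralizer ℂ (localWeyl F I) :
      Set (Fock (ModeIndex F) →L[ℂ] Fock (ModeIndex F)))
  centralizer_centralizer' := by
    change Set.centralizer (Set.centralizer (Set.centralizer _)) = Set.centralizer _
    exact Set.centralizer_centralizer_centralizer _

variable (F) in
/-- The `*`-algebra underlying `𝒜_F(I)`. -/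
abbrev Alg (I : Arc) : Type := (localAlgebra F I).toStarSubalgebra

/-- Unital `*`-endomorphisms of `𝒜_F(I)`. -/
abbrev Endo (F : Type*) [NormedAddCommGroup F] [InnerProductSpace ℝ F] [FiniteDimensional ℝ F]
    (I : Arc) : Type := Alg F I →⋆ₐ[ℂ] Alg F I

variable {I : Arc}

/-- Normality (σ-weak continuity): every vector functional `a ↦ ⟨x, ρ(a) y⟩` is of the form
`a ↦ ∑ₙ ⟨ξₙ, a ηₙ⟩` with `∑ ‖ξₙ‖² < ∞` and `∑ ‖ηₙ‖² < ∞`. -/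
def IsNormal (ρ : Endo F I) : Prop :=
  ∀ x y : Fock (ModeIndex F), ∃ ξ η : lp (fun _ : ℕ => Fock (ModeIndex F)) 2, ∀ a : Alg F I,
    inner ℂ x ((ρ a).1 y) = ∑' n, inner ℂ (ξ n) (a.1 (η n))

/-- `ρ` is the localized gauge automorphism `ρ_ℓ` of `𝒜_F(I)`: the normal automorphism with
`ρ(W([f])) = exp(i ∫ ⟨f, ℓ⟩ dθ/2π) W([f])` whenever `supp f ⊆ I`. -/
def IsGaugeAut (ℓ : Loop F) (ρ : Endo F I) : Prop :=
  Function.Bijective ρ ∧ IsNormal ρ ∧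
    ∀ (f : Loop F) (w : Alg F I), f.SupportedIn I → w.1 = weyl f.oneParticle →
      ρ w = Complex.exp (Complex.I *
        (((2 * Real.pi)⁻¹ * ∫ θ in (0 : ℝ)..(2 * Real.pi), inner ℝ (f θ) (ℓ θ) : ℝ) : ℂ)) • w

/-- The intertwiners `(ρ, σ) = {t ∈ 𝒜_F(I) : t ρ(x) = σ(x) t for all x}`. -/
def intertwiners (ρ σ : Endo F I) : Set (Alg F I) :=
  {t | ∀ x : Alg F I, t * ρ x = σ x * t}

/-- `ρ` is (the action on `𝒜_F(I)` of) an endomorphism localized in the subinterval `J` of `I`: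
it is normal and acts trivially on `𝒜_F(K)` for all subintervals `K` of `I` disjoint from `J`. -/
def IsLocalizedIn (ρ : Endo F I) (J : Arc) : Prop :=
  IsNormal ρ ∧ ∀ K : Arc, K.Sub I → (K.Before J ∨ J.Before K) →
    ∀ a : Alg F I, a.1 ∈ localAlgebra F K → ρ a = a

/-- All values of the Doplicher-Haag-Roberts / Fredenhagen-Rehren-Schroer expression
`σ(u*) v* u ρ(v)`, where `u ∈ (ρ, ρ')`, `v ∈ (σ, σ')` are unitary charge transporters to
endomorphisms `ρ'`, `σ'` localized in subintervals `J₁`, `J₂` of `I`, and `J₂` precedes `J₁` in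
the order of increasing angle (so `J₁` precedes `J₂` clockwise). -/
def braidingValues (ρ σ : Endo F I) : Set (Alg F I) :=
  {ε | ∃ (J₁ J₂ : Arc) (ρ' σ' : Endo F I) (u v : Alg F I),
    J₁.Sub I ∧ J₂.Sub I ∧ J₂.Before J₁ ∧ IsLocalizedIn ρ' J₁ ∧ IsLocalizedIn σ' J₂ ∧
    u ∈ unitary (Alg F I) ∧ v ∈ unitary (Alg F I) ∧
    u ∈ intertwiners ρ ρ' ∧ v ∈ intertwiners σ σ' ∧
    ε = σ (star u) * star v * u * ρ v}

/-- The braiding `ε(ρ, σ)` exists, does not depend on the choices, and is equal to `ε`. -/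
def IsBraiding (ρ σ : Endo F I) (ε : Alg F I) : Prop := braidingValues ρ σ = {ε}

end Net

end FreeBoson

end

open FreeBoson

/-! A loop `ℓ` with non-zero charge has no periodic primitive, but after subtraction of a loop `k`
of the same charge supported outside `I` it has one. Let `ζ` be the class of a primitive of `ℓ - k`.
Since `2 Im ⟨ζ, [f]⟩ = -∫ ⟨f, ℓ - k⟩ dθ/2π` and `k` does not meet loops supported in `I`, the Weyl
relations show that `Ad W(ζ)` has the action prescribed for `ρ_ℓ`. It is normal and bijective on the
local algebra, and any normal endomorphism with these values equals it, because a normal functional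
on a von Neumann algebra is determined by its values on a self-adjoint multiplicative system of
generators (`tsum_inner_eq_inner_of_bicommutant`).

If `ℓ'` has the charge of `ℓ` and is supported in `J ⊆ I`, then `ℓ' - ℓ` is neutral, its primitive
is supported in `I`, and its class `μ` gives a charge transporter `W(μ)` to an automorphism
localized in `J`. With these transporters the braiding is a product of Weyl operators, hence the
phase `2 (Im ⟨ζ₁, ζ₂⟩ - Im ⟨ζ₁ + μ₁, ζ₂ + μ₂⟩)`. For the prescribed order of `J₁` and `J₂` this is
`∫ ⟨L₁, ℓ₂⟩ dθ/2π`, where `L₁` is the primitive of `ℓ₁` that starts at the lower end of `I`. It is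
`2π ⟨q(ℓ₁), q(ℓ₂)⟩` if `ℓ₁` comes before `ℓ₂`, zero in the opposite order, and half of the full
value for multiples of one loop, as `∫ Λ Λ' = Λ² / 2`.

The hard point is independence of the choices, for arbitrary transporters and arbitrary localized
endomorphisms. Writing `u = w₁ W(μ₁)` and `v = w₂ W(μ₂)`, one knows only that `w₁` and `w₂` commute
with Weyl operators of loops in the arcs away from `J₁` and `J₂`. To cancel them one needs Haag
duality together with strong additivity: for a circle cut into consecutive arcs `J₁, J₂, J₃`, an
operator commuting with the Weyl operators of `J₁` commutes with any operator commuting with those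
of `J₂` and `J₃` (`commute_of_arcs`).

This duality is proved in two stages. On the one-particle space, a vector real-orthogonal to the
loops in `J₁` and symplectically orthogonal to those in `J₂` and `J₃` corresponds to a function of
Hardy type on the circle. After subtraction of a constant it is real on one arc and imaginary on the
other two; `H^{1/2}` regularity excludes a jump between these two. Its square is then real with
nonnegative spectrum, so it is constant (`eq_zero_of_hardy_dual`). The passage to Fock space
(`commute_of_isDual`) goes through the tensor powers. Duality of real subspaces is inherited by
tensor products, because a bounded bilinear form that is imaginary on one pair of subspaces and real
on the dual pair vanishes (`form_eq_zero`), and the vacuum then separates commutators. -/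

noncomputable section
namespace FreeBoson

/-! ### Symplectic complements of real subspaces, and bilinear forms on them -/

section SymplecticPair

variable {E E₁ E₂ : Type*} [NormedAddCommGroup E] [InnerProductSpace ℂ E]
  [NormedAddCommGroup E₁] [InnerProductSpace ℂ E₁] [CompleteSpace E₁]
  [NormedAddCommGroup E₂] [InnerProductSpace ℂ E₂] [CompleteSpace E₂]

/-- `K` and `L` are real subspaces that are the symplectic complements of each other. -/
def IsSymplecticPair (K L : Set E) : Prop :=
  (∀ v, v ∈ K ↔ ∀ l ∈ L, (inner ℂ v l).im = 0) ∧ ∀ v, v ∈ L ↔ ∀ k ∈ K, (inner ℂ v k).im = 0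

/-- The vectors orthogonal to `K` vanish. -/
def IsTotal (K : Set E) : Prop := ∀ h, (∀ k ∈ K, inner ℂ h k = 0) → h = 0

/-- Real linear maps that commute with a positive operator up to a phase: if `A ≥ 0` maps a closed
real subspace `K` into `iK`, then it maps `K` into `K`. -/
theorem apply_mem_of_I_smul_apply_mem (A : E₁ →L[ℂ] E₁) (hA : 0 ≤ A) (K : Submodule ℝ E₁)
    (hK : IsClosed (K : Set E₁)) (h : ∀ k ∈ K, Complex.I • A k ∈ K) (k : E₁) (hk : k ∈ K) :
    A k ∈ K := by
  have hsa : IsSelfAdjoint A := .of_nonneg hA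
  have hsq : ∀ k ∈ K, (A * A) k ∈ K := by
    intro k hk
    -- Applying `iA` twice gives `-A²`, so `A²` preserves `K`.
    have := K.neg_mem (h _ (h k hk))
    rw [map_smul, smul_smul, Complex.I_mul_I, neg_one_smul, neg_neg] at this
    exact this
  have hpow : ∀ n : ℕ, ∀ k ∈ K, ((A * A) ^ n) k ∈ K := by
    intro n
    induction n with
    | zero => intro k hk; simpa using hk
    | succ n ih => intro k hk; rw [pow_succ]; exact ih _ (hsq k hk)
  have hpoly : ∀ p : Polynomial ℝ, (Polynomial.aeval (A * A) p) k ∈ K := by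
    intro p
    rw [Polynomial.aeval_eq_sum_range]
    rw [_root_.sum_apply]
    exact K.sum_mem fun n _ => K.smul_mem _ (hpow n k hk)
  -- As `A ≥ 0`, `A` is the square root of `A²`; by Weierstrass it is a norm limit of real
  -- polynomials in `A²`, and these preserve `K`.
  refine hK.closure_subset_iff.2 subset_rfl (Metric.mem_closure_iff.2 fun ε hε => ?_)
  -- The spectral bound carries the norm of `1`, which is `0` on the zero space.
  set R : ℝ := ‖A‖ * ‖(1 : E₁ →L[ℂ] E₁)‖
  have hR : 0 ≤ R := by positivity
  obtain ⟨p, hp⟩ := exists_polynomial_near_of_continuousOn 0 (R ^ 2) Real.sqrt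
    Real.continuous_sqrt.continuousOn (ε / (2 * (‖k‖ + 1))) (by positivity)
  refine ⟨_, hpoly p, ?_⟩
  have h1 : A - Polynomial.aeval (A * A) p = cfc (fun t : ℝ => t - p.eval (t ^ 2)) A := by
    rw [cfc_sub (fun t : ℝ => t) (fun t : ℝ => p.eval (t ^ 2)) A (by fun_prop) (by fun_prop),
      cfc_id' ℝ A]
    congr 1
    rw [cfc_map_polynomial p (fun t : ℝ => t ^ 2) A, cfc_pow_id (R := ℝ) A 2, sq]
  have h2 : ‖A - Polynomial.aeval (A * A) p‖ ≤ ε / (2 * (‖k‖ + 1)) := by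
    rw [h1]
    refine norm_cfc_le (by positivity) fun t ht => ?_
    have ht0 : 0 ≤ t := spectrum_nonneg_of_nonneg hA ht
    have htR : t ≤ R := by
      have := spectrum.norm_le_norm_mul_of_mem ht
      exact (le_abs_self t).trans this
    have := hp (t ^ 2) ⟨by positivity, by gcongr⟩
    rw [Real.sqrt_sq ht0] at this
    rw [norm_sub_rev]
    exact this.le
  rw [dist_eq_norm, ← _root_.sub_apply]
  calc _ ≤ _ := ContinuousLinearMap.le_opNorm _ _
    _ ≤ ε / (2 * (‖k‖ + 1)) * ‖k‖ := by gcongr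
    _ < ε := by
      rw [div_mul_eq_mul_div, div_lt_iff₀ (by positivity)]
      nlinarith [norm_nonneg k]

/-- A bounded bilinear form that is imaginary on `K₁ × K₂` and real on `L₁ × L₂` vanishes. -/
theorem form_eq_zero {K₁ L₁ : Set E₁} {K₂ L₂ : Set E₂} (h₁ : IsSymplecticPair K₁ L₁)
    (h₂ : IsSymplecticPair K₂ L₂) (hK : IsTotal K₁) (hL : IsTotal L₁)
    (B : E₁ →L[ℂ] E₂ →L[ℂ] ℂ) (hBK : ∀ x ∈ K₁, ∀ y ∈ K₂, (B x y).re = 0)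
    (hBL : ∀ x ∈ L₁, ∀ y ∈ L₂, (B x y).im = 0) : B = 0 := by
  -- By Riesz, `B` is an antilinear operator `S`; with its antilinear adjoint `S'`, the operator `A
  -- = S'S` is linear and positive. It suffices to show `A = 0`.
  let S : E₁ →L⋆[ℂ] E₂ :=
    ((InnerProductSpace.toDual ℂ E₂).symm.toContinuousLinearEquiv : _ →L⋆[ℂ] E₂).comp B
  let S' : E₂ →L⋆[ℂ] E₁ :=
    ((InnerProductSpace.toDual ℂ E₁).symm.toContinuousLinearEquiv : _ →L⋆[ℂ] E₁).comp B.flip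
  have hS : ∀ x y, inner ℂ (S x) y = B x y := fun x y =>
    InnerProductSpace.toDual_symm_apply
  have hS' : ∀ x y, inner ℂ (S' y) x = B x y := fun x y =>
    InnerProductSpace.toDual_symm_apply
  let A : E₁ →L[ℂ] E₁ := S'.comp S
  have hA : ∀ x y, inner ℂ (A x) y = inner ℂ (S y) (S x) := fun x y => by
    rw [hS]; exact hS' _ _
  have hpos : 0 ≤ A := by
    rw [ContinuousLinearMap.nonneg_iff_isPositive, ContinuousLinearMap.isPositive_def']
    refine ⟨?_, fun x => ?_⟩
    · rw [ContinuousLinearMap.isSelfAdjoint_iff_isSymmetric]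
      intro x y
      change inner ℂ (A x) y = inner ℂ x (A y)
      rw [hA, ← inner_conj_symm x, hA, inner_conj_symm]
    · rw [ContinuousLinearMap.reApplyInnerSelf_apply, hA]
      exact inner_self_nonneg
  let K : Submodule ℝ E₁ :=
    { carrier := K₁
      add_mem' := by
        intro a b ha hb
        rw [h₁.1] at ha hb ⊢
        intro l hl
        rw [inner_add_left, Complex.add_im, ha l hl, hb l hl, add_zero]
      zero_mem' := by
        rw [h₁.1]
        intro l _
        simp
      smul_mem' := by
        intro c a ha
        rw [h₁.1] at ha ⊢
        intro l hl
        rw [← Complex.coe_smul c a, inner_smul_left, Complex.conj_ofReal, Complex.im_ofReal_mul, ha l hl, mul_zero]}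
  have hclosed : IsClosed (K : Set E₁) := by
    have : (K : Set E₁) = ⋂ l ∈ L₁, {v | (inner ℂ v l).im = 0} := by
      ext v
      simp only [Set.mem_iInter]
      exact h₁.1 v
    rw [this]
    exact isClosed_biInter fun l _ => isClosed_eq (by fun_prop) continuous_const
  -- `B` imaginary on `K₁ × K₂` means that `iS` maps `K₁` into `L₂`, and `B` real on `L₁ × L₂` means
  -- that `S` maps `L₁` into `K₂`. Hence `Re ⟨A k, l⟩ = Re ⟨S l, S k⟩ = 0` for `l ∈ L₁`.
  have hIK : ∀ k ∈ K, Complex.I • A k ∈ K := by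
    intro k hk
    have h1 : Complex.I • S k ∈ L₂ := (h₂.2 _).2 fun y hy => by
      have := hBK k hk y hy
      rw [← hS] at this
      simp [this]
    refine (h₁.1 _).2 fun l hl => ?_
    have h2 : S l ∈ K₂ := (h₂.1 _).2 fun y hy => by rw [hS]; exact hBL l hl y hy
    have h3 := (h₂.1 _).1 h2 _ h1
    rw [inner_smul_right, ← hA] at h3
    rw [inner_smul_left]
    simp only [Complex.mul_im, Complex.I_re, Complex.I_im, Complex.conj_I, Complex.neg_re, Complex.neg_im] at h3 ⊢
    linarith
  -- Positivity upgrades `iAk ∈ K` to `Ak ∈ K`, and totality of `L₁` forces `K ∩ iK = 0`.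
  have hA0 : ∀ k ∈ K₁, A k = 0 := by
    intro k hk
    have h1 := apply_mem_of_I_smul_apply_mem A hpos K hclosed hIK k hk
    have h2 := hIK k hk
    refine hL _ fun l hl => ?_
    have h3 := (h₁.1 _).1 h1 l hl
    have h4 := (h₁.1 _).1 h2 l hl
    refine Complex.ext ?_ h3
    rw [inner_smul_left] at h4
    simpa using h4
  have hS0 : ∀ x, S x = 0 := by
    intro x
    have : A x = 0 := hK _ fun k hk => by
      have := hA k x
      rw [hA, ← inner_conj_symm, ← this, hA0 k hk]
      simp
    rw [← inner_self_eq_zero (𝕜 := ℂ), ← hA, this, inner_zero_left]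
  ext x y
  rw [← hS, hS0]
  simp

/-- Duality of two sets of vectors: `X` and `Y` are symplectically orthogonal, and only the zero
vector is orthogonal (for the real inner product) to `X` and to `iY`. -/
structure IsDual (X Y : Set E) : Prop where
  im_inner : ∀ x ∈ X, ∀ y ∈ Y, (inner ℂ x y).im = 0
  eq_zero : ∀ v : E, (∀ x ∈ X, (inner ℂ v x).re = 0) → (∀ y ∈ Y, (inner ℂ v y).im = 0) → v = 0

/-- If `X` and `Y` are dual, then their symplectic complements are symplectically orthogonal. -/
theorem IsDual.im_inner_complements {X Y : Set E₁} (hd : IsDual X Y)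
    (v w : E₁) (hv : ∀ y ∈ Y, (inner ℂ v y).im = 0) (hw : ∀ x ∈ X, (inner ℂ w x).im = 0) :
    (inner ℂ v w).im = 0 := by
  let _ : InnerProductSpace ℝ E₁ := InnerProductSpace.rclikeToReal ℂ E₁
  let U : Submodule ℝ E₁ := (Submodule.span ℝ X).topologicalClosure
  have hU : ∀ z : E₁, (∀ x ∈ X, (inner ℂ x z).im = 0) → ∀ p ∈ U, (inner ℂ p z).im = 0 := by
    intro z hz p hp
    have hsub : Submodule.span ℝ X ≤
        LinearMap.ker (Complex.imLm.comp
          ((innerₛₗ ℂ z : E₁ →ₗ[ℂ] ℂ).restrictScalars ℝ)) := by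
      rw [Submodule.span_le]
      intro x hx
      have := hz x hx
      rw [← inner_conj_symm, Complex.conj_im, neg_eq_zero] at this
      exact this
    have hcl : IsClosed {p : E₁ | (inner ℂ p z).im = 0} :=
      isClosed_eq (by fun_prop) continuous_const
    refine hcl.closure_subset_iff.2 (fun x hx => ?_) hp
    have := hsub hx
    change (inner ℂ z x).im = 0 at this
    change (inner ℂ x z).im = 0
    rw [← inner_conj_symm, Complex.conj_im, this, neg_zero]
  have : CompleteSpace U := (Submodule.isClosed_topologicalClosure _).completeSpace_coe
  -- In fact `v` lies in the closed real span of `X`: the remainder `q` is real-orthogonal to `X`,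
  -- and symplectically orthogonal to `Y` because `v` and `p` are, so duality kills it.
  obtain ⟨p, hp, q, hq, rfl⟩ := Submodule.exists_add_mem_mem_orthogonal (𝕜 := ℝ) (K := U) v
  have hq0 : q = 0 := by
    refine hd.eq_zero q (fun x hx => ?_) fun y hy => ?_
    · have := hq x (Submodule.le_topologicalClosure _ (Submodule.subset_span hx))
      rw [← inner_conj_symm, Complex.conj_re]
      exact this
    · have h1 := hv y hy
      rw [inner_add_left, Complex.add_im, hU y (fun x hx => hd.im_inner x hx y hy) p hp, zero_add] at h1
      exact h1
  rw [hq0, add_zero]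
  refine hU w (fun x hx => ?_) p hp
  rw [← inner_conj_symm, Complex.conj_im, hw x hx, neg_zero]

/-- If `X` and `Y` are dual, then their symplectic complements form a symplectic pair. -/
theorem IsDual.isSymplecticPair {X Y : Set E₁} (hd : IsDual X Y) :
    IsSymplecticPair {v : E₁ | ∀ y ∈ Y, (inner ℂ v y).im = 0}
      {v : E₁ | ∀ x ∈ X, (inner ℂ v x).im = 0} := by
  have hYX : ∀ y ∈ Y, ∀ x ∈ X, (inner ℂ y x).im = 0 := fun y hy x hx => by
    rw [← inner_conj_symm, Complex.conj_im, hd.im_inner x hx y hy, neg_zero]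
  refine ⟨fun v => ⟨fun hv w hw => hd.im_inner_complements v w hv hw,
    fun hv y hy => hv y (hYX y hy)⟩, fun w => ⟨fun hw v hv => ?_, fun hw x hx => hw x (hd.im_inner x hx)⟩⟩
  rw [← inner_conj_symm, Complex.conj_im, hd.im_inner_complements v w hv hw,
    neg_zero]

/-- A real-linear condition on `X` extends to the symplectic complement of `Y`. If `z` represents
`f`, vanishing of `Re f` on `X` says that `iz` is symplectically orthogonal to `X`. -/
theorem IsDual.re_apply_eq_zero {X Y : Set E₁} (hd : IsDual X Y) (f : E₁ →L[ℂ] ℂ)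
    (hf : ∀ x ∈ X, (f x).re = 0) (v : E₁) (hv : ∀ y ∈ Y, (inner ℂ v y).im = 0) :
    (f v).re = 0 := by
  obtain ⟨z, rfl⟩ := (InnerProductSpace.toDual ℂ E₁).surjective f
  simp only [InnerProductSpace.toDual_apply_apply] at hf ⊢
  have := hd.im_inner_complements v (Complex.I • z) hv fun x hx => by
    simp [hf x hx]
  rw [← inner_conj_symm, Complex.conj_im, neg_eq_zero] at this
  simpa [inner_smul_left] using this

theorem IsDual.im_apply_eq_zero {X Y : Set E₁} (hd : IsDual X Y) (f : E₁ →L[ℂ] ℂ)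
    (hf : ∀ y ∈ Y, (f y).im = 0) (v : E₁) (hv : ∀ x ∈ X, (inner ℂ v x).im = 0) :
    (f v).im = 0 := by
  obtain ⟨z, rfl⟩ := (InnerProductSpace.toDual ℂ E₁).surjective f
  exact hd.im_inner_complements z v hf hv

/-- A bounded bilinear form that is imaginary on `X₁ × X₂` and real on `Y₁ × Y₂` vanishes. -/
theorem IsDual.form_eq_zero {X₁ Y₁ : Set E₁} {X₂ Y₂ : Set E₂} (h₁ : IsDual X₁ Y₁)
    (h₂ : IsDual X₂ Y₂) (hX : IsTotal X₁) (hY : IsTotal Y₁)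
    (B : E₁ →L[ℂ] E₂ →L[ℂ] ℂ) (hBX : ∀ x ∈ X₁, ∀ y ∈ X₂, (B x y).re = 0)
    (hBY : ∀ x ∈ Y₁, ∀ y ∈ Y₂, (B x y).im = 0) : B = 0 := by
  -- The symplectic pair consists of the complements of `Y` and of `X`, which contain `X` and `Y`
  -- respectively. The hypotheses on `B` are extended to these complements one variable at a time.
  refine FreeBoson.form_eq_zero h₁.isSymplecticPair h₂.isSymplecticPair
    (fun v hv => hX v fun x hx => hv x (h₁.im_inner x hx))
    (fun v hv => hY v fun y hy => hv y fun x hx => ?_) B (fun v hv w hw => ?_) fun v hv w hw => ?_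
  · rw [← inner_conj_symm, Complex.conj_im, h₁.im_inner x hx y hy, neg_zero]
  · exact h₂.re_apply_eq_zero (B v)
      (fun y hy => h₁.re_apply_eq_zero (B.flip y) (fun x hx => hBX x hx y hy) v hv) w hw
  · exact h₂.im_apply_eq_zero (B v)
      (fun y hy => h₁.im_apply_eq_zero (B.flip y) (fun x hx => hBY x hx y hy) v hv) w hw

end SymplecticPair

/-! ### Elementary tensors, and duality for tensor powers -/

section Tensor

variable {ι : Type}

/-- Products of square-summable families are square-summable. -/
theorem memℓp_consMul {n : ℕ} (h : HilbertSeq ι) (y : HilbertSeq (Fin n → ι)) :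
    Memℓp (fun i : Fin (n + 1) → ι => h (i 0) * y (Fin.tail i)) 2 := by
  refine memℓp_gen ?_
  have h1 : Summable fun i => ‖h i‖ ^ (2 : ℝ) := by
    simpa using (lp.memℓp h).summable (by simp)
  have h2 : Summable fun i => ‖y i‖ ^ (2 : ℝ) := by
    simpa using (lp.memℓp y).summable (by simp)
  rw [← (Fin.consEquiv fun _ => ι).summable_iff]
  refine (h1.mul_of_nonneg h2 (fun _ => by positivity) fun _ => by positivity).congr fun p => ?_
  simp [mul_pow, Fin.consEquiv]

/-- The vector `h ⊗ y`. -/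
def consMul {n : ℕ} (h : HilbertSeq ι) (y : HilbertSeq (Fin n → ι)) :
    HilbertSeq (Fin (n + 1) → ι) :=
  ⟨_, memℓp_consMul h y⟩

theorem consMul_apply {n : ℕ} (h : HilbertSeq ι) (y : HilbertSeq (Fin n → ι))
    (i : Fin (n + 1) → ι) : consMul h y i = h (i 0) * y (Fin.tail i) := rfl

theorem inner_consMul {n : ℕ} (h h' : HilbertSeq ι) (y y' : HilbertSeq (Fin n → ι)) :
    inner ℂ (consMul h y) (consMul h' y') = inner ℂ h h' * inner ℂ y y' := by
  have h1 := (lp.hasSum_inner (𝕜 := ℂ) h h').mul (lp.hasSum_inner (𝕜 := ℂ) y y')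
    (summable_mul_of_summable_norm (f := fun i => inner ℂ (h i) (h' i))
      (g := fun i => inner ℂ (y i) (y' i)) (lp.summable_inner (𝕜 := ℂ) h h').norm
      (lp.summable_inner (𝕜 := ℂ) y y').norm)
  have h2 := lp.hasSum_inner (𝕜 := ℂ) (consMul h y) (consMul h' y')
  rw [← (Fin.consEquiv fun _ => ι).hasSum_iff] at h2
  have h3 : ∀ p : ι × (Fin n → ι), inner ℂ (consMul h y (Fin.cons p.1 p.2))
      (consMul h' y' (Fin.cons p.1 p.2)) =
      inner ℂ (h p.1) (h' p.1) * inner ℂ (y p.2) (y' p.2) := by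
    intro p
    simp only [consMul_apply, Fin.cons_zero, Fin.tail_cons, RCLike.inner_apply, map_mul]
    ring
  exact h2.unique (h1.congr_fun h3)

theorem norm_consMul {n : ℕ} (h : HilbertSeq ι) (y : HilbertSeq (Fin n → ι)) :
    ‖consMul h y‖ = ‖h‖ * ‖y‖ := by
  rw [← sq_eq_sq₀ (norm_nonneg _) (by positivity), mul_pow]
  have := inner_consMul h h y y
  simp only [inner_self_eq_norm_sq_to_K] at this
  exact_mod_cast this

/-- `h ⊗ y` as a bounded bilinear map. -/
def consMulL (n : ℕ) : HilbertSeq ι →L[ℂ] HilbertSeq (Fin n → ι) →L[ℂ] HilbertSeq (Fin (n + 1) → ι) :=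
  LinearMap.mkContinuous₂
    (LinearMap.mk₂ ℂ consMul
      (fun a b c => lp.ext (funext fun i => by simp [consMul_apply, add_mul]))
      (fun t a b => lp.ext (funext fun i => by simp [consMul_apply, mul_assoc]))
      (fun a b c => lp.ext (funext fun i => by simp [consMul_apply, mul_add]))
      (fun t a b => lp.ext (funext fun i => by simp [consMul_apply, mul_left_comm]))) 1
    fun h y => by rw [one_mul]; exact (norm_consMul h y).le

/-- The vector `ξ₀ ⊗ ⋯ ⊗ ξₙ₋₁`. -/
def tens : {n : ℕ} → (Fin n → HilbertSeq ι) → HilbertSeq (Fin n → ι)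
  | 0, _ => ⟨fun _ => 1, memℓp_gen (hasSum_fintype _).summable⟩
  | _ + 1, ξ => consMul (ξ 0) (tens (Fin.tail ξ))

theorem tens_apply {n : ℕ} (ξ : Fin n → HilbertSeq ι) (i : Fin n → ι) :
    tens ξ i = ∏ j, ξ j (i j) := by
  induction n with
  | zero => rfl
  | succ n ih =>
    rw [Fin.prod_univ_succ, tens, consMul_apply, ih]
    rfl

theorem inner_tens {n : ℕ} (ξ η : Fin n → HilbertSeq ι) :
    inner ℂ (tens ξ) (tens η) = ∏ j, inner ℂ (ξ j) (η j) := by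
  induction n with
  | zero =>
    rw [lp.inner_eq_tsum]
    simp [tens]
  | succ n ih =>
    rw [Fin.prod_univ_succ, tens, tens, inner_consMul, ih]
    rfl

/-- The elementary tensors with factors in `X`. -/
def tensSet (X : Set (HilbertSeq ι)) (n : ℕ) : Set (HilbertSeq (Fin n → ι)) :=
  {v | ∃ ξ : Fin n → HilbertSeq ι, (∀ j, ξ j ∈ X) ∧ v = tens ξ}

theorem im_inner_tensSet {X Y : Set (HilbertSeq ι)}
    (h : ∀ x ∈ X, ∀ y ∈ Y, (inner ℂ x y).im = 0) (n : ℕ) :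
    ∀ x ∈ tensSet X n, ∀ y ∈ tensSet Y n, (inner ℂ x y).im = 0 := by
  rintro _ ⟨ξ, hξ, rfl⟩ _ ⟨η, hη, rfl⟩
  rw [inner_tens]
  have : ∀ j, inner ℂ (ξ j) (η j) = (((inner ℂ (ξ j) (η j)).re : ℝ) : ℂ) := fun j =>
    Complex.ext rfl (h _ (hξ j) _ (hη j))
  rw [Finset.prod_congr rfl fun j _ => this j, ← Complex.ofReal_prod, Complex.ofReal_im]

/-- Split off one tensor factor. A vector `v` of degree `n + 1` orthogonal in the sense of duality
gives the form `(x, y) ↦ ⟨v, x ⊗ y⟩`, imaginary on the `X`-tensors and real on the `Y`-tensors, so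
`IsDual.form_eq_zero` and induction apply. -/
theorem IsDual.tensSet {X Y : Set (HilbertSeq ι)} (h : IsDual X Y) (hX : IsTotal X)
    (hY : IsTotal Y) (n : ℕ) : IsDual (tensSet X n) (tensSet Y n) := by
  classical
  refine ⟨im_inner_tensSet h.im_inner n, ?_⟩
  induction n with
  | zero =>
    intro v h1 h2
    -- In degree zero both sets contain the same vector, the empty tensor; one controls the real
    -- part and the other the imaginary part.
    have h1' := h1 (tens Fin.elim0) ⟨_, fun j => j.elim0, rfl⟩
    have h2' := h2 (tens Fin.elim0) ⟨_, fun j => j.elim0, rfl⟩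
    have : inner ℂ v (tens Fin.elim0) = 0 := Complex.ext h1' h2'
    rw [lp.inner_eq_tsum] at this
    refine lp.ext (funext fun i => ?_)
    rw [Subsingleton.elim i default]
    simpa [tens] using this
  | succ n ih =>
    intro v h1 h2
    have hB := h.form_eq_zero ⟨im_inner_tensSet h.im_inner n, ih⟩ hX hY
      ((ContinuousLinearMap.compL ℂ _ _ _ (innerSL ℂ v)).comp (consMulL n))
      (by
        rintro x hx _ ⟨ξ, hξ, rfl⟩
        exact h1 _ ⟨Fin.cons x ξ, Fin.cases hx hξ, by rw [tens]; rfl⟩)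
      (by
        rintro x hx _ ⟨ξ, hξ, rfl⟩
        exact h2 _ ⟨Fin.cons x ξ, Fin.cases hx hξ, by rw [tens]; rfl⟩)
    refine lp.ext (funext fun i => ?_)
    -- The basis vectors of the tensor power are elementary tensors, so the vanishing form has all
    -- coordinates of `v` among its values.
    have h3 : consMul (lp.single 2 (i 0) (1 : ℂ)) (lp.single 2 (Fin.tail i) (1 : ℂ)) =
        lp.single 2 i (1 : ℂ) := by
      refine lp.ext (funext fun k => ?_)
      rw [consMul_apply]
      by_cases hk : k = i
      · subst hk; simp
      · rw [lp.coeFn_single, lp.coeFn_single, lp.coeFn_single, Pi.single_eq_of_ne hk]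
        by_cases h0 : k 0 = i 0
        · have : Fin.tail k ≠ Fin.tail i := fun ht => hk <| by
            rw [← Fin.cons_self_tail k, ← Fin.cons_self_tail i, h0, ht]
          rw [Pi.single_eq_of_ne this, mul_zero]
        · rw [Pi.single_eq_of_ne h0, zero_mul]
    have h4 : inner ℂ v (consMul (lp.single 2 (i 0) (1 : ℂ)) (lp.single 2 (Fin.tail i) (1 : ℂ)))
        = 0 := congrArg (fun B => B (lp.single 2 (i 0) (1 : ℂ)) (lp.single 2 (Fin.tail i) (1 : ℂ))) hB
    rw [h3, lp.inner_single_right] at h4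
    simpa using h4

end Tensor

/-! ### Polarization of symmetric tensors -/

section Polarization

open Finset in
/-- Ryser's formula. -/
theorem sum_powerset_neg_one_pow_card_mul_prod_sum {n : ℕ} (z : Fin n → Fin n → ℂ) :
    ∑ s : Finset (Fin n), (-1 : ℂ) ^ s.card * ∏ m, ∑ j ∈ s, z j m =
      (-1) ^ n * ∑ σ : Equiv.Perm (Fin n), ∏ m, z (σ m) m := by
  classical
  have h1 : ∀ s : Finset (Fin n), ∏ m, ∑ j ∈ s, z j m =
      ∑ g : Fin n → Fin n, if (∀ m, g m ∈ s) then ∏ m, z (g m) m else 0 := by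
    intro s
    rw [Finset.prod_univ_sum, ← Finset.sum_filter]
    refine Finset.sum_congr ?_ fun _ _ => rfl
    ext g
    simp [Fintype.mem_piFinset]
  simp only [h1, Finset.mul_sum (s := (Finset.univ : Finset (Fin n → Fin n)))]
  rw [Finset.sum_comm]
  have h2 : ∀ g : Fin n → Fin n, ¬ Function.Surjective g →
      ∑ s : Finset (Fin n), (-1 : ℂ) ^ s.card *
        (if (∀ m, g m ∈ s) then ∏ m, z (g m) m else 0) = 0 := by
    intro g hg
    simp only [Function.Surjective, not_forall, not_exists] at hg
    obtain ⟨b, hb⟩ := hg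
    -- If `g` misses the value `b`, adding or removing `b` does not affect the condition on `s` but
    -- flips the sign.
    refine Finset.sum_involution (fun s _ => if b ∈ s then s.erase b else insert b s) ?_ ?_ ?_ ?_
    · intro s _
      by_cases hbs : b ∈ s
      · have hc : (∀ m, g m ∈ s.erase b) ↔ ∀ m, g m ∈ s := by
          simp [Finset.mem_erase, hb]
        simp only [if_pos hbs, hc]
        rw [← Finset.card_erase_add_one hbs, pow_succ]
        ring
      · have hc : (∀ m, g m ∈ insert b s) ↔ ∀ m, g m ∈ s := by
          simp [Finset.mem_insert, hb]
        simp only [if_neg hbs, hc]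
        rw [Finset.card_insert_of_notMem hbs, pow_succ]
        ring
    · intro s _ _ h
      by_cases hbs : b ∈ s
      · rw [if_pos hbs] at h
        exact (Finset.erase_eq_self.1 h) hbs
      · rw [if_neg hbs] at h
        exact hbs (Finset.insert_eq_self.1 h)
    · intro s _
      exact Finset.mem_univ _
    · intro s _
      by_cases hbs : b ∈ s
      · simp [hbs]
      · simp [hbs]
  -- A permutation takes every value, so only the full set contributes.
  have h3 : ∀ σ : Equiv.Perm (Fin n), ∑ s : Finset (Fin n), (-1 : ℂ) ^ s.card *
      (if (∀ m, σ m ∈ s) then ∏ m, z (σ m) m else 0) = (-1) ^ n * ∏ m, z (σ m) m := by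
    intro σ
    rw [Finset.sum_eq_single Finset.univ]
    · simp
    · intro s _ hs
      rw [if_neg, mul_zero]
      exact fun h => hs (Finset.eq_univ_of_forall fun b => by simpa using h (σ.symm b))
    · simp
  rw [Finset.mul_sum, ← Finset.sum_congr rfl fun σ _ => h3 σ]
  symm
  refine Finset.sum_of_injOn (fun σ : Equiv.Perm (Fin n) => (σ : Fin n → Fin n))
    (fun σ _ τ _ h => DFunLike.coe_injective h) (fun _ _ => Finset.mem_coe.2 (Finset.mem_univ _)) ?_
    fun _ _ => rfl
  intro g _ hg
  refine h2 g fun hs => hg ?_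
  exact ⟨Equiv.ofBijective g (Finite.injective_iff_bijective.1 (Finite.injective_iff_surjective.2 hs)),
    by simp, rfl⟩

variable {ι : Type}

theorem inner_tens_comp_perm {n : ℕ} (ψ : HilbertSeq (Fin n → ι))
    (hψ : ∀ (i : Fin n → ι) (σ : Equiv.Perm (Fin n)), ψ (i ∘ σ) = ψ i)
    (ξ : Fin n → HilbertSeq ι) (σ : Equiv.Perm (Fin n)) :
    inner ℂ ψ (tens (ξ ∘ σ)) = inner ℂ ψ (tens ξ) := by
  rw [lp.inner_eq_tsum, lp.inner_eq_tsum,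
    ← (Equiv.arrowCongr σ.symm (Equiv.refl ι)).tsum_eq]
  refine tsum_congr fun i => ?_
  have : (Equiv.arrowCongr σ.symm (Equiv.refl ι)) i = i ∘ σ := by
    funext j; simp
  rw [this, hψ, tens_apply, tens_apply]
  congr 1
  exact Equiv.prod_comp σ fun j => ξ j (i j)

/-- The polarization identity for symmetric tensors. -/
theorem factorial_mul_inner_tens {n : ℕ} (ψ : HilbertSeq (Fin n → ι))
    (hψ : ∀ (i : Fin n → ι) (σ : Equiv.Perm (Fin n)), ψ (i ∘ σ) = ψ i)
    (ξ : Fin n → HilbertSeq ι) :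
    (n.factorial : ℂ) * inner ℂ ψ (tens ξ) = (-1) ^ n * ∑ s : Finset (Fin n),
      (-1 : ℂ) ^ s.card * inner ℂ ψ (tens fun _ : Fin n => ∑ j ∈ s, ξ j) := by
  have h : ∑ s : Finset (Fin n), (-1 : ℂ) ^ s.card • tens (fun _ : Fin n => ∑ j ∈ s, ξ j) =
      (-1 : ℂ) ^ n • ∑ σ : Equiv.Perm (Fin n), tens (ξ ∘ σ) := by
    refine lp.ext (funext fun i => ?_)
    have := sum_powerset_neg_one_pow_card_mul_prod_sum fun j m => ξ j (i m)
    simp only [lp.coeFn_sum, lp.coeFn_smul, Finset.sum_apply, Pi.smul_apply, smul_eq_mul,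
      tens_apply, Function.comp]
    exact this
  have h2 := congrArg (fun v => inner ℂ ψ v) h
  simp only [inner_sum, inner_smul_right, inner_tens_comp_perm ψ hψ] at h2
  rw [h2, ← mul_assoc, ← mul_pow]
  simp [Fintype.card_perm]

/-- The polarization identity has real coefficients and involves only powers of sums of the `ξ j`,
which stay in the real subspace `X`. -/
theorem re_inner_tens_eq_zero {n : ℕ} (ψ : HilbertSeq (Fin n → ι))
    (hψ : ∀ (i : Fin n → ι) (σ : Equiv.Perm (Fin n)), ψ (i ∘ σ) = ψ i)
    (X : Submodule ℝ (HilbertSeq ι))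
    (h : ∀ x ∈ X, (inner ℂ ψ (tens fun _ : Fin n => x)).re = 0)
    (ξ : Fin n → HilbertSeq ι) (hξ : ∀ j, ξ j ∈ X) : (inner ℂ ψ (tens ξ)).re = 0 := by
  have h1 := congrArg Complex.re (factorial_mul_inner_tens ψ hψ ξ)
  have h2 : ∀ m : ℕ, ((-1 : ℂ) ^ m) = (((-1 : ℝ) ^ m : ℝ) : ℂ) := fun m => by push_cast; rfl
  rw [← Complex.ofReal_natCast, Complex.re_ofReal_mul, h2, Complex.re_ofReal_mul,
    Complex.re_sum, Finset.sum_eq_zero, mul_zero] at h1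
  · exact (mul_eq_zero.1 h1).resolve_left (by positivity)
  · intro s _
    rw [h2, Complex.re_ofReal_mul, h _ (X.sum_mem fun j _ => hξ j), mul_zero]

theorem im_inner_tens_eq_zero {n : ℕ} (ψ : HilbertSeq (Fin n → ι))
    (hψ : ∀ (i : Fin n → ι) (σ : Equiv.Perm (Fin n)), ψ (i ∘ σ) = ψ i)
    (X : Submodule ℝ (HilbertSeq ι))
    (h : ∀ x ∈ X, (inner ℂ ψ (tens fun _ : Fin n => x)).im = 0)
    (ξ : Fin n → HilbertSeq ι) (hξ : ∀ j, ξ j ∈ X) : (inner ℂ ψ (tens ξ)).im = 0 := by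
  have h1 := re_inner_tens_eq_zero (Complex.I • ψ)
    (fun i σ => by simp [hψ i σ]) X (fun x hx => by
      simp [h x hx]) ξ hξ
  simpa [inner_smul_left] using h1

end Polarization

/-! ### Particle-number components and parity -/

section FockComponents

variable {ι : Type}

/-- Uniqueness of the coefficients of a power series. Along the rays `t ↦ e^{tξ}` it separates the
particle numbers. -/
theorem eq_zero_of_forall_hasSum_pow_smul (b : ℕ → ℂ)
    (h : ∀ t : ℝ, HasSum (fun n => t ^ n • b n) 0) (n : ℕ) : b n = 0 := by
  let p : FormalMultilinearSeries ℝ ℝ ℂ := fun m => ContinuousMultilinearMap.mkPiRing ℝ (Fin m) (b m)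
  have hpc : ∀ m, p.coeff m = b m := fun m => by simp [p, FormalMultilinearSeries.coeff]
  have hp : HasFPowerSeriesAt (0 : ℝ → ℂ) p 0 := by
    rw [hasFPowerSeriesAt_iff]
    refine Filter.Eventually.of_forall fun t => ?_
    exact (h t).congr_fun fun m => by rw [hpc]
  rw [← hpc n, hp.eq_zero]
  rfl

/-- The `n`-particle component of a vector in the Fock space. -/
def Fock.component (Ψ : Fock ι) (n : ℕ) : HilbertSeq (Fin n → ι) :=
  ⟨fun i => Ψ.1 ⟨n, i⟩, memℓp_gen <| by
    have h := (lp.memℓp Ψ.1).summable (by simp)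
    exact h.comp_injective (i := fun i : Fin n → ι => (⟨n, i⟩ : Σ n : ℕ, (Fin n → ι)))
      fun a b hab => by simpa using hab⟩

theorem Fock.component_comp_perm (Ψ : Fock ι) (n : ℕ) (i : Fin n → ι) (σ : Equiv.Perm (Fin n)) :
    Ψ.component n (i ∘ σ) = Ψ.component n i := Ψ.2 n i σ

theorem hasSum_inner_coherent (Ψ : Fock ι) (ξ : HilbertSeq ι) :
    HasSum (fun n : ℕ => ((Real.sqrt (n.factorial : ℝ) : ℝ) : ℂ)⁻¹ *
      inner ℂ (Ψ.component n) (tens fun _ : Fin n => ξ)) (inner ℂ Ψ (coherent ξ)) := by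
  have h := lp.hasSum_inner (𝕜 := ℂ) Ψ.1 (coherent ξ).1
  refine HasSum.sigma h fun n => ?_
  have h1 := (lp.hasSum_inner (𝕜 := ℂ) (Ψ.component n) (tens fun _ : Fin n => ξ)).mul_left
    ((Real.sqrt (n.factorial : ℝ) : ℝ) : ℂ)⁻¹
  refine h1.congr_fun fun i => ?_
  rw [tens_apply]
  change inner ℂ _ (coherentFun ξ ⟨n, i⟩) = _
  rw [coherentFun, RCLike.inner_apply, RCLike.inner_apply, mul_assoc]
  rfl

theorem tens_const_smul (n : ℕ) (t : ℝ) (ξ : HilbertSeq ι) :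
    tens (fun _ : Fin n => t • ξ) = ((t ^ n : ℝ) : ℂ) • tens (fun _ : Fin n => ξ) := by
  refine lp.ext (funext fun i => ?_)
  simp [tens_apply, Finset.prod_mul_distrib]

theorem hasSum_inner_coherent_smul (Ψ : Fock ι) (ξ : HilbertSeq ι) (t : ℝ) :
    HasSum (fun n : ℕ => t ^ n • (((Real.sqrt (n.factorial : ℝ) : ℝ) : ℂ)⁻¹ *
      inner ℂ (Ψ.component n) (tens fun _ : Fin n => ξ))) (inner ℂ Ψ (coherent (t • ξ))) := by
  refine (hasSum_inner_coherent Ψ (t • ξ)).congr_fun fun n => ?_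
  rw [tens_const_smul, inner_smul_right,
    Complex.real_smul]
  ring

/-- The parity relations for the components of a vector. -/
theorem neg_one_pow_mul_inner_component (Ψ : Fock ι) (ε : ℝ) (ξ : HilbertSeq ι)
    (h : ∀ t : ℝ, inner ℂ Ψ (coherent (-(t • ξ))) =
      ε • (starRingEnd ℂ) (inner ℂ Ψ (coherent (t • ξ)))) (n : ℕ) :
    (-1 : ℝ) ^ n • inner ℂ (Ψ.component n) (tens fun _ : Fin n => ξ) =
      ε • (starRingEnd ℂ) (inner ℂ (Ψ.component n) (tens fun _ : Fin n => ξ)) := by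
  have h1 := eq_zero_of_forall_hasSum_pow_smul (fun n : ℕ =>
    (((Real.sqrt (n.factorial : ℝ) : ℝ) : ℂ)⁻¹ *
      ((-1 : ℝ) ^ n • inner ℂ (Ψ.component n) (tens fun _ : Fin n => ξ) -
      ε • (starRingEnd ℂ) (inner ℂ (Ψ.component n) (tens fun _ : Fin n => ξ))))) (fun t => ?_) n
  · refine sub_eq_zero.1 ((mul_eq_zero.1 h1).resolve_left (inv_ne_zero ?_))
    rw [Ne, Complex.ofReal_eq_zero, Real.sqrt_eq_zero (by positivity)]
    positivity
  -- Both sides of `h` are power series in `t`; replacing `t` by `-t` produces the sign `(-1)^n` in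
  -- degree `n`.
  · have h2 := hasSum_inner_coherent_smul Ψ ξ (-t)
    have h3 := (((hasSum_inner_coherent_smul Ψ ξ t).map (starRingEnd ℂ)
      Complex.continuous_conj).const_smul ε)
    rw [← h t, ← neg_smul] at h3
    have h4 := h2.sub h3
    rw [sub_self] at h4
    refine h4.congr_fun fun n => ?_
    simp only [Function.comp, Complex.real_smul, map_mul, map_inv₀, Complex.conj_ofReal]
    rw [neg_pow]
    push_cast
    ring

/-- Duality for the vectors `z e^x + z̄ e^{-x}`. -/
theorem Fock.eq_zero_of_parity {X Y : Submodule ℝ (HilbertSeq ι)}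
    (hd : IsDual (X : Set (HilbertSeq ι)) Y) (hX : IsTotal (X : Set (HilbertSeq ι)))
    (hY : IsTotal (Y : Set (HilbertSeq ι))) (Ψ : Fock ι)
    (h1 : ∀ x ∈ X, inner ℂ Ψ (coherent (-x)) = -(starRingEnd ℂ) (inner ℂ Ψ (coherent x)))
    (h2 : ∀ y ∈ Y, inner ℂ Ψ (coherent (-y)) = (starRingEnd ℂ) (inner ℂ Ψ (coherent y))) :
    Ψ = 0 := by
  have e1 : ∀ w : ℂ, (1 : ℝ) • w = (-1 : ℝ) • (starRingEnd ℂ) w → w.re = 0 := fun w h => by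
    simp [Complex.ext_iff] at h; linarith
  have e2 : ∀ w : ℂ, (1 : ℝ) • w = (1 : ℝ) • (starRingEnd ℂ) w → w.im = 0 := fun w h => by
    simp [Complex.ext_iff] at h; linarith
  have e3 : ∀ w : ℂ, (-1 : ℝ) • w = (-1 : ℝ) • (starRingEnd ℂ) w → w.im = 0 := fun w h => by
    simp [Complex.ext_iff] at h; linarith
  have e4 : ∀ w : ℂ, (-1 : ℝ) • w = (1 : ℝ) • (starRingEnd ℂ) w → w.re = 0 := fun w h => by
    simp [Complex.ext_iff] at h; linarith
  have key : ∀ n, Ψ.component n = 0 := by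
    intro n
    have hX' : ∀ x ∈ X, (-1 : ℝ) ^ n • inner ℂ (Ψ.component n) (tens fun _ : Fin n => x) =
        (-1 : ℝ) • (starRingEnd ℂ) (inner ℂ (Ψ.component n) (tens fun _ : Fin n => x)) :=
      fun x hx => neg_one_pow_mul_inner_component Ψ (-1) x
        (fun t => by rw [h1 _ (X.smul_mem t hx)]; simp) n
    have hY' : ∀ y ∈ Y, (-1 : ℝ) ^ n • inner ℂ (Ψ.component n) (tens fun _ : Fin n => y) =
        (1 : ℝ) • (starRingEnd ℂ) (inner ℂ (Ψ.component n) (tens fun _ : Fin n => y)) :=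
      fun y hy => neg_one_pow_mul_inner_component Ψ 1 y
        (fun t => by rw [h2 _ (Y.smul_mem t hy)]; simp) n
    have hdn := hd.tensSet hX hY n
    have hs := Ψ.component_comp_perm n
    -- For even `n` the pairing of the component with powers is imaginary on `X` and real on `Y`, as
    -- duality of the tensor sets requires. For odd `n` the two are exchanged, and a factor `i`
    -- restores them.
    rcases Nat.even_or_odd n with hn | hn
    · refine hdn.eq_zero _ ?_ ?_
      · rintro _ ⟨ξ, hξ, rfl⟩
        refine re_inner_tens_eq_zero _ hs X (fun x hx => ?_) ξ hξ
        exact e1 _ (by rw [← hX' x hx, hn.neg_one_pow])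
      · rintro _ ⟨ξ, hξ, rfl⟩
        refine im_inner_tens_eq_zero _ hs Y (fun x hx => ?_) ξ hξ
        exact e2 _ (by rw [← hY' x hx, hn.neg_one_pow])
    · have hI : Complex.I • Ψ.component n = 0 := by
        refine hdn.eq_zero _ ?_ ?_
        · rintro _ ⟨ξ, hξ, rfl⟩
          have := im_inner_tens_eq_zero _ hs X (fun x hx => ?_) ξ hξ
          · simpa [inner_smul_left] using this
          · exact e3 _ (by rw [← hX' x hx, hn.neg_one_pow])
        · rintro _ ⟨ξ, hξ, rfl⟩
          have := re_inner_tens_eq_zero _ hs Y (fun x hx => ?_) ξ hξ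
          · simpa [inner_smul_left] using this
          · exact e4 _ (by rw [← hY' x hx, hn.neg_one_pow])
      exact (smul_eq_zero.1 hI).resolve_left Complex.I_ne_zero
  refine Subtype.ext (lp.ext (funext fun p => ?_))
  exact congrFun (congrArg (fun v : HilbertSeq (Fin p.1 → ι) => (v : (Fin p.1 → ι) → ℂ)) (key p.1)) p.2

end FockComponents

/-! ### Weyl relations -/

section Weyl

variable {ι : Type}

theorem clm_ext_coherent {E : Type*} [NormedAddCommGroup E] [NormedSpace ℂ E]
    {A B : Fock ι →L[ℂ] E} (h : ∀ ξ, A (coherent ξ) = B (coherent ξ)) : A = B :=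
  ContinuousLinearMap.ext_on coherent_total (by rintro _ ⟨ξ, rfl⟩; exact h ξ)

theorem weyl_mul_weyl (ξ η : HilbertSeq ι) :
    weyl ξ * weyl η = Complex.exp (-(Complex.I * ((inner ℂ ξ η).im : ℂ))) • weyl (ξ + η) := by
  refine clm_ext_coherent fun ζ => ?_
  have h1 : (‖ξ + η‖ ^ 2 : ℝ) = ‖ξ‖ ^ 2 + 2 * (inner ℂ ξ η).re + ‖η‖ ^ 2 := norm_add_sq (𝕜 := ℂ) ξ η
  have h2 : inner ℂ ξ η = ((inner ℂ ξ η).re : ℂ) + (inner ℂ ξ η).im * Complex.I :=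
    (Complex.re_add_im _).symm
  rw [mul_apply_eq_comp, smul_apply, weyl_coherent, map_smul, weyl_coherent,
    weyl_coherent, smul_smul, smul_smul, ← Complex.exp_add, ← Complex.exp_add, add_assoc]
  congr 2
  rw [inner_add_right, inner_add_left, h1]
  generalize inner ℂ ξ η = w at h2
  nth_rw 1 [h2]
  push_cast
  ring

theorem weyl_zero : weyl (0 : HilbertSeq ι) = 1 := by
  refine clm_ext_coherent fun ζ => ?_
  rw [weyl_coherent]
  simp

theorem weyl_neg_mul (ξ : HilbertSeq ι) : weyl (-ξ) * weyl ξ = 1 := by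
  rw [weyl_mul_weyl, neg_add_cancel, weyl_zero, inner_neg_left, inner_self_eq_norm_sq_to_K]
  simp [← Complex.ofReal_pow]

theorem weyl_mul_neg (ξ : HilbertSeq ι) : weyl ξ * weyl (-ξ) = 1 := by
  simpa using weyl_neg_mul (-ξ)

theorem inner_weyl_coherent (ξ η ζ : HilbertSeq ι) :
    inner ℂ (weyl (-ξ) (coherent η)) (coherent ζ) = inner ℂ (coherent η) (weyl ξ (coherent ζ)) := by
  rw [weyl_coherent, weyl_coherent, inner_smul_left, inner_smul_right, inner_coherent,
    inner_coherent, ← Complex.exp_conj, ← Complex.exp_add, ← Complex.exp_add]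
  congr 1
  simp only [map_sub, map_neg, Complex.conj_ofReal, inner_conj_symm, inner_add_left,
    inner_add_right, norm_neg, inner_neg_left]
  ring

theorem star_weyl (ξ : HilbertSeq ι) : star (weyl ξ) = weyl (-ξ) := by
  rw [ContinuousLinearMap.star_eq_adjoint]
  symm
  rw [ContinuousLinearMap.eq_adjoint_iff]
  intro x y
  -- The identity on pairs of coherent vectors is extended to the whole space in one argument at a
  -- time.
  have h1 : (innerSL ℂ (weyl (-ξ) x)) = (innerSL ℂ x).comp (weyl ξ) := by
    refine clm_ext_coherent fun ζ => ?_
    have h2 : (innerSL ℂ (coherent ζ)).comp (weyl (-ξ)) = innerSL ℂ (weyl ξ (coherent ζ)) := by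
      refine clm_ext_coherent fun η => ?_
      simp only [ContinuousLinearMap.comp_apply, innerSL_apply_apply]
      rw [← inner_conj_symm, inner_weyl_coherent, inner_conj_symm]
    have h3 := congrArg (fun f => f x) h2
    simp only [ContinuousLinearMap.comp_apply, innerSL_apply_apply] at h3 ⊢
    rw [← inner_conj_symm, h3, inner_conj_symm]
  exact congrArg (fun f => f y) h1

theorem weyl_comm (ξ η : HilbertSeq ι) :
    weyl ξ * weyl η =
      Complex.exp (-(2 * Complex.I * ((inner ℂ ξ η).im : ℂ))) • (weyl η * weyl ξ) := by
  rw [weyl_mul_weyl, weyl_mul_weyl, smul_smul, ← Complex.exp_add, add_comm η ξ,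
    ← inner_conj_symm η ξ, Complex.conj_im]
  congr 2
  push_cast
  ring

theorem commute_weyl (ξ η : HilbertSeq ι) (h : (inner ℂ ξ η).im = 0) :
    Commute (weyl ξ) (weyl η) := by
  rw [commute_iff_eq, weyl_comm, h]
  simp

end Weyl

/-! ### From dual real subspaces to commuting commutants on Fock space -/

section Duality

variable {ι : Type}

theorem IsTotal.clm_eq_zero {E : Type*} [NormedAddCommGroup E] [InnerProductSpace ℂ E]
    [CompleteSpace E] {X : Set E} (hX : IsTotal X) (f : E →L[ℂ] ℂ) (hf : ∀ x ∈ X, f x = 0) :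
    f = 0 := by
  obtain ⟨z, rfl⟩ := (InnerProductSpace.toDual ℂ E).surjective f
  rw [hX z hf, map_zero]

/-- Arbitrary factors replace the factors from `X` one at a time: with the others fixed, the
functional is linear and bounded in the remaining one and vanishes on a total set. -/
theorem clm_tens_eq_zero {X : Set (HilbertSeq ι)} (hX : IsTotal X) (n : ℕ)
    (f : HilbertSeq (Fin n → ι) →L[ℂ] ℂ) (hf : ∀ v ∈ tensSet X n, f v = 0)
    (ξ : Fin n → HilbertSeq ι) : f (tens ξ) = 0 := by
  induction n with
  | zero => exact hf _ ⟨ξ, fun j => j.elim0, rfl⟩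
  | succ n ih =>
    have h1 : (f.comp ((consMulL n).flip (tens (Fin.tail ξ)))) = 0 := by
      refine hX.clm_eq_zero _ fun x hx => ?_
      refine ih (f.comp (consMulL n x)) ?_ (Fin.tail ξ)
      rintro _ ⟨η, hη, rfl⟩
      exact hf _ ⟨Fin.cons x η, Fin.cases hx hη, by rw [tens]; rfl⟩
    exact congrArg (fun g => g (ξ 0)) h1

/-- The coherent vectors of a total real subspace are total. -/
theorem isTotal_coherent {X : Submodule ℝ (HilbertSeq ι)} (hX : IsTotal (X : Set (HilbertSeq ι))) :
    IsTotal (coherent '' (X : Set (HilbertSeq ι))) := by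
  intro Ψ h
  have h0 : ∀ x ∈ X, inner ℂ Ψ (coherent x) = 0 := fun x hx => h _ ⟨x, hx, rfl⟩
  have h1 : ∀ n, ∀ x ∈ X, inner ℂ (Ψ.component n) (tens fun _ : Fin n => x) = 0 := by
    intro n x hx
    have := eq_zero_of_forall_hasSum_pow_smul _ (fun t => by
      have := hasSum_inner_coherent_smul Ψ x t
      rwa [h0 _ (X.smul_mem t hx)] at this) n
    refine (mul_eq_zero.1 this).resolve_left (inv_ne_zero ?_)
    rw [Ne, Complex.ofReal_eq_zero, Real.sqrt_eq_zero (by positivity)]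
    positivity
  have h2 : ∀ n (ξ : Fin n → HilbertSeq ι), inner ℂ (Ψ.component n) (tens ξ) = 0 := by
    intro n
    refine clm_tens_eq_zero hX n (innerSL ℂ (Ψ.component n)) ?_
    rintro _ ⟨ξ, hξ, rfl⟩
    have hs := Ψ.component_comp_perm n
    exact Complex.ext (re_inner_tens_eq_zero _ hs X (fun x hx => by rw [h1 n x hx]; rfl) ξ hξ)
      (im_inner_tens_eq_zero _ hs X (fun x hx => by rw [h1 n x hx]; rfl) ξ hξ)
  have h3 : ∀ ξ, inner ℂ Ψ (coherent ξ) = 0 := fun ξ => by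
    have := hasSum_inner_coherent Ψ ξ
    simp only [h2, mul_zero] at this
    exact this.unique hasSum_zero
  have h4 : innerSL ℂ Ψ = 0 := clm_ext_coherent h3
  have := congrArg (fun f => f Ψ) h4
  simpa using this

/-- The self-adjoint operators `z W(x) + z̄ W(-x)`. -/
def weylReal (x : HilbertSeq ι) (z : ℂ) : Fock ι →L[ℂ] Fock ι :=
  z • weyl x + (starRingEnd ℂ) z • weyl (-x)

theorem isSelfAdjoint_weylReal (x : HilbertSeq ι) (z : ℂ) : IsSelfAdjoint (weylReal x z) := by
  rw [isSelfAdjoint_iff, weylReal, star_add, star_smul, star_smul, star_weyl, star_weyl, neg_neg,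
    add_comm]
  simp

theorem Commute.weylReal_right {a : Fock ι →L[ℂ] Fock ι} {X : Submodule ℝ (HilbertSeq ι)}
    (h : ∀ x ∈ X, Commute a (weyl x)) (x : HilbertSeq ι) (hx : x ∈ X) (z : ℂ) :
    Commute a (weylReal x z) :=
  ((h x hx).smul_right z).add_right ((h _ (X.neg_mem hx)).smul_right _)

/-- For commuting self-adjoint `a`, `b` the product `ab` is self-adjoint, so `⟨av, bv⟩ = ⟨v, abv⟩`
is real. -/
theorem im_inner_of_commute {E : Type*} [NormedAddCommGroup E] [InnerProductSpace ℂ E]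
    [CompleteSpace E] {a b : E →L[ℂ] E} (ha : IsSelfAdjoint a) (hb : IsSelfAdjoint b)
    (h : Commute a b) (v : E) : (inner ℂ (a v) (b v)).im = 0 := by
  have hs1 := ContinuousLinearMap.isSelfAdjoint_iff_isSymmetric.1 ha
  have hs2 := ContinuousLinearMap.isSelfAdjoint_iff_isSymmetric.1 hb
  have h1 : inner ℂ (a v) (b v) = inner ℂ (b v) (a v) := by
    have e1 : inner ℂ (a v) (b v) = inner ℂ v (a (b v)) := hs1 _ _
    have e2 : inner ℂ (b v) (a v) = inner ℂ v (b (a v)) := hs2 _ _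
    rw [e1, e2]
    exact congrArg (fun T => inner ℂ v (T v)) h.eq
  rw [← Complex.conj_eq_iff_im, inner_conj_symm, h1]

/-- The vectors `(z W(x) + z̄ W(-x)) Ω`, `x ∈ X`. -/
def weylRealVectors (X : Submodule ℝ (HilbertSeq ι)) : Set (Fock ι) :=
  {v | ∃ x ∈ X, ∃ z : ℂ, v = weylReal x z (coherent 0)}

theorem inner_weylReal_vacuum (Ψ : Fock ι) (x : HilbertSeq ι) (z : ℂ) :
    inner ℂ Ψ (weylReal x z (coherent 0)) = (Real.exp (-(‖x‖ ^ 2 / 2)) : ℝ) *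
      (z * inner ℂ Ψ (coherent x) + (starRingEnd ℂ) z * inner ℂ Ψ (coherent (-x))) := by
  simp only [weylReal, add_apply, smul_apply, weyl_coherent, inner_zero_right, sub_zero, norm_neg,
    add_zero, inner_add_right, inner_smul_right]
  push_cast
  ring

/-- One-particle duality carried to Fock space. Locality follows from commuting self-adjoint Weyl
combinations; separation translates into relations between `⟨Ψ, e^x⟩` and `⟨Ψ, e^{-x}⟩`, which
`Fock.eq_zero_of_parity` excludes for `Ψ ≠ 0`. -/
theorem IsDual.weylRealVectors {X Y : Submodule ℝ (HilbertSeq ι)}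
    (hd : IsDual (X : Set (HilbertSeq ι)) Y) (hX : IsTotal (X : Set (HilbertSeq ι)))
    (hY : IsTotal (Y : Set (HilbertSeq ι))) :
    IsDual (weylRealVectors X) (weylRealVectors Y) := by
  constructor
  · rintro _ ⟨x, hx, z, rfl⟩ _ ⟨y, hy, w, rfl⟩
    refine im_inner_of_commute (isSelfAdjoint_weylReal x z) (isSelfAdjoint_weylReal y w) ?_ _
    refine Commute.weylReal_right (fun y hy => ?_) y hy w
    refine (Commute.weylReal_right (fun x hx => ?_) x hx z).symm
    exact (commute_weyl x y (hd.im_inner x hx y hy)).symm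
  · intro Ψ h1 h2
    refine Fock.eq_zero_of_parity hd hX hY Ψ (fun x hx => ?_) fun y hy => ?_
    · have e : ∀ z : ℂ, (z * inner ℂ Ψ (coherent x) +
          (starRingEnd ℂ) z * inner ℂ Ψ (coherent (-x))).re = 0 := fun z => by
        have := h1 _ ⟨x, hx, z, rfl⟩
        rw [inner_weylReal_vacuum, Complex.re_ofReal_mul] at this
        exact (mul_eq_zero.1 this).resolve_left (Real.exp_pos _).ne'
      -- The choices `z = 1` and `z = i` together give `b = -ā`.
      have e1 := e 1
      have e2 := e Complex.I
      generalize inner ℂ Ψ (coherent x) = a at *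
      generalize inner ℂ Ψ (coherent (-x)) = b at *
      simp at e1 e2
      refine Complex.ext ?_ ?_ <;> simp <;> linarith
    · have e : ∀ z : ℂ, (z * inner ℂ Ψ (coherent y) +
          (starRingEnd ℂ) z * inner ℂ Ψ (coherent (-y))).im = 0 := fun z => by
        have := h2 _ ⟨y, hy, z, rfl⟩
        rw [inner_weylReal_vacuum, Complex.im_ofReal_mul] at this
        exact (mul_eq_zero.1 this).resolve_left (Real.exp_pos _).ne'
      -- Here the same two choices give `b = ā`.
      have e1 := e 1
      have e2 := e Complex.I
      generalize inner ℂ Ψ (coherent y) = a at *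
      generalize inner ℂ Ψ (coherent (-y)) = b at *
      simp at e1 e2
      refine Complex.ext ?_ ?_ <;> simp <;> linarith

theorem Commute.star_weyl_right {a : Fock ι →L[ℂ] Fock ι} {X : Submodule ℝ (HilbertSeq ι)}
    (h : ∀ x ∈ X, Commute a (weyl x)) : ∀ x ∈ X, Commute (star a) (weyl x) := by
  intro x hx
  have := (h (-x) (X.neg_mem hx)).star_star
  rwa [star_weyl, neg_neg] at this

open scoped ComplexStarModule in
-- For self-adjoint `a`, `c` the vectors `aΩ` and `cΩ` lie in the symplectic complements of the
-- vectors generated from `X` and from `Y`. By duality `⟨cΩ, aΩ⟩` is real, which is the claim; the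
-- general case follows by splitting into real and imaginary parts.
theorem vacuum_commutator {X Y : Submodule ℝ (HilbertSeq ι)}
    (hd : IsDual (X : Set (HilbertSeq ι)) Y) (hX : IsTotal (X : Set (HilbertSeq ι)))
    (hY : IsTotal (Y : Set (HilbertSeq ι))) (a c : Fock ι →L[ℂ] Fock ι)
    (ha : ∀ x ∈ X, Commute a (weyl x)) (hc : ∀ y ∈ Y, Commute c (weyl y)) :
    inner ℂ (coherent (0 : HilbertSeq ι)) ((a * c) (coherent 0)) =
      inner ℂ (coherent (0 : HilbertSeq ι)) ((c * a) (coherent 0)) := by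
  have hsa : ∀ a c : Fock ι →L[ℂ] Fock ι, IsSelfAdjoint a → IsSelfAdjoint c →
      (∀ x ∈ X, Commute a (weyl x)) → (∀ y ∈ Y, Commute c (weyl y)) →
      inner ℂ (coherent (0 : HilbertSeq ι)) ((a * c) (coherent 0)) =
      inner ℂ (coherent (0 : HilbertSeq ι)) ((c * a) (coherent 0)) := by
    intro a c ha hc hax hcy
    have h := (hd.weylRealVectors hX hY).im_inner_complements (c (coherent 0)) (a (coherent 0))
      (by
        rintro _ ⟨y, hy, z, rfl⟩
        exact im_inner_of_commute hc (isSelfAdjoint_weylReal y z)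
          (Commute.weylReal_right hcy y hy z) _)
      (by
        rintro _ ⟨x, hx, z, rfl⟩
        exact im_inner_of_commute ha (isSelfAdjoint_weylReal x z)
          (Commute.weylReal_right hax x hx z) _)
    have hs1 := ContinuousLinearMap.isSelfAdjoint_iff_isSymmetric.1 ha
    have hs2 := ContinuousLinearMap.isSelfAdjoint_iff_isSymmetric.1 hc
    have e1 : inner ℂ (a (coherent 0)) (c (coherent 0)) =
      inner ℂ (coherent (0 : HilbertSeq ι)) ((a * c) (coherent 0)) := hs1 _ _
    have e2 : inner ℂ (c (coherent 0)) (a (coherent 0)) =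
      inner ℂ (coherent (0 : HilbertSeq ι)) ((c * a) (coherent 0)) := hs2 _ _
    rw [← e1, ← e2, ← inner_conj_symm, Complex.conj_eq_iff_im]
    exact h
  have hre : ∀ (a : Fock ι →L[ℂ] Fock ι) (Z : Submodule ℝ (HilbertSeq ι)),
      (∀ x ∈ Z, Commute a (weyl x)) → ∀ x ∈ Z, Commute (ℜ a : Fock ι →L[ℂ] Fock ι) (weyl x) := by
    intro a Z h x hx
    rw [realPart_apply_coe]
    exact ((h x hx).add_left (Commute.star_weyl_right h x hx)).smul_left _
  have him : ∀ (a : Fock ι →L[ℂ] Fock ι) (Z : Submodule ℝ (HilbertSeq ι)),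
      (∀ x ∈ Z, Commute a (weyl x)) → ∀ x ∈ Z, Commute (ℑ a : Fock ι →L[ℂ] Fock ι) (weyl x) := by
    intro a Z h x hx
    rw [imaginaryPart_apply_coe]
    exact (((h x hx).sub_left (Commute.star_weyl_right h x hx)).smul_left _).smul_left _
  rw [← realPart_add_I_smul_imaginaryPart a, ← realPart_add_I_smul_imaginaryPart c]
  have k1 := hsa _ _ (ℜ a).2 (ℜ c).2 (hre a X ha) (hre c Y hc)
  have k2 := hsa _ _ (ℜ a).2 (ℑ c).2 (hre a X ha) (him c Y hc)
  have k3 := hsa _ _ (ℑ a).2 (ℜ c).2 (him a X ha) (hre c Y hc)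
  have k4 := hsa _ _ (ℑ a).2 (ℑ c).2 (him a X ha) (him c Y hc)
  simp only [add_mul, mul_add, smul_mul_assoc, mul_smul_comm, add_apply, smul_apply,
    inner_add_right, inner_smul_right, k1, k2, k3, k4]
  ring

/-- Duality for second quantised subspaces: the commutants of the Weyl operators of two dual real
subspaces commute. -/
theorem commute_of_isDual {X Y : Submodule ℝ (HilbertSeq ι)}
    (hd : IsDual (X : Set (HilbertSeq ι)) Y) (hX : IsTotal (X : Set (HilbertSeq ι)))
    (hY : IsTotal (Y : Set (HilbertSeq ι))) (a c : Fock ι →L[ℂ] Fock ι)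
    (ha : ∀ x ∈ X, Commute a (weyl x)) (hc : ∀ y ∈ Y, Commute c (weyl y)) : Commute a c := by
  have hWY : ∀ x ∈ X, ∀ y ∈ Y, Commute (weyl x) (weyl y) := fun x hx y hy =>
    commute_weyl x y (hd.im_inner x hx y hy)
  have key : ∀ x₁ ∈ X, ∀ x₂ ∈ X, inner ℂ (weyl x₁ (coherent 0)) ((a * c) (weyl x₂ (coherent 0))) =
      inner ℂ (weyl x₁ (coherent 0)) ((c * a) (weyl x₂ (coherent 0))) := by
    intro x₁ h₁ x₂ h₂
    -- The commutant of the Weyl operators of `Y` contains those of `X`, so `c` may be replaced by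
    -- `W(-x₁) c W(x₂)`. As `a` commutes with these factors, the vacuum expectation becomes a matrix
    -- element of the commutator of `a` and `c` between `W(x₁)Ω` and `W(x₂)Ω`.
    have h := vacuum_commutator hd hX hY a (weyl (-x₁) * c * weyl x₂) ha fun y hy =>
      ((hWY _ (X.neg_mem h₁) y hy).mul_left (hc y hy)).mul_left (hWY _ h₂ y hy)
    have hadj : ∀ v, inner ℂ (weyl x₁ (coherent 0)) v = inner ℂ (coherent 0) (weyl (-x₁) v) := by
      intro v
      rw [← star_weyl, ContinuousLinearMap.star_eq_adjoint,
        ContinuousLinearMap.adjoint_inner_right]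
    rw [hadj, hadj]
    have e1 : a * (weyl (-x₁) * c * weyl x₂) = weyl (-x₁) * (a * c) * weyl x₂ := by
      rw [← mul_assoc, ← mul_assoc, (ha _ (X.neg_mem h₁)).eq]
      simp only [mul_assoc]
    have e2 : weyl (-x₁) * c * weyl x₂ * a = weyl (-x₁) * (c * a) * weyl x₂ := by
      rw [mul_assoc, ← (ha _ h₂).eq]
      simp only [mul_assoc]
    rw [e1, e2] at h
    exact h
  have hvac : ∀ x : HilbertSeq ι, ∃ r : ℂ, r ≠ 0 ∧ weyl x (coherent 0) = r • coherent x :=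
    fun x => ⟨_, Complex.exp_ne_zero _, by rw [weyl_coherent, add_zero]⟩
  have hcoh : ∀ x₁ ∈ X, ∀ x₂ ∈ X, inner ℂ (coherent x₁) ((a * c - c * a) (coherent x₂)) = 0 := by
    intro x₁ h₁ x₂ h₂
    obtain ⟨r₁, hr₁, e₁⟩ := hvac x₁
    obtain ⟨r₂, hr₂, e₂⟩ := hvac x₂
    have h := key x₁ h₁ x₂ h₂
    rw [e₁, e₂, map_smul, map_smul, inner_smul_left, inner_smul_left, inner_smul_right,
      inner_smul_right] at h
    have h' := mul_left_cancel₀ hr₂ (mul_left_cancel₀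
      ((map_ne_zero (starRingEnd ℂ)).2 hr₁) h)
    rw [sub_apply, inner_sub_right, h', sub_self]
  have hT := isTotal_coherent hX
  have h0 : ∀ x₂ ∈ X, (a * c - c * a) (coherent x₂) = 0 := by
    intro x₂ h₂
    refine hT _ ?_
    rintro _ ⟨x₁, h₁, rfl⟩
    rw [← inner_conj_symm, hcoh x₁ h₁ x₂ h₂, map_zero]
  have hfin : a * c - c * a = 0 := by
    ext v
    have : (innerSL ℂ ((a * c - c * a) v)).comp (a * c - c * a) = 0 := by
      refine hT.clm_eq_zero _ ?_
      rintro _ ⟨x, hx, rfl⟩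
      rw [ContinuousLinearMap.comp_apply, h0 x hx, map_zero]
    exact inner_self_eq_zero.1 (congrArg (fun f => f v) this)
  exact sub_eq_zero.1 hfin

end Duality

/-! ### Loops: supports, periodization, charge, primitives -/

section Loops

variable {F : Type*} [NormedAddCommGroup F] [NormedSpace ℝ F]

instance : Fact (0 < 2 * Real.pi) := ⟨Real.two_pi_pos⟩

theorem Loop.continuous (f : Loop F) : Continuous f.toFun := f.smooth.continuous

theorem Loop.apply_add_int_mul (f : Loop F) (θ : ℝ) (k : ℤ) : f (θ + k * (2 * Real.pi)) = f θ :=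
  f.periodic.int_mul k θ

@[ext] theorem Loop.ext {f g : Loop F} (h : ∀ θ, f θ = g θ) : f = g := by
  cases f; cases g
  simp only [Loop.mk.injEq]
  exact funext h

instance : Add (Loop F) :=
  ⟨fun f g => ⟨fun θ => f θ + g θ, f.smooth.add g.smooth, fun θ => by
    simp only [f.periodic θ, g.periodic θ]⟩⟩

instance : SMul ℝ (Loop F) :=
  ⟨fun c f => ⟨fun θ => c • f θ, contDiff_const.smul f.smooth, fun θ => by
    simp only [f.periodic θ]⟩⟩

instance : Zero (Loop F) := ⟨⟨fun _ => 0, contDiff_const, fun _ => rfl⟩⟩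

instance : Sub (Loop F) :=
  ⟨fun f g => ⟨fun θ => f θ - g θ, f.smooth.sub g.smooth, fun θ => by
    simp only [f.periodic θ, g.periodic θ]⟩⟩

theorem Loop.add_apply (f g : Loop F) (θ : ℝ) : (f + g) θ = f θ + g θ := rfl
theorem Loop.sub_apply (f g : Loop F) (θ : ℝ) : (f - g) θ = f θ - g θ := rfl
theorem Loop.smul_apply (c : ℝ) (f : Loop F) (θ : ℝ) : (c • f) θ = c • f θ := rfl
theorem Loop.zero_apply (θ : ℝ) : (0 : Loop F) θ = 0 := rfl
theorem Loop.smulVec_apply (f : Loop ℝ) (p : F) (θ : ℝ) : f.smulVec p θ = f θ • p := rfl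

/-- The derivative of a loop. -/
def Loop.deriv (f : Loop F) : Loop F where
  toFun := _root_.deriv f.toFun
  smooth := (contDiff_infty_iff_deriv.1 f.smooth).2
  periodic θ := by
    rw [← deriv_comp_add_const]
    congr 1
    funext θ
    exact f.periodic θ

theorem Loop.hasDerivAt (f : Loop F) (θ : ℝ) : HasDerivAt f.toFun (f.deriv θ) θ :=
  ((f.smooth.differentiable (by simp)) θ).hasDerivAt

theorem isClosed_translates (a b : ℝ) :
    IsClosed {θ : ℝ | ∃ k : ℤ, θ + k * (2 * Real.pi) ∈ Set.Icc a b} := by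
  have h : {θ : ℝ | ∃ k : ℤ, θ + k * (2 * Real.pi) ∈ Set.Icc a b} =
      (fun θ : ℝ => (θ : AddCircle (2 * Real.pi))) ⁻¹'
        ((fun θ : ℝ => (θ : AddCircle (2 * Real.pi))) '' Set.Icc a b) := by
    ext θ
    constructor
    · rintro ⟨k, hk⟩
      refine ⟨_, hk, ?_⟩
      simp only [AddCircle.coe_add, add_eq_left]
      rw [AddCircle.coe_eq_zero_iff]
      exact ⟨k, by simp⟩
    · rintro ⟨y, hy, hyx⟩
      have : ((y - θ : ℝ) : AddCircle (2 * Real.pi)) = 0 := by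
        rw [AddCircle.coe_sub]
        exact sub_eq_zero.2 hyx
      obtain ⟨k, hk⟩ := (AddCircle.coe_eq_zero_iff _).1 this
      refine ⟨k, ?_⟩
      have : θ + k * (2 * Real.pi) = y := by
        rw [← zsmul_eq_mul, hk]; ring
      rwa [this]
  rw [h]
  exact ((isCompact_Icc.image (AddCircle.continuous_mk' _)).isClosed).preimage
    (AddCircle.continuous_mk' _)

theorem exists_add_int_mul_mem_Ico (a θ : ℝ) :
    ∃ k : ℤ, θ + k * (2 * Real.pi) ∈ Set.Ico a (a + 2 * Real.pi) := by
  refine ⟨-toIcoDiv Real.two_pi_pos a θ, ?_⟩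
  have := toIcoMod_mem_Ico Real.two_pi_pos a θ
  rw [toIcoMod, zsmul_eq_mul] at this
  rw [Int.cast_neg, neg_mul, ← sub_eq_add_neg]
  exact this

/-- A closed support inside an open arc leaves a margin at both end points. This form involves no
closures or translates: vanishing on one closed interval that covers the complement of the arc with
a margin. -/
theorem Loop.supportedIn_iff (f : Loop F) (I : Arc) : f.SupportedIn I ↔
    ∃ a b, I.lo < a ∧ b < I.hi ∧ ∀ θ ∈ Set.Icc b (a + 2 * Real.pi), f θ = 0 := by
  constructor
  · intro h
    have hend : ∀ x, x ∉ I.angles → ∃ ε > 0, ∀ θ, |θ - x| ≤ ε → f θ = 0 := by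
      intro x hx
      have h1 : ∀ᶠ θ in nhds x, θ ∉ tsupport f.toFun :=
        (isClosed_tsupport _).isOpen_compl.mem_nhds fun hx' => hx (h hx')
      obtain ⟨ε, hε, hb⟩ := Metric.eventually_nhds_iff_ball.1 h1
      refine ⟨ε / 2, by positivity, fun θ hθ => image_eq_zero_of_notMem_tsupport (hb θ ?_)⟩
      rw [Metric.mem_ball, Real.dist_eq]
      linarith
    have hout : ∀ x, I.hi ≤ x → x ≤ I.lo + 2 * Real.pi → x ∉ I.angles := by
      rintro x h1 h2 ⟨k, hk1, hk2⟩
      have hpi := Real.two_pi_pos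
      have := I.lo_lt_hi
      rcases lt_trichotomy k 0 with hk | rfl | hk
      · have : (k : ℝ) ≤ -1 := by exact_mod_cast Int.le_sub_one_of_lt hk
        nlinarith
      · simp at hk2; linarith
      · have : (1 : ℝ) ≤ k := by exact_mod_cast hk
        nlinarith [I.hi_lt]
    obtain ⟨ε₁, h₁, hb₁⟩ := hend I.hi (hout _ le_rfl I.hi_lt.le)
    obtain ⟨ε₂, h₂, hb₂⟩ := hend (I.lo + 2 * Real.pi) (hout _ I.hi_lt.le le_rfl)
    refine ⟨I.lo + ε₂, I.hi - ε₁, by linarith, by linarith, fun θ hθ => ?_⟩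
    rcases le_total θ I.hi with h3 | h3
    · exact hb₁ θ (abs_le.2 ⟨by linarith [hθ.1], by linarith⟩)
    rcases le_total (I.lo + 2 * Real.pi) θ with h4 | h4
    · exact hb₂ θ (abs_le.2 ⟨by linarith, by linarith [hθ.2]⟩)
    exact image_eq_zero_of_notMem_tsupport fun h5 => hout θ h3 h4 (h h5)
  · rintro ⟨a, b, ha, hb, h0⟩
    -- The translates of `[a, b]` form a closed set, so it suffices to locate the points where `f`
    -- does not vanish.
    have hsub : tsupport f.toFun ⊆ {θ : ℝ | ∃ k : ℤ, θ + k * (2 * Real.pi) ∈ Set.Icc a b} := by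
      refine closure_minimal (fun θ hθ => ?_) (isClosed_translates a b)
      obtain ⟨k, hk⟩ := exists_add_int_mul_mem_Ico b θ
      refine ⟨k - 1, ?_⟩
      have h1 : ¬ θ + k * (2 * Real.pi) ≤ a + 2 * Real.pi := fun hle =>
        hθ (by rw [← f.apply_add_int_mul θ k]; exact h0 _ ⟨hk.1, hle⟩)
      have h2 := hk.2
      push_cast
      constructor <;> linarith
    refine hsub.trans ?_
    rintro θ ⟨k, hk⟩
    exact ⟨k, lt_of_lt_of_le ha hk.1, lt_of_le_of_lt hk.2 hb⟩

theorem Loop.SupportedIn.mono {f : Loop F} {J I : Arc} (h : f.SupportedIn J) (hJ : J.Sub I) :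
    f.SupportedIn I := by
  rintro θ hθ
  obtain ⟨k, hk⟩ := h hθ
  exact ⟨k, hJ.1.trans_lt hk.1, hk.2.trans_le hJ.2⟩

theorem Loop.SupportedIn.apply_eq_zero {f : Loop F} {I : Arc} (h : f.SupportedIn I) {θ : ℝ}
    (h1 : I.hi ≤ θ) (h2 : θ ≤ I.lo + 2 * Real.pi) : f θ = 0 := by
  obtain ⟨a, b, ha, hb, h0⟩ := (f.supportedIn_iff I).1 h
  exact h0 θ ⟨hb.le.trans h1, by linarith⟩

theorem Loop.SupportedIn.of_forall {f g : Loop F} {I : Arc} (h : f.SupportedIn I)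
    (h0 : ∀ θ, f θ = 0 → g θ = 0) : g.SupportedIn I := by
  obtain ⟨a, b, ha, hb, h1⟩ := (f.supportedIn_iff I).1 h
  exact (g.supportedIn_iff I).2 ⟨a, b, ha, hb, fun θ hθ => h0 θ (h1 θ hθ)⟩

theorem Loop.SupportedIn.add {f g : Loop F} {I : Arc} (hf : f.SupportedIn I)
    (hg : g.SupportedIn I) : (f + g).SupportedIn I :=
  (tsupport_add f.toFun g.toFun).trans (Set.union_subset hf hg)

theorem Loop.SupportedIn.sub {f g : Loop F} {I : Arc} (hf : f.SupportedIn I)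
    (hg : g.SupportedIn I) : (f - g).SupportedIn I :=
  (tsupport_sub f.toFun g.toFun).trans (Set.union_subset hf hg)

theorem Loop.SupportedIn.smul {f : Loop F} {I : Arc} (hf : f.SupportedIn I) (c : ℝ) :
    (c • f).SupportedIn I :=
  hf.of_forall fun θ h => by rw [Loop.smul_apply, h, smul_zero]

theorem Loop.SupportedIn.smulVec {f : Loop ℝ} {I : Arc} (hf : f.SupportedIn I) (p : F) :
    (f.smulVec p).SupportedIn I := by
  obtain ⟨a, b, ha, hb, h1⟩ := (f.supportedIn_iff I).1 hf
  exact ((f.smulVec p).supportedIn_iff I).2 ⟨a, b, ha, hb, fun θ hθ => by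
    rw [Loop.smulVec_apply, h1 θ hθ, zero_smul]⟩

theorem Loop.SupportedIn.deriv {f : Loop F} {I : Arc} (hf : f.SupportedIn I) :
    f.deriv.SupportedIn I :=
  (tsupport_deriv_subset (𝕜 := ℝ) (f := f.toFun)).trans hf

theorem Loop.supportedIn_zero (I : Arc) : (0 : Loop F).SupportedIn I := by
  rw [Loop.supportedIn_iff]
  exact ⟨(I.lo + I.hi) / 2, (I.lo + I.hi) / 2, by linarith [I.lo_lt_hi], by linarith [I.lo_lt_hi],
    fun _ _ => rfl⟩

/-- The periodic continuation of a smooth function with compact support in an arc. -/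
theorem exists_loop_eq (I : Arc) (φ : ℝ → F) (hφ : ContDiff ℝ ∞ φ)
    (h : HasCompactSupport φ) (hs : tsupport φ ⊆ Set.Ioo I.lo I.hi) :
    ∃ f : Loop F, f.SupportedIn I ∧ ∀ θ ∈ Set.Icc I.lo (I.lo + 2 * Real.pi), f θ = φ θ := by
  obtain ⟨a, b, ha, hle, hb, hab⟩ : ∃ a b, I.lo < a ∧ a ≤ b ∧ b < I.hi ∧
      tsupport φ ⊆ Set.Icc a b := by
    rcases (tsupport φ).eq_empty_or_nonempty with he | hne
    · exact ⟨(I.lo + I.hi) / 2, (I.lo + I.hi) / 2, by linarith [I.lo_lt_hi],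
        le_rfl, by linarith [I.lo_lt_hi], by rw [he]; exact Set.empty_subset _⟩
    · obtain ⟨a, ha, ha'⟩ := h.isCompact.exists_isLeast hne
      obtain ⟨b, hb, hb'⟩ := h.isCompact.exists_isGreatest hne
      exact ⟨a, b, (hs ha).1, ha' hb, (hs hb).2, fun x hx => ⟨ha' hx, hb' hx⟩⟩
  have h0 : ∀ θ, θ ∉ Set.Icc a b → φ θ = 0 := fun θ hθ =>
    image_eq_zero_of_notMem_tsupport fun h' => hθ (hab h')
  have hI := I.hi_lt
  have hI' := I.lo_lt_hi
  let g : ℝ → F := fun θ => φ (toIcoMod Real.two_pi_pos I.lo θ)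
  have hper : Function.Periodic g (2 * Real.pi) := fun θ => by
    simp only [g, toIcoMod_add_right]
  -- This open interval contains a full period, so every angle has a translate near which the
  -- continuation coincides with `φ`; smoothness follows.
  have hloc : ∀ θ ∈ Set.Ioo (b - 2 * Real.pi) (a + 2 * Real.pi), g θ = φ θ := by
    intro θ hθ
    rcases lt_or_ge θ I.lo with h1 | h1
    · have : toIcoMod Real.two_pi_pos I.lo θ = θ + 2 * Real.pi := by
        rw [← toIcoMod_add_right, toIcoMod_eq_self]
        exact ⟨by linarith [hθ.1], by linarith⟩
      simp only [g, this]
      rw [h0 _ fun h3 => by linarith [h3.2, hθ.1], h0 θ fun h3 => by linarith [h3.1]]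
    · rcases lt_or_ge θ (I.lo + 2 * Real.pi) with h2 | h2
      · simp only [g]
        rw [(toIcoMod_eq_self _).2 ⟨h1, h2⟩]
      · have : toIcoMod Real.two_pi_pos I.lo θ = θ - 2 * Real.pi := by
          rw [← toIcoMod_sub, toIcoMod_eq_self]
          exact ⟨by linarith, by linarith [hθ.2]⟩
        simp only [g, this]
        rw [h0 _ fun h3 => by linarith [h3.1, hθ.2], h0 _ fun h3 => by linarith [h3.2]]
  have hsm : ContDiff ℝ ∞ g := by
    rw [contDiff_iff_contDiffAt]
    intro θ
    obtain ⟨k, hk⟩ := exists_add_int_mul_mem_Ico I.lo θ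
    have h1 : ContDiffAt ℝ ∞ (fun x => φ (x + k * (2 * Real.pi))) θ :=
      (hφ.comp (contDiff_id.add contDiff_const)).contDiffAt
    refine h1.congr_of_eventuallyEq ?_
    have h2 : Set.Ioo (b - 2 * Real.pi) (a + 2 * Real.pi) ∈ nhds (θ + k * (2 * Real.pi)) :=
      Ioo_mem_nhds (by linarith [hk.1]) (by linarith [hk.2])
    have h3 : Filter.Tendsto (fun x : ℝ => x + k * (2 * Real.pi)) (nhds θ)
        (nhds (θ + k * (2 * Real.pi))) := (continuous_id.add continuous_const).tendsto θ
    filter_upwards [h3 h2] with x hx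
    rw [← hloc _ hx]
    exact (hper.int_mul k x).symm
  refine ⟨⟨g, hsm, hper⟩, (Loop.supportedIn_iff _ _).2 ⟨(I.lo + a) / 2, (b + I.hi) / 2,
    by linarith, by linarith, fun θ hθ => ?_⟩, fun θ hθ => hloc θ ⟨by linarith [hθ.1], by linarith [hθ.2]⟩⟩
  change g θ = 0
  rcases le_or_gt (a + 2 * Real.pi) θ with h1 | h1
  · linarith [hθ.2]
  rw [hloc θ ⟨by linarith [hθ.1], h1⟩, h0]
  exact fun h2 => by linarith [hθ.1, h2.2]

theorem Loop.intervalIntegrable (f : Loop F) (a b : ℝ) :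
    IntervalIntegrable f.toFun MeasureTheory.volume a b := f.continuous.intervalIntegrable a b

theorem charge_eq (f : Loop F) (a : ℝ) :
    charge f = (2 * Real.pi)⁻¹ • ∫ θ in a..(a + 2 * Real.pi), f θ := by
  rw [charge, f.periodic.intervalIntegral_add_eq a 0, zero_add]

theorem charge_smulVec [CompleteSpace F] (f : Loop ℝ) (p : F) :
    charge (f.smulVec p) = charge f • p := by
  simp only [charge, Loop.smulVec_apply]
  rw [intervalIntegral.integral_smul_const, smul_assoc]

theorem charge_sub (f g : Loop F) : charge (f - g) = charge f - charge g := by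
  simp only [charge, Loop.sub_apply]
  rw [intervalIntegral.integral_sub (f.intervalIntegrable _ _) (g.intervalIntegrable _ _), smul_sub]

/-- There is a loop of charge one in every arc. -/
theorem exists_loop_charge_eq_one (I : Arc) : ∃ b : Loop ℝ, b.SupportedIn I ∧ charge b = 1 := by
  have hI := I.lo_lt_hi
  let c : ContDiffBump ((I.lo + I.hi) / 2) :=
    ⟨(I.hi - I.lo) / 8, (I.hi - I.lo) / 4, by linarith, by linarith⟩
  have hs : tsupport (c : ℝ → ℝ) ⊆ Set.Ioo I.lo I.hi := by
    rw [c.tsupport_eq, Real.closedBall_eq_Icc]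
    intro x hx
    have h1 := hx.1
    have h2 := hx.2
    simp only [c] at h1 h2
    constructor <;> linarith
  obtain ⟨f, hf, hfe⟩ := exists_loop_eq I c c.contDiff c.hasCompactSupport hs
  have hpos : 0 < ∫ θ in I.lo..(I.lo + 2 * Real.pi), f θ := by
    have h1 : ∫ θ in I.lo..(I.lo + 2 * Real.pi), f θ =
        ∫ θ in I.lo..(I.lo + 2 * Real.pi), c θ := by
      refine intervalIntegral.integral_congr fun θ hθ => ?_
      rw [Set.uIcc_of_le (by linarith [Real.two_pi_pos])] at hθ
      exact hfe θ hθ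
    rw [h1, intervalIntegral.integral_of_le (by linarith [Real.two_pi_pos]),
      MeasureTheory.setIntegral_eq_integral_of_forall_compl_eq_zero]
    · exact c.integral_pos
    · intro θ hθ
      refine image_eq_zero_of_notMem_tsupport fun h2 => hθ ?_
      have := hs h2
      exact ⟨this.1, by linarith [this.2, I.hi_lt]⟩
  have hc : charge f ≠ 0 := by
    rw [charge_eq f I.lo]
    have := Real.two_pi_pos
    positivity
  refine ⟨(charge f)⁻¹ • f, hf.smul _, ?_⟩
  have : charge ((charge f)⁻¹ • f) = (charge f)⁻¹ • charge f := by
    generalize (charge f)⁻¹ = r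
    simp only [charge, Loop.smul_apply]
    rw [intervalIntegral.integral_smul, smul_comm]
  rw [this, smul_eq_mul, inv_mul_cancel₀ hc]

theorem exists_loop_charge_eq [CompleteSpace F] (I : Arc) (p : F) :
    ∃ f : Loop F, f.SupportedIn I ∧ charge f = p := by
  obtain ⟨b, hb, hb1⟩ := exists_loop_charge_eq_one I
  exact ⟨b.smulVec p, hb.smulVec p, by rw [charge_smulVec, hb1, one_smul]⟩

/-- The primitive of a neutral loop. -/
def Loop.primitive [CompleteSpace F] (f : Loop F) (hf : charge f = 0) (a : ℝ) : Loop F where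
  toFun θ := ∫ x in a..θ, f x
  smooth := by
    rw [contDiff_infty_iff_deriv]
    have h : ∀ θ, HasDerivAt (fun θ => ∫ x in a..θ, f x) (f θ) θ := fun θ =>
      f.continuous.integral_hasStrictDerivAt a θ |>.hasDerivAt
    refine ⟨fun θ => (h θ).differentiableAt, ?_⟩
    rw [funext fun θ => (h θ).deriv]
    exact f.smooth
  periodic θ := by
    have h0 : ∫ x in θ..(θ + 2 * Real.pi), f x = 0 := by
      have := charge_eq f θ
      rw [hf] at this
      exact ((smul_eq_zero.1 this.symm).resolve_left (by positivity))
    change ∫ x in a..(θ + 2 * Real.pi), f x = ∫ x in a..θ, f x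
    rw [← intervalIntegral.integral_add_adjacent_intervals (f.intervalIntegrable a θ)
      (f.intervalIntegrable θ _), h0, add_zero]

theorem Loop.primitive_apply [CompleteSpace F] (f : Loop F) (hf : charge f = 0) (a θ : ℝ) :
    f.primitive hf a θ = ∫ x in a..θ, f x := rfl

theorem Loop.deriv_primitive [CompleteSpace F] (f : Loop F) (hf : charge f = 0) (a : ℝ) :
    (f.primitive hf a).deriv = f :=
  Loop.ext fun θ => (f.continuous.integral_hasStrictDerivAt a θ).hasDerivAt.deriv

/-- The primitive starts at zero at the lower end of the arc. Neutrality makes it vanish again one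
period later, and it is constant where `f` vanishes. -/
theorem Loop.SupportedIn.primitive [CompleteSpace F] {f : Loop F} {I : Arc} (h : f.SupportedIn I)
    (hf : charge f = 0) : (f.primitive hf I.lo).SupportedIn I := by
  obtain ⟨a, b, ha, hb, h0⟩ := (f.supportedIn_iff I).1 h
  rw [Loop.supportedIn_iff]
  refine ⟨a, b, ha, hb, fun θ hθ => ?_⟩
  have h1 := (f.primitive hf I.lo).periodic I.lo
  rw [Loop.primitive_apply, Loop.primitive_apply, intervalIntegral.integral_same] at h1
  rw [Loop.primitive_apply, ← intervalIntegral.integral_add_adjacent_intervals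
    (f.intervalIntegrable _ (I.lo + 2 * Real.pi)) (f.intervalIntegrable _ _), h1, zero_add,
    intervalIntegral.integral_congr (g := fun _ => 0), intervalIntegral.integral_zero]
  intro x hx
  have hI := I.hi_lt
  have hx' : x ∈ Set.Icc b (a + 2 * Real.pi) := by
    rcases le_total (I.lo + 2 * Real.pi) θ with h3 | h3
    · rw [Set.uIcc_of_le h3] at hx
      exact ⟨by linarith [hx.1], hx.2.trans hθ.2⟩
    · rw [Set.uIcc_of_ge h3] at hx
      exact ⟨hθ.1.trans hx.1, by linarith [hx.2]⟩
  exact h0 x hx'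

end Loops

/-! ### Fourier coefficients and the Hardy function of a one-particle vector -/

section Fourier

open MeasureTheory AddCircle

/-- The Hilbert space `L²(S¹)`. -/
abbrev CircleL2 : Type := Lp ℂ 2 (haarAddCircle (T := 2 * Real.pi))

/-- The Fourier coefficients of a product. -/
theorem hasSum_fourierCoeff_mul (f g : CircleL2) (n : ℤ) :
    HasSum (fun k : ℤ => fourierCoeff f (n - k) * fourierCoeff g k)
      (fourierCoeff (fun x => f x * g x) n) := by
  have hm : MemLp (fun x : AddCircle (2 * Real.pi) => fourier n x * (starRingEnd ℂ) (f x)) 2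
      haarAddCircle := by
    refine (Lp.memLp f).congr_norm ?_ (Filter.Eventually.of_forall fun x => ?_)
    · exact (fourier n).continuous.aestronglyMeasurable.mul
        (Complex.continuous_conj.comp_aestronglyMeasurable (Lp.aestronglyMeasurable f))
    · rw [norm_mul, RCLike.norm_conj, fourier_apply, Circle.norm_coe, one_mul]
  have h := (fourierBasis (T := 2 * Real.pi)).hasSum_inner_mul_inner hm.toLp g
  have h1 : inner ℂ hm.toLp g = fourierCoeff (fun x => f x * g x) n := by
    rw [L2.inner_def, fourierCoeff]
    refine integral_congr_ae ?_
    filter_upwards [hm.coeFn_toLp] with x hx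
    rw [hx, RCLike.inner_apply, map_mul, Complex.conj_conj, fourier_neg, smul_eq_mul]
    ring
  rw [h1] at h
  refine h.congr_fun fun k => ?_
  rw [← fourierBasis.repr_apply_apply, fourierBasis_repr, ← inner_conj_symm,
    ← fourierBasis.repr_apply_apply, fourierBasis_repr]
  congr 1
  rw [fourierCoeff_congr_ae hm.coeFn_toLp, fourierCoeff, fourierCoeff, ← integral_conj]
  refine integral_congr_ae (Filter.Eventually.of_forall fun x => ?_)
  simp only [smul_eq_mul, map_mul, Complex.conj_conj, ← fourier_neg, neg_neg]
  rw [← mul_assoc, ← fourier_add, neg_sub, sub_eq_add_neg]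

/-- The function on the circle defined by a real loop. -/
def Loop.circle (φ : Loop ℝ) : C(AddCircle (2 * Real.pi), ℂ) where
  toFun := (φ.periodic.comp (fun x : ℝ => (x : ℂ))).lift
  continuous_toFun := by
    rw [(QuotientAddGroup.isQuotientMap_mk (N := AddSubgroup.zmultiples (2 * Real.pi))).continuous_iff]
    exact Complex.continuous_ofReal.comp φ.continuous

theorem Loop.circle_coe (φ : Loop ℝ) (θ : ℝ) :
    φ.circle (θ : AddCircle (2 * Real.pi)) = (φ θ : ℂ) := rfl

theorem Loop.conj_circle (φ : Loop ℝ) (x : AddCircle (2 * Real.pi)) :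
    (starRingEnd ℂ) (φ.circle x) = φ.circle x := by
  induction x using QuotientAddGroup.induction_on with
  | H θ => exact Complex.conj_ofReal _

/-- The Fourier coefficients of a real loop. -/
def Loop.coeff (φ : Loop ℝ) (k : ℤ) : ℂ :=
  fourierCoeffOn Real.two_pi_pos (fun θ => (φ θ : ℂ)) k

theorem Loop.coeff_eq (φ : Loop ℝ) (k : ℤ) (a : ℝ) : φ.coeff k =
    (2 * Real.pi : ℝ)⁻¹ • ∫ θ in a..(a + 2 * Real.pi), Complex.exp (-(Complex.I * k * θ)) * φ θ := by
  have hper : Function.Periodic (fun θ : ℝ => Complex.exp (-(Complex.I * k * θ)) * (φ θ : ℂ))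
      (2 * Real.pi) := by
    intro θ
    simp only [φ.periodic θ]
    congr 1
    rw [Complex.exp_eq_exp_iff_exists_int]
    exact ⟨-k, by push_cast; ring⟩
  rw [hper.intervalIntegral_add_eq a 0, Loop.coeff, fourierCoeffOn_eq_integral]
  simp only [one_div, sub_zero, zero_add]
  congr 1
  refine intervalIntegral.integral_congr fun θ _ => ?_
  simp only [fourier_coe_apply, smul_eq_mul]
  congr 2
  have := Complex.ofReal_ne_zero.2 Real.pi_ne_zero
  push_cast
  field_simp
  ring

theorem Loop.fourierCoeff_circle (φ : Loop ℝ) (k : ℤ) : fourierCoeff φ.circle k = φ.coeff k := by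
  rw [fourierCoeff_eq_intervalIntegral _ _ 0, φ.coeff_eq k 0, one_div]
  congr 1
  refine intervalIntegral.integral_congr fun θ _ => ?_
  simp only [fourier_coe_apply, smul_eq_mul, φ.circle_coe]
  congr 2
  have := Complex.ofReal_ne_zero.2 Real.pi_ne_zero
  push_cast
  field_simp

theorem Loop.coeff_neg (φ : Loop ℝ) (k : ℤ) : φ.coeff (-k) = (starRingEnd ℂ) (φ.coeff k) := by
  rw [← φ.fourierCoeff_circle, ← φ.fourierCoeff_circle, fourierCoeff, fourierCoeff, ← integral_conj]
  refine integral_congr_ae (Filter.Eventually.of_forall fun x => ?_)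
  simp only [smul_eq_mul, map_mul, φ.conj_circle, ← fourier_neg]

theorem Loop.coeff_deriv (φ : Loop ℝ) (k : ℤ) (hk : k ≠ 0) :
    φ.deriv.coeff k = Complex.I * k * φ.coeff k := by
  have h := fourierCoeffOn_of_hasDerivAt Real.two_pi_pos hk (f := fun θ => (φ θ : ℂ))
    (f' := fun θ => (φ.deriv θ : ℂ)) (fun x _ => (φ.hasDerivAt x).ofReal_comp)
    ((Complex.continuous_ofReal.comp φ.deriv.continuous).intervalIntegrable _ _)
  have hper : (φ (2 * Real.pi) : ℂ) = φ 0 := by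
    have := φ.periodic 0
    rw [zero_add] at this
    rw [this]
  rw [hper] at h
  change φ.coeff k = 1 / _ * (_ - _ * φ.deriv.coeff k) at h
  rw [h]
  have := Complex.ofReal_ne_zero.2 Real.pi_ne_zero
  have hk' : (k : ℂ) ≠ 0 := by exact_mod_cast hk
  have hI := Complex.I_ne_zero
  push_cast
  field_simp
  ring_nf

/-- The class of a real loop in `L²(S¹)`. -/
def Loop.toL2 (φ : Loop ℝ) : CircleL2 := ContinuousMap.toLp (E := ℂ) 2 haarAddCircle ℂ φ.circle

theorem Loop.coeFn_toL2 (φ : Loop ℝ) : φ.toL2 =ᵐ[haarAddCircle] φ.circle :=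
  ContinuousMap.coeFn_toLp haarAddCircle φ.circle

theorem Loop.fourierCoeff_toL2 (φ : Loop ℝ) (k : ℤ) : fourierCoeff φ.toL2 k = φ.coeff k := by
  rw [← φ.fourierCoeff_circle]
  exact fourierCoeff_toLp _ k

/-- The coefficients `conj(hₙ₋₁) / √n`, `n ≥ 1`. -/
def hardyCoeff (h : ℕ → ℂ) (k : ℤ) : ℂ :=
  if 0 < k then (starRingEnd ℂ) (h (k - 1).toNat) * ((Real.sqrt k : ℝ) : ℂ)⁻¹ else 0

theorem hardyCoeff_natCast_add_one (h : ℕ → ℂ) (n : ℕ) :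
    hardyCoeff h (n + 1) = (starRingEnd ℂ) (h n) * ((Real.sqrt (n + 1) : ℝ) : ℂ)⁻¹ := by
  rw [hardyCoeff, if_pos (by omega)]
  simp

theorem hardyCoeff_of_nonpos (h : ℕ → ℂ) {k : ℤ} (hk : k ≤ 0) : hardyCoeff h k = 0 :=
  if_neg (not_lt.2 hk)

theorem natCast_add_one_injective : Function.Injective fun n : ℕ => ((n : ℤ) + 1) :=
  fun a b h => by simpa using h

theorem notMem_range_natCast_add_one {k : ℤ} (hk : k ∉ Set.range fun n : ℕ => ((n : ℤ) + 1)) :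
    k ≤ 0 := by
  by_contra! h
  exact hk ⟨(k - 1).toNat, by simp; omega⟩

theorem memℓp_hardyCoeff (h : HilbertSeq ℕ) : Memℓp (hardyCoeff h) 2 := by
  refine memℓp_gen ?_
  rw [← natCast_add_one_injective.summable_iff]
  · refine Summable.of_nonneg_of_le (fun n => Real.rpow_nonneg (norm_nonneg _) _) (fun n => ?_)
      ((lp.memℓp h).summable (by simp))
    simp only [Function.comp, hardyCoeff_natCast_add_one]
    refine Real.rpow_le_rpow (norm_nonneg _) ?_ (by simp)
    rw [norm_mul, RCLike.norm_conj, norm_inv, Complex.norm_real,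
      Real.norm_of_nonneg (Real.sqrt_nonneg _)]
    refine mul_le_of_le_one_right (norm_nonneg _) (inv_le_one_of_one_le₀ ?_)
    rw [Real.one_le_sqrt]
    linarith [(Nat.cast_nonneg n : (0 : ℝ) ≤ n)]
  · intro k hk
    rw [hardyCoeff_of_nonpos _ (notMem_range_natCast_add_one hk)]
    simp

/-- The function `∑ₙ conj(hₙ₋₁) n^{-1/2} e^{inθ}`. -/
def hardy (h : HilbertSeq ℕ) : CircleL2 :=
  fourierBasis.repr.symm ⟨hardyCoeff h, memℓp_hardyCoeff h⟩

theorem fourierCoeff_hardy (h : HilbertSeq ℕ) (k : ℤ) :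
    fourierCoeff (hardy h) k = hardyCoeff h k := by
  rw [← fourierBasis_repr, hardy, LinearIsometryEquiv.apply_symm_apply]

/-- The derivative multiplies the mode `-n` by `-in`, and `n · n^{-1/2} = √n` recovers the weight of
the one-particle space. The nonlocal inner product thereby becomes an integral over the circle,
where conditions on arcs can be read off. -/
theorem hasSum_hardy (h : HilbertSeq ℕ) (φ : Loop ℝ) :
    HasSum (fun n : ℕ => (starRingEnd ℂ) (h n) *
      (((Real.sqrt (n + 1) : ℝ) : ℂ) * φ.coeff (-(n + 1))))
      (Complex.I * ∫ x, hardy h x * φ.deriv.circle x ∂haarAddCircle) := by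
  have h1 := hasSum_fourierCoeff_mul φ.deriv.toL2 (hardy h) 0
  have h2 : fourierCoeff (fun x => φ.deriv.toL2 x * hardy h x) 0 =
      ∫ x, hardy h x * φ.deriv.circle x ∂haarAddCircle := by
    rw [fourierCoeff]
    refine integral_congr_ae ?_
    filter_upwards [φ.deriv.coeFn_toL2] with x hx
    simp [hx, mul_comm]
  rw [h2, ← natCast_add_one_injective.hasSum_iff] at h1
  · refine (h1.mul_left Complex.I).congr_fun fun n => ?_
    have hn : (-((n : ℤ) + 1)) ≠ 0 := by omega
    have hs : ((Real.sqrt (n + 1) : ℝ) : ℂ) ≠ 0 := by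
      exact Complex.ofReal_ne_zero.2 (Real.sqrt_pos.2 (by positivity)).ne'
    have hs2 : ((Real.sqrt (n + 1) : ℝ) : ℂ) * ((Real.sqrt (n + 1) : ℝ) : ℂ) = n + 1 := by
      rw [← Complex.ofReal_mul, Real.mul_self_sqrt (by positivity)]
      push_cast; rfl
    simp only [Function.comp, fourierCoeff_hardy, hardyCoeff_natCast_add_one, zero_sub,
      Loop.fourierCoeff_toL2, φ.coeff_deriv _ hn]
    field_simp
    rw [sq, hs2, Complex.I_sq]
    push_cast
    ring
  · intro k hk
    rw [fourierCoeff_hardy, hardyCoeff_of_nonpos _ (notMem_range_natCast_add_one hk), mul_zero]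

end Fourier

/-! ### The one-particle inner product and its symplectic form -/

section OneParticle

open MeasureTheory AddCircle

variable {F : Type*} [NormedAddCommGroup F] [InnerProductSpace ℝ F] [FiniteDimensional ℝ F]

/-- The components of a loop in the standard orthonormal basis. -/
def Loop.comp (f : Loop F) (j : Fin (Module.finrank ℝ F)) : Loop ℝ where
  toFun θ := inner ℝ (stdOrthonormalBasis ℝ F j) (f θ)
  smooth := contDiff_const.inner ℝ f.smooth
  periodic θ := by simp only [f.periodic θ]

theorem Loop.oneParticle_apply (f : Loop F) (x : ModeIndex F) :
    f.oneParticle x = ((Real.sqrt (x.1 + 1) : ℝ) : ℂ) * (f.comp x.2).coeff (-(x.1 + 1)) := rfl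

/-- The components of a one-particle vector. -/
def row (h : OneParticle F) (j : Fin (Module.finrank ℝ F)) : HilbertSeq ℕ :=
  ⟨fun n => h (n, j), memℓp_gen <| by
    have h := (lp.memℓp h).summable (by simp)
    exact h.comp_injective (i := fun n : ℕ => ((n, j) : ModeIndex F))
      fun a b hab => by simpa using hab⟩

omit [FiniteDimensional ℝ F] in
theorem row_apply (h : OneParticle F) (j : Fin (Module.finrank ℝ F)) (n : ℕ) :
    row h j n = h (n, j) := rfl

theorem inner_oneParticle (h : OneParticle F) (f : Loop F) :
    inner ℂ h f.oneParticle =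
      ∑ j, Complex.I * ∫ x, hardy (row h j) x * (f.comp j).deriv.circle x ∂haarAddCircle := by
  have h1 := lp.hasSum_inner (𝕜 := ℂ) h f.oneParticle
  rw [← (Equiv.prodComm _ _).hasSum_iff] at h1
  refine (h1.prod_fiberwise fun j => ?_).unique (hasSum_fintype _)
  refine (hasSum_hardy (row h j) (f.comp j)).congr_fun fun n => ?_
  simp only [Function.comp, Equiv.prodComm_apply, Prod.swap_prod_mk, f.oneParticle_apply,
    RCLike.inner_apply, row_apply]
  ring

theorem Loop.coeff_add (φ ψ : Loop ℝ) (k : ℤ) : (φ + ψ).coeff k = φ.coeff k + ψ.coeff k := by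
  have hc : ∀ χ : Loop ℝ, IntervalIntegrable
      (fun θ : ℝ => Complex.exp (-(Complex.I * k * θ)) * (χ θ : ℂ)) volume 0 (0 + 2 * Real.pi) :=
    fun χ => ((by fun_prop : Continuous fun θ : ℝ => Complex.exp (-(Complex.I * k * θ))).mul
      (Complex.continuous_ofReal.comp χ.continuous)).intervalIntegrable _ _
  rw [φ.coeff_eq k 0, ψ.coeff_eq k 0, (φ + ψ).coeff_eq k 0, ← smul_add,
    ← intervalIntegral.integral_add (hc φ) (hc ψ)]
  congr 1
  refine intervalIntegral.integral_congr fun θ _ => ?_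
  simp only [Loop.add_apply]
  push_cast
  ring

theorem Loop.coeff_smul (c : ℝ) (φ : Loop ℝ) (k : ℤ) : (c • φ).coeff k = c * φ.coeff k := by
  rw [φ.coeff_eq k 0, (c • φ).coeff_eq k 0, mul_smul_comm, ← intervalIntegral.integral_const_mul]
  congr 1
  refine intervalIntegral.integral_congr fun θ _ => ?_
  simp only [Loop.smul_apply, smul_eq_mul]
  push_cast
  ring

theorem Loop.comp_add (f g : Loop F) (j : Fin (Module.finrank ℝ F)) :
    (f + g).comp j = f.comp j + g.comp j :=
  Loop.ext fun _ => inner_add_right _ _ _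

theorem Loop.comp_smul (c : ℝ) (f : Loop F) (j : Fin (Module.finrank ℝ F)) :
    (c • f).comp j = c • f.comp j :=
  Loop.ext fun _ => inner_smul_right _ _ _

theorem Loop.comp_deriv (f : Loop F) (j : Fin (Module.finrank ℝ F)) :
    (f.comp j).deriv = f.deriv.comp j := by
  refine Loop.ext fun θ => HasDerivAt.deriv ?_
  have := (hasDerivAt_const θ (stdOrthonormalBasis ℝ F j)).inner ℝ (f.hasDerivAt θ)
  rw [inner_zero_left, add_zero] at this
  exact this

theorem Loop.oneParticle_add (f g : Loop F) :
    (f + g).oneParticle = f.oneParticle + g.oneParticle := by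
  refine lp.ext (funext fun x => ?_)
  rw [lp.coeFn_add, Pi.add_apply, Loop.oneParticle_apply, Loop.oneParticle_apply,
    Loop.oneParticle_apply, Loop.comp_add, Loop.coeff_add, mul_add]

theorem Loop.oneParticle_smul (c : ℝ) (f : Loop F) :
    (c • f).oneParticle = c • f.oneParticle := by
  refine lp.ext (funext fun x => ?_)
  rw [lp.coeFn_smul, Pi.smul_apply, Loop.oneParticle_apply, Loop.oneParticle_apply,
    Loop.comp_smul, Loop.coeff_smul, Complex.real_smul, mul_left_comm]

theorem Loop.charge_deriv {E : Type*} [NormedAddCommGroup E] [NormedSpace ℝ E] [CompleteSpace E]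
    (f : Loop E) : charge f.deriv = 0 := by
  have := f.periodic 0
  rw [zero_add] at this
  rw [charge, intervalIntegral.integral_eq_sub_of_hasDerivAt (fun x _ => f.hasDerivAt x)
    (f.deriv.intervalIntegrable _ _), this, sub_self, smul_zero]

theorem integral_circle (f : ℝ → ℂ) (g : AddCircle (2 * Real.pi) → ℂ) (h : ∀ θ : ℝ, g θ = f θ) :
    ∫ x, g x ∂haarAddCircle = (2 * Real.pi : ℝ)⁻¹ • ∫ θ in (0 : ℝ)..(2 * Real.pi), f θ := by
  rw [integral_haarAddCircle, ← AddCircle.intervalIntegral_preimage (2 * Real.pi) 0, zero_add]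
  simp only [h]

/-- The pairing of the positive part of a real loop with a derivative. -/
theorem two_mul_re_integral_hardy (φ ψ : Loop ℝ) (u : CircleL2)
    (hu : ∀ n : ℕ, fourierCoeff u (n + 1) = φ.coeff (n + 1)) (hu0 : ∀ k ≤ 0, fourierCoeff u k = 0) :
    2 * (∫ x, u x * ψ.deriv.circle x ∂haarAddCircle).re =
      (2 * Real.pi)⁻¹ * ∫ θ in (0 : ℝ)..(2 * Real.pi), φ θ * ψ.deriv θ := by
  have e : ∀ v : CircleL2, fourierCoeff (fun x => ψ.deriv.toL2 x * v x) 0 =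
      ∫ x, v x * ψ.deriv.circle x ∂haarAddCircle := by
    intro v
    rw [fourierCoeff]
    refine integral_congr_ae ?_
    filter_upwards [ψ.deriv.coeFn_toL2] with x hx
    simp [hx, mul_comm]
  have hS := hasSum_fourierCoeff_mul ψ.deriv.toL2 u 0
  rw [e, ← natCast_add_one_injective.hasSum_iff (fun k hk => by
    rw [hu0 k (notMem_range_natCast_add_one hk), mul_zero])] at hS
  set S := ∫ x, u x * ψ.deriv.circle x ∂haarAddCircle
  have hT := hasSum_fourierCoeff_mul ψ.deriv.toL2 φ.toL2 0
  rw [e] at hT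
  simp only [zero_sub, Loop.fourierCoeff_toL2, Function.comp_def, hu] at hS hT
  -- A derivative is neutral, so the zero mode of `φ`, which `u` lacks, does not contribute.
  have h0 : ψ.deriv.coeff 0 = 0 := by
    have := ψ.charge_deriv
    rw [charge_eq _ 0, smul_eq_zero] at this
    rw [Loop.coeff_eq _ _ 0]
    simp only [Int.cast_zero, mul_zero, zero_mul, neg_zero, Complex.exp_zero, one_mul]
    rw [intervalIntegral.integral_ofReal, this.resolve_left (by positivity)]
    simp
  have h1 : HasSum (fun n : ℕ => ψ.deriv.coeff (-(n : ℤ)) * φ.coeff n) S := by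
    rw [← hasSum_nat_add_iff' 1]
    simpa [h0] using hS
  have h2 : HasSum (fun n : ℕ => ψ.deriv.coeff (-(-((n : ℤ) + 1))) * φ.coeff (-((n : ℤ) + 1)))
      ((starRingEnd ℂ) S) := by
    refine (hS.map (starRingEnd ℂ) Complex.continuous_conj).congr_fun fun n => ?_
    rw [Function.comp, map_mul, ← Loop.coeff_neg, ← Loop.coeff_neg]
  -- By reality of the loops the negative modes contribute the conjugate of the positive ones, so
  -- the full pairing is `S + S̄`.
  have h3 := (HasSum.of_nat_of_neg_add_one (f := fun k : ℤ => ψ.deriv.coeff (-k) * φ.coeff k)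
    h1 h2).unique hT
  have h4 : ∫ x, φ.toL2 x * ψ.deriv.circle x ∂haarAddCircle =
      ∫ x, φ.circle x * ψ.deriv.circle x ∂haarAddCircle := by
    refine integral_congr_ae ?_
    filter_upwards [φ.coeFn_toL2] with x hx
    rw [hx]
  rw [h4, integral_circle (fun θ => ((φ θ * ψ.deriv θ : ℝ) : ℂ)) _ (fun θ => by
    rw [Loop.circle_coe, Loop.circle_coe, Complex.ofReal_mul]),
    intervalIntegral.integral_ofReal, Complex.add_conj] at h3
  have h5 := congrArg Complex.re h3
  rw [Complex.real_smul, ← Complex.ofReal_mul, Complex.ofReal_re, Complex.ofReal_re] at h5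
  exact h5

/-- The Hardy function of `[g]` has exactly the positive modes of `g`. Twice the real part of its
pairing with a derivative is therefore the local pairing of `g`, component by component. -/
theorem im_inner_oneParticle (g f : Loop F) :
    (inner ℂ g.oneParticle f.oneParticle).im =
      2⁻¹ * ((2 * Real.pi)⁻¹ * ∫ θ in (0 : ℝ)..(2 * Real.pi), inner ℝ (g θ) (f.deriv θ)) := by
  rw [inner_oneParticle, Complex.im_sum]
  have h : ∀ j, (Complex.I * ∫ x, hardy (row g.oneParticle j) x * (f.comp j).deriv.circle x
      ∂haarAddCircle).im = 2⁻¹ * ((2 * Real.pi)⁻¹ * ∫ θ in (0 : ℝ)..(2 * Real.pi),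
        g.comp j θ * (f.comp j).deriv θ) := by
    intro j
    rw [Complex.I_mul_im, ← two_mul_re_integral_hardy (g.comp j) (f.comp j)
      (hardy (row g.oneParticle j))]
    · ring
    · intro n
      have hs : ((Real.sqrt (n + 1) : ℝ) : ℂ) ≠ 0 :=
        Complex.ofReal_ne_zero.2 (Real.sqrt_pos.2 (by positivity)).ne'
      rw [fourierCoeff_hardy, hardyCoeff_natCast_add_one, row_apply, Loop.oneParticle_apply,
        map_mul, Complex.conj_ofReal, ← Loop.coeff_neg, neg_neg]
      field_simp
    · intro k hk
      rw [fourierCoeff_hardy, hardyCoeff_of_nonpos _ hk]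
  rw [Finset.sum_congr rfl fun j _ => h j, ← Finset.mul_sum, ← Finset.mul_sum,
    ← intervalIntegral.integral_finsetSum]
  · congr 2
    refine intervalIntegral.integral_congr fun θ _ => ?_
    simp only [Loop.comp_deriv]
    rw [← (stdOrthonormalBasis ℝ F).sum_inner_mul_inner]
    refine Finset.sum_congr rfl fun j _ => ?_
    rw [real_inner_comm]
    rfl
  · intro j _
    exact ((g.comp j).continuous.mul (f.comp j).deriv.continuous).intervalIntegrable _ _

end OneParticle

/-! ### Weak derivatives on arcs, and absence of jumps in `H^{1/2}` -/

section Circle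

open MeasureTheory AddCircle

/-- The lemma of du Bois-Reymond: a function on an arc whose weak derivative vanishes is constant. -/
theorem ae_eq_const_of_integral_mul_deriv_eq_zero (J : Arc) (w : ℝ → ℝ)
    (hw : IntervalIntegrable w volume J.lo (J.lo + 2 * Real.pi))
    (h : ∀ φ : Loop ℝ, φ.SupportedIn J →
      ∫ θ in J.lo..(J.lo + 2 * Real.pi), w θ * φ.deriv θ = 0) :
    ∃ c, ∀ᵐ θ, θ ∈ Set.Ioo J.lo J.hi → w θ = c := by
  obtain ⟨b, hb, hb1⟩ := exists_loop_charge_eq_one J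
  have hJ := J.hi_lt
  have hJ' := J.lo_lt_hi
  have hpi := Real.two_pi_pos
  have hle : J.lo ≤ J.lo + 2 * Real.pi := by linarith
  have hwi : ∀ φ : Loop ℝ, IntervalIntegrable (fun θ => w θ * φ θ) volume J.lo
      (J.lo + 2 * Real.pi) := fun φ => hw.mul_continuousOn φ.continuous.continuousOn
  -- The constant must be the mean of `w` against a loop `b` of charge one.
  set c : ℝ := (2 * Real.pi)⁻¹ * ∫ θ in J.lo..(J.lo + 2 * Real.pi), w θ * b θ with hc
  refine ⟨c, ?_⟩
  have hloc : IntegrableOn (fun θ => w θ - c) (Set.Ioo J.lo J.hi) := by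
    have h1 : IntegrableOn w (Set.Ioc J.lo (J.lo + 2 * Real.pi)) :=
      (intervalIntegrable_iff_integrableOn_Ioc_of_le hle).1 hw
    exact (h1.mono_set fun θ hθ => ⟨hθ.1, by linarith [hθ.2]⟩).sub
      (integrableOn_const (by simp))
  have key := isOpen_Ioo.ae_eq_zero_of_integral_contDiff_smul_eq_zero
    (U := Set.Ioo J.lo J.hi) (μ := volume) hloc.locallyIntegrableOn ?_
  · filter_upwards [key] with θ hθ hm
    exact sub_eq_zero.1 (hθ hm)
  · intro φ hφ hφc hφs
    obtain ⟨f, hf, hfe⟩ := exists_loop_eq J φ hφ hφc hφs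
    have h1 : ∫ θ, φ θ • (w θ - c) = ∫ θ in J.lo..(J.lo + 2 * Real.pi), (w θ * f θ - c * f θ) := by
      rw [intervalIntegral.integral_of_le hle,
        ← setIntegral_eq_integral_of_forall_compl_eq_zero (s := Set.Ioc J.lo (J.lo + 2 * Real.pi))]
      · refine setIntegral_congr_fun measurableSet_Ioc fun θ hθ => ?_
        simp only [hfe θ ⟨hθ.1.le, hθ.2⟩, smul_eq_mul]
        ring
      · intro θ hθ
        have h2 : φ θ = 0 := image_eq_zero_of_notMem_tsupport fun h2 => by
          have := hφs h2
          exact hθ ⟨this.1, by linarith [this.2]⟩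
        rw [h2, zero_smul]
    -- Subtracting a multiple of `b` makes the test function neutral, hence the derivative of a loop
    -- supported in `J`.
    have hneutral : charge (f - charge f • b) = 0 := by
      have : charge (charge f • b) = charge f • charge b := by
        generalize charge f = r
        simp only [charge, Loop.smul_apply]
        rw [intervalIntegral.integral_smul, smul_comm]
      rw [charge_sub, this, hb1, smul_eq_mul, mul_one, sub_self]
    have h2 := h _ ((hf.sub (hb.smul (charge f))).primitive hneutral)
    rw [Loop.deriv_primitive] at h2
    have h3 : ∀ θ, w θ * (f - charge f • b) θ = w θ * f θ - charge f * (w θ * b θ) := by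
      intro θ
      rw [Loop.sub_apply, Loop.smul_apply, smul_eq_mul]
      ring
    simp only [h3] at h2
    rw [intervalIntegral.integral_sub (hwi f) ((hwi b).const_mul _),
      intervalIntegral.integral_const_mul] at h2
    rw [h1, intervalIntegral.integral_sub (hwi f) ((f.intervalIntegrable _ _).const_mul _),
      intervalIntegral.integral_const_mul]
    have h4 := charge_eq f J.lo
    rw [smul_eq_mul] at h4
    rw [h4] at h2
    rw [← h2, hc]
    ring

theorem CircleL2.integrable (u : CircleL2) : Integrable u haarAddCircle :=
  (Lp.memLp u).integrable (by norm_num)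

theorem CircleL2.intervalIntegrable (u : CircleL2) (a : ℝ) :
    IntervalIntegrable (fun θ : ℝ => u (θ : AddCircle (2 * Real.pi))) volume a
      (a + 2 * Real.pi) := by
  rw [intervalIntegrable_iff_integrableOn_Ioc_of_le (by linarith [Real.two_pi_pos])]
  have h1 : Integrable u (volume : Measure (AddCircle (2 * Real.pi))) := by
    rw [volume_eq_smul_haarAddCircle]
    exact u.integrable.smul_measure ENNReal.ofReal_ne_top
  exact (AddCircle.measurePreserving_mk (2 * Real.pi) a).integrable_comp_of_integrable h1

theorem ae_circle_of_ae {p : AddCircle (2 * Real.pi) → Prop} (hp : MeasurableSet {x | p x}) (a : ℝ)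
    (h : ∀ᵐ θ : ℝ, θ ∈ Set.Ioc a (a + 2 * Real.pi) → p θ) : ∀ᵐ x ∂haarAddCircle, p x := by
  have h1 : (volume : Measure (AddCircle (2 * Real.pi))) {x | ¬ p x} = 0 := by
    change volume {x | p x}ᶜ = 0
    rw [AddCircle.add_projection_respects_measure (2 * Real.pi) a hp.compl]
    refine measure_mono_null (fun θ hθ => ?_) h
    exact fun h2 => hθ.1 (h2 hθ.2)
  rw [volume_eq_smul_haarAddCircle, Measure.smul_apply, smul_eq_mul, mul_eq_zero] at h1
  exact h1.resolve_left (by simpa using Real.pi_pos)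

theorem fourierCoeff_translate (u : CircleL2) (s : AddCircle (2 * Real.pi)) (k : ℤ) :
    fourierCoeff (fun x => u (x + s)) k = fourier k s * fourierCoeff u k := by
  have h : ∀ x, fourier (-k) x • u (x + s) =
      (fun y => fourier k s * (fourier (-k) y • u y)) (x + s) := by
    intro x
    have h1 : fourier k s * fourier (-k) (x + s) = fourier (-k) x := by
      simp only [fourier_apply, smul_add, toCircle_add, neg_smul, toCircle_neg, Circle.coe_mul,
        Circle.coe_inv]
      have := Circle.coe_ne_zero (toCircle (k • s))
      field_simp
    simp only [smul_eq_mul]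
    rw [← mul_assoc, h1]
  rw [fourierCoeff, integral_congr_ae (Filter.Eventually.of_forall h)]
  refine (integral_add_right_eq_self (μ := haarAddCircle)
    (fun y => fourier k s * (fourier (-k) y • u y)) s).trans ?_
  rw [integral_const_mul, fourierCoeff]

/-- Parseval for the difference of a function and its translate; a translation acts on the mode `k`
by a phase. -/
theorem integral_translate_sub_sq (u : CircleL2) (s : AddCircle (2 * Real.pi)) :
    ∫ x, ‖u (x + s) - u x‖ ^ 2 ∂haarAddCircle =
      ∑' k : ℤ, ‖fourierCoeff u k‖ ^ 2 * ‖fourier k s - 1‖ ^ 2 := by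
  have hmp : MeasurePreserving (fun x => x + s)
      (haarAddCircle (T := 2 * Real.pi)) haarAddCircle := measurePreserving_add_right _ _
  have hm1 : MemLp (fun x => u (x + s)) 2 haarAddCircle :=
    (Lp.memLp u).comp_measurePreserving hmp
  have hm : MemLp (fun x => u (x + s) - u x) 2 haarAddCircle := hm1.sub (Lp.memLp u)
  obtain ⟨v, hv⟩ : ∃ v : CircleL2, v =ᵐ[haarAddCircle] fun x => u (x + s) - u x :=
    ⟨hm.toLp, hm.coeFn_toLp⟩
  have h := tsum_sq_fourierCoeff v
  have h1 : ∫ x, ‖v x‖ ^ 2 ∂haarAddCircle = ∫ x, ‖u (x + s) - u x‖ ^ 2 ∂haarAddCircle := by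
    refine integral_congr_ae ?_
    filter_upwards [hv] with x hx
    rw [hx]
  rw [← h1, ← h]
  refine tsum_congr fun k => ?_
  rw [fourierCoeff_congr_ae hv, ← mul_pow, ← norm_mul]
  congr 2
  have h2 : fourierCoeff (fun x => u (x + s) - u x) k =
      fourierCoeff (fun x => u (x + s)) k - fourierCoeff u k := by
    have hi := (hm1.integrable (by norm_num)).fourier_smul (-k)
    simp only [fourierCoeff, smul_sub]
    exact integral_sub hi (u.integrable.fourier_smul (-k))
  rw [h2, fourierCoeff_translate]
  ring

/-- After division by `t`, the linear bound gives a majorant that is summable in `H^{1/2}`, while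
the quadratic one gives convergence to zero mode by mode. -/
theorem norm_fourier_coe_sub_one_sq_le (k : ℤ) (t : ℝ) :
    ‖fourier k (t : AddCircle (2 * Real.pi)) - 1‖ ^ 2 ≤ min (2 * (|k| * |t|)) ((|k| * |t|) ^ 2) := by
  have h1 : fourier k (t : AddCircle (2 * Real.pi)) = Complex.exp (Complex.I * (k * t : ℝ)) := by
    rw [fourier_coe_apply]
    congr 1
    have := Complex.ofReal_ne_zero.2 Real.pi_ne_zero
    push_cast
    field_simp
  have h2 := Real.norm_exp_I_mul_ofReal_sub_one_le (x := k * t)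
  rw [← h1, Real.norm_eq_abs, abs_mul] at h2
  have h3 : ‖fourier k (t : AddCircle (2 * Real.pi)) - 1‖ ≤ 2 := by
    refine (norm_sub_le _ _).trans ?_
    rw [fourier_apply, Circle.norm_coe, norm_one]
    norm_num
  have h0 := norm_nonneg (fourier k (t : AddCircle (2 * Real.pi)) - 1)
  push_cast
  refine le_min ?_ (pow_le_pow_left₀ h0 h2 2)
  nlinarith

/-- A function in `H^{1/2}` whose real part is constant on both sides of a point has no jump. -/
theorem eq_of_re_eq_const (u : CircleL2)
    (hu : Summable fun k : ℤ => |(k : ℝ)| * ‖fourierCoeff u k‖ ^ 2) (x δ c c' : ℝ) (hδ : 0 < δ)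
    (h1 : ∀ᵐ θ : ℝ, θ ∈ Set.Ioo (x - δ) x → (u (θ : AddCircle (2 * Real.pi))).re = c)
    (h2 : ∀ᵐ θ : ℝ, θ ∈ Set.Ioo x (x + δ) → (u (θ : AddCircle (2 * Real.pi))).re = c') :
    c = c' := by
  have hpi := Real.two_pi_pos
  -- `D(t)` is the squared `L²` distance of `u` and its translate by `t`, divided by `t`. For
  -- `H^{1/2}` functions it tends to zero as `t → 0⁺`, whereas a jump of height `c' - c` keeps it
  -- above `(c' - c)² / 2π`.
  set D : ℝ → ℝ := fun t => ∑' k : ℤ, ‖fourierCoeff u k‖ ^ 2 *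
    ‖fourier k (t : AddCircle (2 * Real.pi)) - 1‖ ^ 2 / t with hD
  have hlim : Filter.Tendsto D (nhdsWithin 0 (Set.Ioi 0)) (nhds (∑' _ : ℤ, 0)) := by
    refine tendsto_tsum_of_dominated_convergence (hu.mul_left 2) (fun k => ?_) ?_
    · have h3 : Filter.Tendsto (fun t : ℝ => ‖fourierCoeff u k‖ ^ 2 * (|(k : ℝ)| ^ 2 * t))
          (nhdsWithin 0 (Set.Ioi 0)) (nhds 0) := by
        have : Filter.Tendsto (fun t : ℝ => ‖fourierCoeff u k‖ ^ 2 * (|(k : ℝ)| ^ 2 * t))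
          (nhds 0) (nhds (‖fourierCoeff u k‖ ^ 2 * (|(k : ℝ)| ^ 2 * 0))) :=
          (by fun_prop : Continuous fun t : ℝ =>
            ‖fourierCoeff u k‖ ^ 2 * (|(k : ℝ)| ^ 2 * t)).tendsto 0
        rw [mul_zero, mul_zero] at this
        exact this.mono_left nhdsWithin_le_nhds
      refine squeeze_zero' ?_ ?_ h3
      · filter_upwards [self_mem_nhdsWithin] with t ht
        have : (0 : ℝ) < t := ht
        positivity
      · filter_upwards [self_mem_nhdsWithin] with t ht
        have ht : (0 : ℝ) < t := ht
        rw [div_le_iff₀ ht, mul_assoc]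
        refine mul_le_mul_of_nonneg_left ?_ (by positivity)
        have := (norm_fourier_coe_sub_one_sq_le k t).trans (min_le_right _ _)
        rw [abs_of_pos ht] at this
        push_cast at this
        nlinarith
    · filter_upwards [self_mem_nhdsWithin] with t ht k
      have ht : (0 : ℝ) < t := ht
      rw [Real.norm_of_nonneg (by positivity), div_le_iff₀ ht]
      have := (norm_fourier_coe_sub_one_sq_le k t).trans (min_le_left _ _)
      rw [abs_of_pos ht] at this
      push_cast at this
      nlinarith [mul_le_mul_of_nonneg_left this (sq_nonneg ‖fourierCoeff u k‖)]
  rw [tsum_zero] at hlim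
  have hlow : ∀ᶠ t in nhdsWithin (0 : ℝ) (Set.Ioi 0),
      (2 * Real.pi)⁻¹ * (c' - c) ^ 2 ≤ D t := by
    have hmem : Set.Ioo (0 : ℝ) (min δ (2 * Real.pi)) ∈ nhdsWithin (0 : ℝ) (Set.Ioi 0) :=
      Ioo_mem_nhdsGT (lt_min hδ hpi)
    filter_upwards [hmem] with t ht
    have ht0 := ht.1
    have htδ : t < δ := ht.2.trans_le (min_le_left _ _)
    have htpi : t < 2 * Real.pi := ht.2.trans_le (min_le_right _ _)
    have hDt : D t = (∫ x, ‖u (x + (t : AddCircle (2 * Real.pi))) - u x‖ ^ 2 ∂haarAddCircle) / t := by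
      rw [integral_translate_sub_sq, hD]
      exact tsum_div_const
    rw [hDt, le_div_iff₀ ht0, integral_haarAddCircle,
      ← AddCircle.intervalIntegral_preimage (2 * Real.pi) (x - t), smul_eq_mul, mul_assoc]
    refine mul_le_mul_of_nonneg_left ?_ (by positivity)
    set G : ℝ → ℝ := fun θ => ‖u ((θ : AddCircle (2 * Real.pi)) +
      (t : AddCircle (2 * Real.pi))) - u (θ : AddCircle (2 * Real.pi))‖ ^ 2 with hG
    have hGi : IntegrableOn G (Set.Ioc (x - t) (x - t + 2 * Real.pi)) := by
      have hmp : MeasurePreserving (fun x => x + (t : AddCircle (2 * Real.pi)))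
        (haarAddCircle (T := 2 * Real.pi)) haarAddCircle := measurePreserving_add_right _ _
      have hm : MemLp (fun x => u (x + (t : AddCircle (2 * Real.pi))) - u x) 2 haarAddCircle :=
        ((Lp.memLp u).comp_measurePreserving hmp).sub (Lp.memLp u)
      have h3 := hm.of_haarAddCircle.integrable_norm_pow (by norm_num)
      exact (AddCircle.measurePreserving_mk (2 * Real.pi) (x - t)).integrable_comp_of_integrable h3
    rw [intervalIntegral.integral_of_le (by linarith)]
    -- On this interval of length `t`, `θ` and `θ + t` lie on different sides of `x`.
    have h3 : ∫ _ in Set.Ioo (x - t) x, (c' - c) ^ 2 ≤ ∫ θ in Set.Ioo (x - t) x, G θ := by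
      refine setIntegral_mono_ae_restrict (integrableOn_const (by simp))
        (hGi.mono_set fun θ hθ => ⟨hθ.1, by linarith [hθ.2]⟩) ?_
      rw [Filter.EventuallyLE, ae_restrict_iff' measurableSet_Ioo]
      have h2' : ∀ᵐ θ : ℝ, θ + t ∈ Set.Ioo x (x + δ) →
          (u ((θ + t : ℝ) : AddCircle (2 * Real.pi))).re = c' :=
        (measurePreserving_add_right volume t).quasiMeasurePreserving.ae h2
      filter_upwards [h1, h2'] with θ e1 e2 hθ
      have e1' := e1 ⟨by linarith [hθ.1], hθ.2⟩
      have e2' := e2 ⟨by linarith [hθ.1], by linarith [hθ.2]⟩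
      rw [← e1', ← e2', AddCircle.coe_add, ← Complex.sub_re, hG, ← sq_abs]
      exact pow_le_pow_left₀ (abs_nonneg _) (Complex.abs_re_le_norm _) 2
    have h4 : ∫ θ in Set.Ioo (x - t) x, G θ ≤
        ∫ θ in Set.Ioc (x - t) (x - t + 2 * Real.pi), G θ :=
      setIntegral_mono_set hGi (Filter.Eventually.of_forall fun θ => by positivity)
        (Filter.Eventually.of_forall fun θ hθ => ⟨hθ.1, by linarith [hθ.2]⟩)
    refine le_trans ?_ (h3.trans h4)
    rw [setIntegral_const, smul_eq_mul, Measure.real, Real.volume_Ioo,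
      ENNReal.toReal_ofReal (by linarith)]
    nlinarith
  have hle : (2 * Real.pi)⁻¹ * (c' - c) ^ 2 ≤ 0 := ge_of_tendsto hlim hlow
  have hsq : (c' - c) ^ 2 = 0 := by
    refine le_antisymm ?_ (sq_nonneg _)
    have := inv_pos.2 hpi
    nlinarith
  linarith [pow_eq_zero_iff (two_ne_zero) |>.1 hsq]

end Circle

/-! ### Functions with nonnegative spectrum: real squares and vanishing on an interval -/

section HardySpace

open MeasureTheory AddCircle

/-- A function with nonnegative spectrum and real square is constant. -/
theorem fourierCoeff_eq_zero_of_sq_real (g : CircleL2) (h0 : ∀ k < 0, fourierCoeff g k = 0)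
    (hr : ∀ᵐ x ∂haarAddCircle, (g x * g x).im = 0) (n : ℕ) (hn : n ≠ 0) :
    fourierCoeff g n = 0 := by
  -- The square has no negative modes, and being real it has no positive ones either.
  have hneg : ∀ n : ℤ, n < 0 → fourierCoeff (fun x => g x * g x) n = 0 := by
    intro n hn
    refine (hasSum_fourierCoeff_mul g g n).unique (hasSum_zero.congr_fun fun k => ?_)
    rcases lt_or_ge k 0 with hk | hk
    · rw [h0 k hk, mul_zero]
    · rw [h0 (n - k) (by omega), zero_mul]
  have hconj : ∀ n : ℤ, fourierCoeff (fun x => g x * g x) n =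
      (starRingEnd ℂ) (fourierCoeff (fun x => g x * g x) (-n)) := by
    intro n
    rw [fourierCoeff, fourierCoeff, ← integral_conj]
    refine integral_congr_ae ?_
    filter_upwards [hr] with x hx
    rw [smul_eq_mul, smul_eq_mul, map_mul, ← fourier_neg, neg_neg, Complex.conj_eq_iff_im.2 hx]
  have hpos : ∀ n : ℕ, n ≠ 0 → ∑ p ∈ Finset.HasAntidiagonal.antidiagonal n,
      fourierCoeff g p.1 * fourierCoeff g p.2 = 0 := by
    intro n hn
    have h1 := hasSum_fourierCoeff_mul g g n
    rw [hconj, hneg (-n) (by omega), map_zero, ← Nat.cast_injective.hasSum_iff (fun k hk => by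
      have : k < 0 := by
        by_contra! h
        exact hk ⟨k.toNat, by simp [h]⟩
      rw [h0 k this, mul_zero])] at h1
    have h2 : HasSum (fun k : ℕ => fourierCoeff g ((n : ℤ) - k) * fourierCoeff g k)
        (∑ k ∈ Finset.range (n + 1), fourierCoeff g ((n : ℤ) - k) * fourierCoeff g k) := by
      refine hasSum_sum_of_ne_finset_zero fun k hk => ?_
      rw [Finset.mem_range] at hk
      rw [h0 ((n : ℤ) - k) (by omega), zero_mul]
    rw [Finset.Nat.sum_antidiagonal_eq_sum_range_succ
      (fun i j => fourierCoeff g (i : ℤ) * fourierCoeff g (j : ℤ))]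
    rw [← h2.unique h1]
    refine Finset.sum_congr rfl fun k hk => ?_
    rw [Finset.mem_range] at hk
    rw [mul_comm, Nat.cast_sub (by omega)]
  -- As formal power series, `G²` is the square of a constant; in an integral domain `G` is then
  -- plus or minus that constant.
  let G : PowerSeries ℂ := PowerSeries.mk fun n => fourierCoeff g n
  have hG : G * G = PowerSeries.C (fourierCoeff g 0) * PowerSeries.C (fourierCoeff g 0) := by
    ext n
    rw [PowerSeries.coeff_mul, ← map_mul, PowerSeries.coeff_C]
    split_ifs with h
    · subst h; simp [G]
    · simpa [G] using hpos n h
  have hG' : G = PowerSeries.C (fourierCoeff g 0) ∨ G = -PowerSeries.C (fourierCoeff g 0) :=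
    mul_self_eq_mul_self_iff.1 hG
  have hc : PowerSeries.coeff n G = 0 := by
    rcases hG' with h | h <;> rw [h] <;> simp [PowerSeries.coeff_C, hn]
  simpa [G] using hc

/-- The function on the real line defined by a power series on the unit circle. -/
def boundaryValue (G : PowerSeries ℂ) (t : ℝ) : ℂ :=
  ∑' n : ℕ, PowerSeries.coeff n G * Complex.exp (Complex.I * (n * t : ℝ))

theorem norm_mul_exp_I (z : ℂ) (r : ℝ) : ‖z * Complex.exp (Complex.I * r)‖ = ‖z‖ := by
  rw [norm_mul, mul_comm Complex.I, Complex.norm_exp_ofReal_mul_I, mul_one]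

/-- Absolute summability makes the Cauchy product compatible with evaluation on the circle, so
pointwise products become products in the integral domain of power series. -/
theorem boundaryValue_mul (G H : PowerSeries ℂ) (hG : Summable fun n => ‖PowerSeries.coeff n G‖)
    (hH : Summable fun n => ‖PowerSeries.coeff n H‖) :
    (Summable fun n => ‖PowerSeries.coeff n (G * H)‖) ∧
      ∀ t, boundaryValue (G * H) t = boundaryValue G t * boundaryValue H t := by
  constructor
  · simp only [PowerSeries.coeff_mul]
    exact summable_norm_sum_mul_antidiagonal_of_summable_norm (f := fun n => PowerSeries.coeff n G)
      (g := fun n => PowerSeries.coeff n H) hG hH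
  · intro t
    rw [boundaryValue, boundaryValue, boundaryValue,
      tsum_mul_tsum_eq_tsum_sum_antidiagonal_of_summable_norm
        (f := fun n => PowerSeries.coeff n G * Complex.exp (Complex.I * (n * t : ℝ)))
        (g := fun n => PowerSeries.coeff n H * Complex.exp (Complex.I * (n * t : ℝ)))
        (by simpa only [norm_mul_exp_I] using hG) (by simpa only [norm_mul_exp_I] using hH)]
    refine tsum_congr fun n => ?_
    rw [PowerSeries.coeff_mul, Finset.sum_mul]
    refine Finset.sum_congr rfl fun p hp => ?_
    rw [Finset.HasAntidiagonal.mem_antidiagonal] at hp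
    rw [mul_mul_mul_comm, ← Complex.exp_add, ← hp]
    congr 2
    push_cast
    ring

theorem boundaryValue_prod (G : ℕ → PowerSeries ℂ)
    (hG : ∀ m, Summable fun n => ‖PowerSeries.coeff n (G m)‖) (N : ℕ) :
    (Summable fun n => ‖PowerSeries.coeff n (∏ m ∈ Finset.range N, G m)‖) ∧
      ∀ t, boundaryValue (∏ m ∈ Finset.range N, G m) t =
        ∏ m ∈ Finset.range N, boundaryValue (G m) t := by
  induction N with
  | zero =>
    constructor
    · refine summable_of_hasFiniteSupport (Set.Finite.subset (Set.finite_singleton 0) ?_)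
      intro n hn
      by_contra h
      exact hn (by simp [PowerSeries.coeff_one, show n ≠ 0 from h])
    · intro t
      rw [boundaryValue, tsum_eq_single 0]
      · simp
      · intro n hn
        simp [PowerSeries.coeff_one, hn]
  | succ N ih =>
    simp only [Finset.prod_range_succ]
    have h := boundaryValue_mul _ _ ih.1 (hG N)
    exact ⟨h.1, fun t => by rw [h.2, ih.2]⟩

theorem fourier_coe_two_pi (k : ℤ) (t : ℝ) :
    fourier k (t : AddCircle (2 * Real.pi)) = Complex.exp (Complex.I * (k * t : ℝ)) := by
  rw [fourier_coe_apply]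
  congr 1
  have := Complex.ofReal_ne_zero.2 Real.pi_ne_zero
  push_cast
  field_simp

/-- The series converges uniformly on the circle, so orthonormality of the Fourier modes extracts
each coefficient from the zero function. -/
theorem eq_zero_of_boundaryValue_eq_zero (G : PowerSeries ℂ)
    (hG : Summable fun n => ‖PowerSeries.coeff n G‖) (h : ∀ t, boundaryValue G t = 0) : G = 0 := by
  have hsum : Summable fun n : ℕ => PowerSeries.coeff n G •
      (fourier n : C(AddCircle (2 * Real.pi), ℂ)) := by
    refine Summable.of_norm (hG.congr fun n => ?_)
    rw [norm_smul, fourier_norm, mul_one]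
  have hS := hsum.hasSum
  have h0 : ∑' n : ℕ, PowerSeries.coeff n G •
      (fourier n : C(AddCircle (2 * Real.pi), ℂ)) = 0 := by
    ext x
    induction x using QuotientAddGroup.induction_on with
    | H t =>
      have h1 := (ContinuousMap.evalCLM ℂ (t : AddCircle (2 * Real.pi))).hasSum hS
      rw [ContinuousMap.zero_apply, ← h t]
      refine h1.unique ?_
      have h2 : Summable fun n : ℕ =>
          PowerSeries.coeff n G * Complex.exp (Complex.I * (n * t : ℝ)) :=
        Summable.of_norm (by simpa only [norm_mul_exp_I] using hG)
      refine h2.hasSum.congr_fun fun n => ?_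
      simp only [ContinuousMap.evalCLM_apply, ContinuousMap.smul_apply,
        fourier_coe_two_pi, smul_eq_mul]
      push_cast
      rfl
  rw [h0] at hS
  ext m
  have h1 := (ContinuousMap.toLp (E := ℂ) 2 (haarAddCircle (T := 2 * Real.pi)) ℂ).hasSum hS
  have h2 := (innerSL ℂ (fourierLp (T := 2 * Real.pi) 2 m)).hasSum h1
  rw [map_zero, map_zero] at h2
  refine HasSum.unique ?_ h2
  have h3 := hasSum_ite_eq m (PowerSeries.coeff m G)
  refine h3.congr_fun fun n => ?_
  have h4 := orthonormal_iff_ite.1 (orthonormal_fourier (T := 2 * Real.pi)) (m : ℤ) n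
  change inner ℂ (fourierLp 2 (m : ℤ)) (ContinuousMap.toLp 2 haarAddCircle ℂ
    (PowerSeries.coeff n G • fourier (n : ℤ))) = _
  rw [map_smul, inner_smul_right]
  change _ * inner ℂ (fourierLp 2 (m : ℤ)) (fourierLp 2 (n : ℤ)) = _
  rw [h4]
  by_cases hmn : n = m
  · subst hmn; simp
  · rw [if_neg hmn, if_neg (by omega), mul_zero]

/-- The boundary value of an absolutely convergent power series that vanishes on an interval
vanishes identically. -/
theorem coeff_eq_zero_of_vanishing_near_zero (c : ℕ → ℂ) (hc : Summable fun n => ‖c n‖) (ε : ℝ)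
    (hε : 0 < ε)
    (h : ∀ t : ℝ, |t| < ε → ∑' n : ℕ, c n * Complex.exp (Complex.I * (n * t : ℝ)) = 0) (n : ℕ) :
    c n = 0 := by
  have hpi := Real.two_pi_pos
  -- Rotations in steps of `2π/N < ε` carry the zero interval over the whole circle. The product of
  -- the `N` rotated series vanishes everywhere, so one factor is zero, and rotation only changes
  -- coefficients by phases.
  obtain ⟨N, hN⟩ := exists_nat_gt (2 * Real.pi / ε)
  have hN0 : (0 : ℝ) < N := lt_trans (by positivity) hN
  let G : ℕ → PowerSeries ℂ := fun m =>
    PowerSeries.mk fun n => c n * Complex.exp (Complex.I * (n * (2 * Real.pi * m / N) : ℝ))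
  have hG : ∀ m, Summable fun n => ‖PowerSeries.coeff n (G m)‖ := fun m => by
    simpa only [G, PowerSeries.coeff_mk, norm_mul_exp_I] using hc
  have hval : ∀ m t, boundaryValue (G m) t =
      ∑' n : ℕ, c n * Complex.exp (Complex.I * (n * (2 * Real.pi * m / N + t) : ℝ)) := by
    intro m t
    refine tsum_congr fun n => ?_
    simp only [G, PowerSeries.coeff_mk]
    rw [mul_assoc, ← Complex.exp_add]
    congr 2
    push_cast
    ring
  have hprod := boundaryValue_prod G hG N
  have hzero : ∏ m ∈ Finset.range N, G m = 0 := by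
    refine eq_zero_of_boundaryValue_eq_zero _ hprod.1 fun t => ?_
    rw [hprod.2]
    -- Rounding `-t`, reduced modulo `2π`, down to a multiple of `2π/N` selects a factor evaluated
    -- at a point of `(-ε, 0]`.
    obtain ⟨k, hk0, hk1⟩ := exists_add_int_mul_mem_Ico 0 (-t)
    set s := -t + k * (2 * Real.pi) with hs
    have hm0 : 0 ≤ s * N / (2 * Real.pi) := by positivity
    have hm1 : s * N / (2 * Real.pi) < N := by
      rw [div_lt_iff₀ hpi]
      nlinarith
    have hlt : ⌊s * N / (2 * Real.pi)⌋₊ < N := (Nat.floor_lt hm0).2 hm1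
    refine Finset.prod_eq_zero (Finset.mem_range.2 hlt) ?_
    set m := ⌊s * N / (2 * Real.pi)⌋₊
    have h1 : (m : ℝ) ≤ s * N / (2 * Real.pi) := Nat.floor_le hm0
    have h2 : s * N / (2 * Real.pi) < m + 1 := Nat.lt_floor_add_one _
    rw [le_div_iff₀ hpi] at h1
    rw [div_lt_iff₀ hpi] at h2
    rw [hval, ← h (2 * Real.pi * m / N - s) ?_]
    · refine tsum_congr fun n => ?_
      congr 1
      rw [Complex.exp_eq_exp_iff_exists_int]
      refine ⟨n * k, ?_⟩
      rw [hs]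
      push_cast
      ring
    · rw [div_lt_iff₀ hε] at hN
      have e1 : 2 * Real.pi * m / N - s ≤ 0 := by
        rw [sub_nonpos, div_le_iff₀ hN0]; linarith
      have e2 : -ε < 2 * Real.pi * m / N - s := by
        rw [lt_sub_iff_add_lt, lt_div_iff₀ hN0]
        nlinarith
      rw [abs_of_nonpos e1]
      linarith
  rw [Finset.prod_eq_zero_iff] at hzero
  obtain ⟨m, _, hm⟩ := hzero
  have := congrArg (PowerSeries.coeff n) hm
  simp only [G, PowerSeries.coeff_mk, map_zero] at this
  exact (mul_eq_zero.1 this).resolve_right (Complex.exp_ne_zero _)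

end HardySpace

/-! ### The Reeh-Schlieder property -/

section ReehSchlieder

open MeasureTheory AddCircle

/-- The rotated loop. -/
def Loop.translate {E : Type*} [NormedAddCommGroup E] [NormedSpace ℝ E] (f : Loop E) (t : ℝ) :
    Loop E where
  toFun θ := f (θ - t)
  smooth := f.smooth.comp (contDiff_id.sub contDiff_const)
  periodic θ := by
    change f (θ + 2 * Real.pi - t) = f (θ - t)
    rw [add_sub_right_comm, f.periodic]

theorem Loop.coeff_translate (φ : Loop ℝ) (t : ℝ) (k : ℤ) :
    (φ.translate t).coeff k = Complex.exp (-(Complex.I * k * t)) * φ.coeff k := by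
  rw [φ.coeff_eq k 0, (φ.translate t).coeff_eq k (0 + t), mul_smul_comm,
    ← intervalIntegral.integral_const_mul, add_right_comm,
    ← intervalIntegral.integral_comp_add_right _ t]
  congr 1
  refine intervalIntegral.integral_congr fun θ _ => ?_
  simp only [Loop.translate, add_sub_cancel_right]
  rw [← mul_assoc, ← Complex.exp_add]
  congr 2
  push_cast
  ring

theorem Loop.SupportedIn.translate {E : Type*} [NormedAddCommGroup E] [NormedSpace ℝ E]
    {f : Loop E} {J K : Arc} (h : f.SupportedIn J) {t : ℝ} (h1 : K.lo ≤ J.lo + t)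
    (h2 : J.hi + t ≤ K.hi) : (f.translate t).SupportedIn K := by
  obtain ⟨a, b, ha, hb, h0⟩ := (f.supportedIn_iff J).1 h
  refine ((f.translate t).supportedIn_iff K).2 ⟨a + t, b + t, by linarith, by linarith,
    fun θ hθ => h0 (θ - t) ⟨?_, ?_⟩⟩ <;> linarith [hθ.1, hθ.2]

/-- For `b` of charge one, the complex function `b(θ) e^{ikθ}` has `k`-th coefficient one, so its
real or its imaginary part has a non-zero one. -/
theorem exists_coeff_ne_zero (J : Arc) (k : ℤ) : ∃ φ : Loop ℝ, φ.SupportedIn J ∧ φ.coeff k ≠ 0 := by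
  obtain ⟨b, hb, hb1⟩ := exists_loop_charge_eq_one J
  have hper : ∀ θ : ℝ, (k : ℝ) * (θ + 2 * Real.pi) = k * θ + k * (2 * Real.pi) := fun θ => by ring
  let c : Loop ℝ := ⟨fun θ => b θ * Real.cos (k * θ),
    b.smooth.mul (Real.contDiff_cos.comp (contDiff_const.mul contDiff_id)), fun θ => by
      simp only [b.periodic θ, hper, Real.cos_add_int_mul_two_pi]⟩
  let s : Loop ℝ := ⟨fun θ => b θ * Real.sin (k * θ),
    b.smooth.mul (Real.contDiff_sin.comp (contDiff_const.mul contDiff_id)), fun θ => by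
      simp only [b.periodic θ, hper, Real.sin_add_int_mul_two_pi]⟩
  have hc : c.SupportedIn J := hb.of_forall fun θ h => by simp only [c, h, zero_mul]
  have hs : s.SupportedIn J := hb.of_forall fun θ h => by simp only [s, h, zero_mul]
  by_contra! h
  have hi : ∀ φ : Loop ℝ, IntervalIntegrable
      (fun θ : ℝ => Complex.exp (-(Complex.I * k * θ)) * (φ θ : ℂ)) volume 0 (0 + 2 * Real.pi) :=
    fun φ => ((by fun_prop : Continuous fun θ : ℝ => Complex.exp (-(Complex.I * k * θ))).mul
      (Complex.continuous_ofReal.comp φ.continuous)).intervalIntegrable _ _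
  have hsum : c.coeff k + Complex.I * s.coeff k = 1 := by
    rw [c.coeff_eq k 0, s.coeff_eq k 0, mul_smul_comm, ← smul_add,
      ← intervalIntegral.integral_const_mul, ← intervalIntegral.integral_add (hi c)
      ((hi s).const_mul _)]
    rw [charge_eq _ 0, smul_eq_mul] at hb1
    rw [Complex.real_smul, ← Complex.ofReal_one, ← hb1, Complex.ofReal_mul,
      ← intervalIntegral.integral_ofReal]
    congr 1
    refine intervalIntegral.integral_congr fun θ _ => ?_
    have he : Complex.cos (k * θ) + Complex.I * Complex.sin (k * θ) =
        Complex.exp (Complex.I * k * θ) := by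
      rw [mul_assoc, mul_comm Complex.I (k * θ : ℂ), Complex.exp_mul_I]; ring
    simp only [c, s]
    push_cast
    calc _ = Complex.exp (-(Complex.I * k * θ)) *
          (Complex.cos (k * θ) + Complex.I * Complex.sin (k * θ)) * (b θ : ℂ) := by ring
      _ = _ := by rw [he, ← Complex.exp_add, neg_add_cancel, Complex.exp_zero, one_mul]
  rw [h c hc, h s hs] at hsum
  simp at hsum

/-- The Reeh-Schlieder property of the Hardy space. -/
theorem eq_zero_of_integral_hardy_eq_zero (h : HilbertSeq ℕ) (J : Arc)
    (h0 : ∀ φ : Loop ℝ, φ.SupportedIn J → ∫ x, hardy h x * φ.deriv.circle x ∂haarAddCircle = 0) :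
    h = 0 := by
  have hJ := J.lo_lt_hi
  have hJ' := J.hi_lt
  -- A test loop in the shrunken arc `K` stays in `J` under all rotations by less than `ε`. The
  -- pairing as a function of the rotation angle then vanishes near zero.
  set ε := (J.hi - J.lo) / 4 with hε
  let K : Arc := ⟨J.lo + ε, J.hi - ε, by linarith, by linarith⟩
  refine lp.ext (funext fun m => ?_)
  obtain ⟨φ, hφ, hφm⟩ := exists_coeff_ne_zero K (-(m + 1))
  have hkey := coeff_eq_zero_of_vanishing_near_zero
    (fun n : ℕ => (starRingEnd ℂ) (h n) * (((Real.sqrt (n + 1) : ℝ) : ℂ) * φ.coeff (-(n + 1))))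
    (hasSum_hardy h φ).summable.norm ε (by linarith) (fun t ht => ?_) m
  · have hs : ((Real.sqrt (m + 1) : ℝ) : ℂ) ≠ 0 :=
      Complex.ofReal_ne_zero.2 (Real.sqrt_pos.2 (by positivity)).ne'
    have := (mul_eq_zero.1 hkey).resolve_right (mul_ne_zero hs hφm)
    simpa using this
  · obtain ⟨ht1, ht2⟩ := abs_lt.1 ht
    have h1 := hasSum_hardy h (φ.translate t)
    rw [h0 _ (hφ.translate (by simp only [K]; linarith) (by simp only [K]; linarith)),
      mul_zero] at h1
    have h2 := (h1.mul_left (Complex.exp (-(Complex.I * t)))).tsum_eq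
    rw [mul_zero] at h2
    rw [← h2]
    refine tsum_congr fun n => ?_
    rw [Loop.coeff_translate]
    -- The mode `-(n + 1)` rotates by `e^{i(n+1)t}`; the common factor `e^{-it}` makes the power
    -- series start in degree zero.
    have h3 : Complex.exp (Complex.I * ((n * t : ℝ) : ℂ)) = Complex.exp (-(Complex.I * t)) *
        Complex.exp (-(Complex.I * ((-(n + 1) : ℤ) : ℂ) * t)) := by
      rw [← Complex.exp_add]
      congr 1
      push_cast
      ring
    rw [h3]
    ring

end ReehSchlieder

/-! ### One-particle Haag duality for scalar loops -/

section ScalarDuality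

open MeasureTheory AddCircle

theorem integral_mul_circle (u : CircleL2) (φ : Loop ℝ) (a : ℝ) :
    ∫ x, u x * φ.circle x ∂haarAddCircle = (2 * Real.pi : ℝ)⁻¹ •
      ∫ θ in a..(a + 2 * Real.pi), u (θ : AddCircle (2 * Real.pi)) * (φ θ : ℂ) := by
  rw [integral_haarAddCircle, ← AddCircle.intervalIntegral_preimage (2 * Real.pi) a]
  rfl

theorem intervalIntegrable_mul_loop (u : CircleL2) (φ : Loop ℝ) (a : ℝ) :
    IntervalIntegrable (fun θ : ℝ => u (θ : AddCircle (2 * Real.pi)) * (φ θ : ℂ)) volume a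
      (a + 2 * Real.pi) :=
  (u.intervalIntegrable a).mul_continuousOn
    (Complex.continuous_ofReal.comp φ.continuous).continuousOn

theorem re_integral_mul_circle (u : CircleL2) (φ : Loop ℝ) (a : ℝ) :
    (∫ x, u x * φ.circle x ∂haarAddCircle).re = (2 * Real.pi)⁻¹ *
      ∫ θ in a..(a + 2 * Real.pi), (u (θ : AddCircle (2 * Real.pi))).re * φ θ := by
  have h := Complex.reCLM.intervalIntegral_comp_comm (intervalIntegrable_mul_loop u φ a)
  simp only [Complex.reCLM_apply, Complex.re_mul_ofReal] at h
  rw [integral_mul_circle u φ a, Complex.smul_re, smul_eq_mul, h]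

theorem im_integral_mul_circle (u : CircleL2) (φ : Loop ℝ) (a : ℝ) :
    (∫ x, u x * φ.circle x ∂haarAddCircle).im = (2 * Real.pi)⁻¹ *
      ∫ θ in a..(a + 2 * Real.pi), (u (θ : AddCircle (2 * Real.pi))).im * φ θ := by
  have h := Complex.imCLM.intervalIntegral_comp_comm (intervalIntegrable_mul_loop u φ a)
  simp only [Complex.imCLM_apply, Complex.im_mul_ofReal] at h
  rw [integral_mul_circle u φ a, Complex.smul_im, smul_eq_mul, h]

theorem summable_abs_mul_sq_fourierCoeff_hardy (h : HilbertSeq ℕ) :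
    Summable fun k : ℤ => |(k : ℝ)| * ‖fourierCoeff (hardy h) k‖ ^ 2 := by
  rw [← natCast_add_one_injective.summable_iff]
  · have hs := (lp.memℓp h).summable (by simp)
    refine hs.congr fun n => ?_
    have hn : (0 : ℝ) < n + 1 := by positivity
    simp only [Function.comp, fourierCoeff_hardy, hardyCoeff_natCast_add_one]
    rw [norm_mul, RCLike.norm_conj, norm_inv, Complex.norm_real,
      Real.norm_of_nonneg (Real.sqrt_nonneg _), mul_pow, inv_pow, Real.sq_sqrt hn.le]
    push_cast
    rw [abs_of_pos hn]
    simp only [ENNReal.toReal_ofNat, Real.rpow_ofNat]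
    field_simp
  · intro k hk
    rw [fourierCoeff_hardy, hardyCoeff_of_nonpos _ (notMem_range_natCast_add_one hk)]
    simp

/-- Haag duality for a circle that is divided into three arcs, on the level of the Hardy space. -/
theorem eq_zero_of_hardy_dual (h : HilbertSeq ℕ) (J₁ J₂ J₃ : Arc) (h12 : J₁.hi = J₂.lo)
    (h23 : J₂.hi = J₃.lo) (h31 : J₃.hi = J₁.lo + 2 * Real.pi)
    (h1 : ∀ φ : Loop ℝ, φ.SupportedIn J₁ →
      (∫ x, hardy h x * φ.deriv.circle x ∂haarAddCircle).im = 0)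
    (h2 : ∀ φ : Loop ℝ, φ.SupportedIn J₂ →
      (∫ x, hardy h x * φ.deriv.circle x ∂haarAddCircle).re = 0)
    (h3 : ∀ φ : Loop ℝ, φ.SupportedIn J₃ →
      (∫ x, hardy h x * φ.deriv.circle x ∂haarAddCircle).re = 0) : h = 0 := by
  set u := hardy h with hu
  have hpi := Real.two_pi_pos
  have hre : ∀ a, IntervalIntegrable (fun θ : ℝ => (u (θ : AddCircle (2 * Real.pi))).re) volume a
      (a + 2 * Real.pi) := fun a => by
    have := u.intervalIntegrable a
    exact ⟨this.1.re, this.2.re⟩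
  have him : ∀ a, IntervalIntegrable (fun θ : ℝ => (u (θ : AddCircle (2 * Real.pi))).im) volume a
      (a + 2 * Real.pi) := fun a => by
    have := u.intervalIntegrable a
    exact ⟨this.1.im, this.2.im⟩
  obtain ⟨α, hα⟩ := ae_eq_const_of_integral_mul_deriv_eq_zero J₁ _ (him _) fun φ hφ => by
    have := h1 φ hφ
    rw [im_integral_mul_circle u _ J₁.lo] at this
    exact (mul_eq_zero.1 this).resolve_left (by positivity)
  have hreal : ∀ J : Arc, (∀ φ : Loop ℝ, φ.SupportedIn J →
      (∫ x, u x * φ.deriv.circle x ∂haarAddCircle).re = 0) → ∃ c, ∀ᵐ θ : ℝ, θ ∈ Set.Ioo J.lo J.hi →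
      (u (θ : AddCircle (2 * Real.pi))).re = c := fun J hJ =>
    ae_eq_const_of_integral_mul_deriv_eq_zero J _ (hre _) fun φ hφ => by
      have := hJ φ hφ
      rw [re_integral_mul_circle u _ J.lo] at this
      exact (mul_eq_zero.1 this).resolve_left (by positivity)
  obtain ⟨c, hc⟩ := hreal J₂ h2
  obtain ⟨c', hc'⟩ := hreal J₃ h3
  -- This is strong additivity: the common end point of `J₂` and `J₃` is invisible because the Hardy
  -- function lies in `H^{1/2}`.
  have hcc : c = c' := by
    have l2 := J₂.lo_lt_hi
    have l3 := J₃.lo_lt_hi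
    refine eq_of_re_eq_const u (summable_abs_mul_sq_fourierCoeff_hardy h) J₂.hi
      (min (J₂.hi - J₂.lo) (J₃.hi - J₃.lo)) c c' (lt_min (by linarith) (by linarith)) ?_ ?_
    · filter_upwards [hc] with θ hθ hm
      exact hθ ⟨by linarith [hm.1, min_le_left (J₂.hi - J₂.lo) (J₃.hi - J₃.lo)], hm.2⟩
    · filter_upwards [hc'] with θ hθ hm
      exact hθ ⟨by linarith [hm.1],
        by linarith [hm.2, min_le_right (J₂.hi - J₂.lo) (J₃.hi - J₃.lo)]⟩
  subst hcc
  set z : ℂ := ⟨c, α⟩ with hz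
  -- With `z = c + iα`, the function `u - z` is real on `J₁` and imaginary on `J₂` and `J₃`, so its
  -- square is real almost everywhere. The constant affects only the zero mode, which carries no
  -- information on `h`.
  let g : CircleL2 := u - z • fourierLp 2 0
  have hg : ∀ᵐ x ∂haarAddCircle, g x = u x - z := by
    filter_upwards [Lp.coeFn_sub u (z • fourierLp 2 0), Lp.coeFn_smul z
      (fourierLp (T := 2 * Real.pi) 2 0), coeFn_fourierLp (T := 2 * Real.pi) 2 0] with x h1 h2 h3
    rw [h1, Pi.sub_apply, h2, Pi.smul_apply, h3]
    simp
  have hcoeff : ∀ k ≠ 0, fourierCoeff g k = hardyCoeff h k := by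
    intro k hk
    have h4 : fourierCoeff (fourierLp (T := 2 * Real.pi) 2 0) k = 0 := by
      rw [← fourierBasis_repr, ← coe_fourierBasis, HilbertBasis.repr_self, lp.single_apply,
        Pi.single_eq_of_ne hk]
    rw [← fourierCoeff_hardy, ← fourierBasis_repr, map_sub, map_smul, lp.coeFn_sub, Pi.sub_apply,
      lp.coeFn_smul, Pi.smul_apply, fourierBasis_repr, fourierBasis_repr, h4, smul_zero, sub_zero]
  have hreal2 : ∀ᵐ x ∂haarAddCircle, ((u x - z) * (u x - z)).im = 0 := by
    have hm : Measurable u := (Lp.stronglyMeasurable u).measurable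
    refine ae_circle_of_ae (measurableSet_eq_fun (by fun_prop) measurable_const) J₁.lo ?_
    have hne : ∀ a : ℝ, ∀ᵐ θ : ℝ, θ ≠ a := fun a => compl_mem_ae_iff.2 (measure_singleton a)
    filter_upwards [hα, hc, hc', hne J₁.hi, hne J₂.hi, hne J₃.hi] with θ a1 a2 a3 b1 b2 b3 hθ
    rw [Complex.mul_im, mul_comm, ← two_mul, Complex.sub_re, Complex.sub_im]
    have hcases : θ ∈ Set.Ioo J₁.lo J₁.hi ∨ θ ∈ Set.Ioo J₂.lo J₂.hi ∨ θ ∈ Set.Ioo J₃.lo J₃.hi := by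
      rcases lt_or_gt_of_ne b1 with l1 | l1
      · exact Or.inl ⟨hθ.1, l1⟩
      rcases lt_or_gt_of_ne b2 with l2 | l2
      · exact Or.inr (Or.inl ⟨by linarith, l2⟩)
      · exact Or.inr (Or.inr ⟨by linarith, lt_of_le_of_ne (by linarith [hθ.2]) b3⟩)
    rcases hcases with hm | hm | hm
    · rw [a1 hm]; simp [z]
    · rw [a2 hm]; simp [z]
    · rw [a3 hm]; simp [z]
  refine lp.ext (funext fun n => ?_)
  have hfin := fourierCoeff_eq_zero_of_sq_real g (fun k hk => by
    rw [hcoeff k hk.ne, hardyCoeff_of_nonpos _ hk.le]) (by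
      filter_upwards [hg, hreal2] with x e1 e2
      rw [e1, e2]) (n + 1) (by omega)
  push_cast at hfin
  rw [hcoeff _ (by omega), hardyCoeff_natCast_add_one] at hfin
  have := (mul_eq_zero.1 hfin).resolve_right (inv_ne_zero
    (Complex.ofReal_ne_zero.2 (Real.sqrt_pos.2 (by positivity)).ne'))
  simpa using this

end ScalarDuality

/-! ### Local one-particle subspaces: totality, locality, duality -/

section LocalSubspace

open MeasureTheory AddCircle

variable {F : Type*} [NormedAddCommGroup F] [InnerProductSpace ℝ F] [FiniteDimensional ℝ F]

variable (F) in
/-- The classes of the loops with support in an arc. -/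
def localSubspace (J : Arc) : Submodule ℝ (OneParticle F) where
  carrier := {ξ | ∃ f : Loop F, f.SupportedIn J ∧ ξ = f.oneParticle}
  add_mem' := by
    rintro _ _ ⟨f, hf, rfl⟩ ⟨g, hg, rfl⟩
    exact ⟨f + g, hf.add hg, (Loop.oneParticle_add f g).symm⟩
  zero_mem' := ⟨(0 : ℝ) • (0 : Loop F), (Loop.supportedIn_zero J).smul 0, by
    rw [Loop.oneParticle_smul, zero_smul]⟩
  smul_mem' := by
    rintro c _ ⟨f, hf, rfl⟩
    exact ⟨c • f, hf.smul c, (Loop.oneParticle_smul c f).symm⟩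

theorem Loop.oneParticle_mem_localSubspace {f : Loop F} {J : Arc} (hf : f.SupportedIn J) :
    f.oneParticle ∈ localSubspace F J := ⟨f, hf, rfl⟩

theorem inner_oneParticle_smulVec (h : OneParticle F) (φ : Loop ℝ)
    (j : Fin (Module.finrank ℝ F)) :
    inner ℂ h (φ.smulVec (stdOrthonormalBasis ℝ F j)).oneParticle =
      Complex.I * ∫ x, hardy (row h j) x * φ.deriv.circle x ∂haarAddCircle := by
  have hc : ∀ i, (φ.smulVec (stdOrthonormalBasis ℝ F j)).comp i = if i = j then φ else 0 := by
    intro i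
    refine Loop.ext fun θ => ?_
    change inner ℝ (stdOrthonormalBasis ℝ F i) (φ θ • stdOrthonormalBasis ℝ F j) = _
    rw [inner_smul_right, orthonormal_iff_ite.1 (stdOrthonormalBasis ℝ F).orthonormal]
    split_ifs <;> simp [Loop.zero_apply]
  have h0 : (0 : Loop ℝ).deriv.circle = 0 := by
    have : (0 : Loop ℝ).deriv = 0 := Loop.ext fun θ => deriv_const θ (0 : ℝ)
    rw [this]
    ext x
    induction x using QuotientAddGroup.induction_on with
    | H t => simp [Loop.circle_coe, Loop.zero_apply]
  rw [inner_oneParticle, Finset.sum_eq_single j]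
  · rw [hc, if_pos rfl]
  · intro i _ hi
    rw [hc, if_neg hi, h0]
    simp
  · simp

omit [FiniteDimensional ℝ F] in
theorem eq_zero_of_row_eq_zero (h : OneParticle F) (h0 : ∀ j, row h j = 0) : h = 0 := by
  refine lp.ext (funext fun x => ?_)
  have := congrArg (fun v : HilbertSeq ℕ => v x.1) (h0 x.2)
  simpa [row_apply] using this

theorem isTotal_localSubspace (J : Arc) : IsTotal (localSubspace F J : Set (OneParticle F)) := by
  intro h hh
  refine eq_zero_of_row_eq_zero h fun j => eq_zero_of_integral_hardy_eq_zero _ J fun φ hφ => ?_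
  have := hh _ (Loop.oneParticle_mem_localSubspace (hφ.smulVec (stdOrthonormalBasis ℝ F j)))
  rw [inner_oneParticle_smulVec] at this
  exact (mul_eq_zero.1 this).resolve_left Complex.I_ne_zero

/-- Disjointness on the circle is reduced to order on the line by moving `θ` into the period that
begins at `J.lo`. -/
theorem Loop.SupportedIn.eq_zero_or_eq_zero {E : Type*} [NormedAddCommGroup E] [NormedSpace ℝ E]
    {f g : Loop E} {J K : Arc} (hf : f.SupportedIn J) (hg : g.SupportedIn K) (h1 : J.hi ≤ K.lo)
    (h2 : K.hi ≤ J.lo + 2 * Real.pi) (θ : ℝ) : f θ = 0 ∨ g θ = 0 := by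
  obtain ⟨k, hk0, hk1⟩ := exists_add_int_mul_mem_Ico J.lo θ
  rcases lt_or_ge (θ + k * (2 * Real.pi)) J.hi with h | h
  · right
    have := hg.apply_eq_zero (θ := θ + k * (2 * Real.pi) + 2 * Real.pi) (by linarith)
      (by linarith)
    rwa [g.periodic, g.apply_add_int_mul] at this
  · left
    have := hf.apply_eq_zero h hk1.le
    rwa [f.apply_add_int_mul] at this

/-- Locality on the level of the one-particle space. -/
theorem im_inner_oneParticle_eq_zero {f g : Loop F} {J K : Arc} (hf : f.SupportedIn J)
    (hg : g.SupportedIn K) (h1 : J.hi ≤ K.lo) (h2 : K.hi ≤ J.lo + 2 * Real.pi) :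
    (inner ℂ f.oneParticle g.oneParticle).im = 0 := by
  rw [im_inner_oneParticle, intervalIntegral.integral_congr (g := fun _ => 0)]
  · simp
  · intro θ _
    rcases hf.eq_zero_or_eq_zero hg.deriv h1 h2 θ with h | h
    · simp only [h, inner_zero_left]
    · simp only [h, inner_zero_right]

/-- Haag duality on the level of the one-particle space. -/
theorem isDual_localSubspace (J₁ J₂ J₃ : Arc) (h12 : J₁.hi = J₂.lo) (h23 : J₂.hi = J₃.lo)
    (h31 : J₃.hi = J₁.lo + 2 * Real.pi) :
    IsDual (localSubspace F J₁ : Set (OneParticle F))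
      (localSubspace F J₂ ⊔ localSubspace F J₃ : Submodule ℝ (OneParticle F)) where
  im_inner := by
    rintro _ ⟨f, hf, rfl⟩ y hy
    obtain ⟨_, ⟨g, hg, rfl⟩, _, ⟨g', hg', rfl⟩, rfl⟩ := Submodule.mem_sup.1 hy
    have l2 := J₂.lo_lt_hi
    have l3 := J₃.lo_lt_hi
    rw [inner_add_right, Complex.add_im, im_inner_oneParticle_eq_zero hf hg h12.le (by linarith),
      im_inner_oneParticle_eq_zero hf hg' (by linarith) h31.le, add_zero]
  eq_zero := by
    intro v hv1 hv2
    refine eq_zero_of_row_eq_zero v fun j => eq_zero_of_hardy_dual _ J₁ J₂ J₃ h12 h23 h31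
      (fun φ hφ => ?_) (fun φ hφ => ?_) (fun φ hφ => ?_)
    · have := hv1 _ (Loop.oneParticle_mem_localSubspace
        (hφ.smulVec (stdOrthonormalBasis ℝ F j)))
      rw [inner_oneParticle_smulVec, Complex.I_mul_re] at this
      exact neg_eq_zero.1 this
    · have := hv2 _ (Submodule.mem_sup_left (Loop.oneParticle_mem_localSubspace
        (hφ.smulVec (stdOrthonormalBasis ℝ F j))))
      rwa [inner_oneParticle_smulVec, Complex.I_mul_im] at this
    · have := hv2 _ (Submodule.mem_sup_right (Loop.oneParticle_mem_localSubspace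
        (hφ.smulVec (stdOrthonormalBasis ℝ F j))))
      rwa [inner_oneParticle_smulVec, Complex.I_mul_im] at this

end LocalSubspace

/-! ### Normal functionals on a bicommutant -/

section Density

variable {H : Type*} [NormedAddCommGroup H] [InnerProductSpace ℂ H] [CompleteSpace H] {κ : Type*}

variable (κ) in
/-- The diagonal action of an operator on a direct sum of copies of the space. -/
def amplify (a : H →L[ℂ] H) : lp (fun _ : κ => H) 2 →L[ℂ] lp (fun _ : κ => H) 2 :=
  lp.mapCLM 2 (fun _ => a) (norm_nonneg a) (fun _ => le_rfl)

omit [CompleteSpace H] in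
theorem amplify_apply (a : H →L[ℂ] H) (x : lp (fun _ : κ => H) 2) (n : κ) :
    amplify κ a x n = a (x n) := rfl

theorem inner_amplify (a : H →L[ℂ] H) (x y : lp (fun _ : κ => H) 2) :
    inner ℂ (amplify κ a x) y = inner ℂ x (amplify κ (star a) y) := by
  rw [lp.inner_eq_tsum, lp.inner_eq_tsum]
  refine tsum_congr fun n => ?_
  rw [amplify_apply, amplify_apply, ContinuousLinearMap.star_eq_adjoint,
    ContinuousLinearMap.adjoint_inner_right]

/-- The density theorem of von Neumann, for normal functionals. -/
theorem tsum_inner_eq_zero_of_bicommutant (S : Set (H →L[ℂ] H)) (hstar : ∀ s ∈ S, star s ∈ S)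
    (hone : 1 ∈ S) (hmul : ∀ s ∈ S, ∀ t ∈ S, ∃ c : ℂ, ∃ r ∈ S, s * t = c • r) (a : H →L[ℂ] H)
    (ha : ∀ T, (∀ s ∈ S, Commute T s) → Commute T a) (ξ η : lp (fun _ : κ => H) 2)
    (h : ∀ s ∈ S, ∑' n, inner ℂ (ξ n) (s (η n)) = 0) : ∑' n, inner ℂ (ξ n) (a (η n)) = 0 := by
  classical
  -- `V` is the cyclic subspace of `η` under the diagonal action of `S`. Once its projection
  -- commutes with the diagonal action of `a`, the image of `η` under `a` is in `V`, which `ξ`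
  -- annihilates.
  set V : Submodule ℂ (lp (fun _ : κ => H) 2) :=
    (Submodule.span ℂ ((fun s => amplify κ s η) '' S)).topologicalClosure with hV
  have : CompleteSpace V := (Submodule.isClosed_topologicalClosure _).completeSpace_coe
  have hVinv : ∀ s ∈ S, ∀ v ∈ V, amplify κ s v ∈ V := by
    intro s hs v hv
    have h1 : Submodule.span ℂ ((fun s => amplify κ s η) '' S) ≤
        V.comap (amplify κ s).toLinearMap := by
      rw [Submodule.span_le]
      rintro _ ⟨t, ht, rfl⟩
      obtain ⟨c, r, hr, hst⟩ := hmul s hs t ht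
      have h2 : amplify κ s (amplify κ t η) = c • amplify κ r η := by
        refine lp.ext (funext fun n => ?_)
        have := congrArg (fun T : H →L[ℂ] H => T (η n)) hst
        exact this
      change amplify κ s (amplify κ t η) ∈ V
      rw [h2]
      exact V.smul_mem _ (Submodule.le_topologicalClosure _ (Submodule.subset_span ⟨r, hr, rfl⟩))
    exact Submodule.topologicalClosure_minimal _ h1
      ((Submodule.isClosed_topologicalClosure _).preimage (amplify κ s).continuous) hv
  have hPs : ∀ s ∈ S, ∀ x, V.starProjection (amplify κ s x) = amplify κ s (V.starProjection x) := by
    intro s hs x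
    refine Submodule.eq_starProjection_of_mem_of_inner_eq_zero
      (hVinv s hs _ (Submodule.starProjection_apply_mem _ _)) fun w hw => ?_
    rw [← map_sub, inner_amplify]
    exact Submodule.starProjection_inner_eq_zero x _ (hVinv _ (hstar s hs) w hw)
  have hPa1 : ∀ (j : κ) (x : H), V.starProjection (amplify κ a (lp.single 2 j x)) =
      amplify κ a (V.starProjection (lp.single 2 j x)) := by
    intro j x
    have hsingle : ∀ (b : H →L[ℂ] H) (y : H),
        amplify κ b (lp.single 2 j y) = lp.single 2 j (b y) := by
      intro b y
      refine lp.ext (funext fun n => ?_)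
      rw [amplify_apply, lp.single_apply, lp.single_apply]
      rcases eq_or_ne n j with rfl | hn
      · simp
      · simp [Pi.single_eq_of_ne hn]
    refine lp.ext (funext fun i => ?_)
    -- The matrix entries of the projection are operators on the original space that commute with
    -- `S`, hence with `a`.
    let T : H →L[ℂ] H := (lp.evalCLM ℂ (fun _ : κ => H) 2 i).comp
      (V.starProjection.comp (lp.singleContinuousLinearMap ℂ (fun _ : κ => H) 2 j))
    have hT : ∀ y, T y = V.starProjection (lp.single 2 j y) i := fun y => rfl
    have hTa := ha T fun s hs => ContinuousLinearMap.ext fun y => by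
      change T (s y) = s (T y)
      rw [hT, hT, ← hsingle, hPs s hs]
      rfl
    have h3 : T (a x) = a (T x) := congrArg (fun R : H →L[ℂ] H => R x) hTa.eq
    rw [hT, hT, ← hsingle] at h3
    exact h3
  have hPa : ∀ x, V.starProjection (amplify κ a x) = amplify κ a (V.starProjection x) := by
    intro x
    have h4 := lp.hasSum_single (p := 2) (by simp) x
    have h5 := (V.starProjection.comp (amplify κ a)).hasSum h4
    have h6 := ((amplify κ a).comp V.starProjection).hasSum h4
    refine h5.unique (h6.congr_fun fun n => ?_)
    exact hPa1 n (x n)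
  have hη : η ∈ V := by
    refine Submodule.le_topologicalClosure _ (Submodule.subset_span ⟨1, hone, ?_⟩)
    exact lp.ext (funext fun n => rfl)
  have haη : amplify κ a η ∈ V := by
    rw [← Submodule.starProjection_eq_self_iff.2 hη, ← hPa]
    exact Submodule.starProjection_apply_mem _ _
  have hξ : V ≤ LinearMap.ker (innerSL ℂ ξ).toLinearMap := by
    refine Submodule.topologicalClosure_minimal _ ?_
      (isClosed_singleton.preimage (innerSL ℂ ξ).continuous)
    rw [Submodule.span_le]
    rintro _ ⟨s, hs, rfl⟩
    change inner ℂ ξ (amplify κ s η) = 0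
    rw [lp.inner_eq_tsum]
    exact h s hs
  have h7 : inner ℂ ξ (amplify κ a η) = 0 := hξ haη
  rwa [lp.inner_eq_tsum] at h7

/-- Two normal functionals that agree on a self-adjoint system of generators, one of them being a
vector functional, agree on the generated von Neumann algebra. -/
theorem tsum_inner_eq_inner_of_bicommutant (S : Set (H →L[ℂ] H)) (hstar : ∀ s ∈ S, star s ∈ S)
    (hone : 1 ∈ S) (hmul : ∀ s ∈ S, ∀ t ∈ S, ∃ c : ℂ, ∃ r ∈ S, s * t = c • r) (a : H →L[ℂ] H)
    (ha : ∀ T, (∀ s ∈ S, Commute T s) → Commute T a) (ξ η : lp (fun _ : ℕ => H) 2) (x y : H)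
    (h : ∀ s ∈ S, ∑' n, inner ℂ (ξ n) (s (η n)) = inner ℂ x (s y)) :
    ∑' n, inner ℂ (ξ n) (a (η n)) = inner ℂ x (a y) := by
  -- Prepending the pair `(-x, y)` subtracts the vector functional, so equality of two functionals
  -- becomes vanishing of one.
  let cons : H → lp (fun _ : ℕ => H) 2 → lp (fun _ : ℕ => H) 2 := fun z ζ =>
    ⟨fun n => Nat.casesOn n z fun m => ζ m, memℓp_gen <| by
      rw [← summable_nat_add_iff 1]
      exact (lp.memℓp ζ).summable (by simp)⟩
  have hsplit : ∀ b : H →L[ℂ] H, ∑' n, inner ℂ (cons (-x) ξ n) (b (cons y η n)) =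
      -inner ℂ x (b y) + ∑' n, inner ℂ (ξ n) (b (η n)) := by
    intro b
    have hs := lp.summable_inner (𝕜 := ℂ) (cons (-x) ξ) (amplify ℕ b (cons y η))
    have h1 := hs.tsum_eq_zero_add
    rw [← inner_neg_left]
    exact h1
  have := tsum_inner_eq_zero_of_bicommutant S hstar hone hmul a ha (cons (-x) ξ) (cons y η)
    fun s hs => by rw [hsplit, h s hs, neg_add_cancel]
  rw [hsplit] at this
  exact (neg_add_eq_zero.1 this).symm

end Density

/-! ### Local algebras, inner-implemented automorphisms, and charge transporters -/

section LocalAlgebra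

variable {F : Type*} [NormedAddCommGroup F] [InnerProductSpace ℝ F] [FiniteDimensional ℝ F]
  {I : Arc}

/-- Since `W(ξ)* = W(-ξ)` and the local classes form a real subspace, the conditions on adjoints in
the star-centralizers are automatic and the plain bicommutant criterion remains. -/
theorem mem_localAlgebra_iff (a : Fock (ModeIndex F) →L[ℂ] Fock (ModeIndex F)) :
    a ∈ localAlgebra F I ↔
      ∀ T, (∀ ξ ∈ localSubspace F I, Commute T (weyl ξ)) → Commute T a := by
  have hT : ∀ T, T ∈ StarSubalgebra.centralizer ℂ (localWeyl F I) ↔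
      ∀ ξ ∈ localSubspace F I, Commute T (weyl ξ) := by
    intro T
    rw [StarSubalgebra.mem_centralizer_iff]
    constructor
    · rintro h _ ⟨f, hf, rfl⟩
      exact (h _ ⟨f, hf, rfl⟩).1.symm
    · rintro h _ ⟨f, hf, rfl⟩
      have hf' := Loop.oneParticle_mem_localSubspace hf
      rw [star_weyl]
      exact ⟨(h _ hf').eq.symm, (h _ ((localSubspace F I).neg_mem hf')).eq.symm⟩
  change a ∈ StarSubalgebra.centralizer ℂ _ ↔ _
  rw [StarSubalgebra.mem_centralizer_iff]
  constructor
  · intro h T hT'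
    exact (h T ((hT T).2 hT')).1
  · intro h T hT'
    have h1 := (hT T).1 hT'
    exact ⟨(h T h1).eq, (h (star T) (Commute.star_weyl_right h1)).eq⟩

theorem weyl_mem_localAlgebra {ξ : OneParticle F} (hξ : ξ ∈ localSubspace F I) :
    weyl ξ ∈ localAlgebra F I :=
  (mem_localAlgebra_iff _).2 fun _ h => h ξ hξ

omit [FiniteDimensional ℝ F] in
theorem weyl_conj (ξ η : OneParticle F) : weyl ξ * weyl η * weyl (-ξ) =
    Complex.exp (-(2 * Complex.I * ((inner ℂ ξ η).im : ℂ))) • weyl η := by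
  rw [weyl_comm, smul_mul_assoc, mul_assoc (weyl η), weyl_mul_neg, mul_one]

theorem localSubspace_mono {J : Arc} (h : J.Sub I) : localSubspace F J ≤ localSubspace F I := by
  rintro _ ⟨f, hf, rfl⟩
  exact ⟨f, hf.mono h, rfl⟩

/-- Conjugation by any Weyl operator, local or not, multiplies each `W(ξ)` by a phase; it therefore
preserves the commutant of the local Weyl operators and so the bicommutant. -/
theorem weyl_conj_mem (ζ : OneParticle F) {a : Fock (ModeIndex F) →L[ℂ] Fock (ModeIndex F)}
    (ha : a ∈ localAlgebra F I) : weyl ζ * a * weyl (-ζ) ∈ localAlgebra F I := by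
  rw [mem_localAlgebra_iff] at ha ⊢
  intro T hT
  have h1 := ha (weyl (-ζ) * T * weyl ζ) fun ξ hξ => by
    have h2 : weyl ξ = Complex.exp (2 * Complex.I * ((inner ℂ ζ ξ).im : ℂ)) •
        (weyl ζ * weyl ξ * weyl (-ζ)) := by
      rw [weyl_conj, smul_smul, ← Complex.exp_add, add_neg_cancel, Complex.exp_zero, one_smul]
    have h3 : weyl (-ζ) * weyl ξ * weyl ζ =
        Complex.exp (2 * Complex.I * ((inner ℂ ζ ξ).im : ℂ)) • weyl ξ := by
      have := weyl_conj (-ζ) ξ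
      rw [neg_neg] at this
      rw [this, inner_neg_left]
      simp
    rw [commute_iff_eq]
    calc weyl (-ζ) * T * weyl ζ * weyl ξ
        = weyl (-ζ) * T * (weyl ζ * weyl ξ * weyl (-ζ)) * weyl ζ := by
          simp only [mul_assoc, weyl_neg_mul, mul_one]
      _ = weyl (-ζ) * (weyl ζ * weyl ξ * weyl (-ζ)) * T * weyl ζ := by
          rw [weyl_conj]
          simp only [mul_smul_comm, smul_mul_assoc, mul_assoc]
          congr 1
          rw [← mul_assoc T, (hT ξ hξ).eq, mul_assoc]
      _ = weyl (-ζ) * weyl ζ * weyl ξ * weyl (-ζ) * T * weyl ζ := by simp only [mul_assoc]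
      _ = weyl ξ * (weyl (-ζ) * T * weyl ζ) := by
          rw [weyl_neg_mul, one_mul]; simp only [mul_assoc]
  rw [commute_iff_eq] at h1 ⊢
  calc T * (weyl ζ * a * weyl (-ζ))
      = weyl ζ * weyl (-ζ) * T * weyl ζ * a * weyl (-ζ) := by
        rw [weyl_mul_neg, one_mul]; simp only [mul_assoc]
    _ = weyl ζ * (weyl (-ζ) * T * weyl ζ * a) * weyl (-ζ) := by simp only [mul_assoc]
    _ = weyl ζ * a * weyl (-ζ) * T * (weyl ζ * weyl (-ζ)) := by
        rw [h1]; simp only [mul_assoc]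
    _ = weyl ζ * a * weyl (-ζ) * T := by rw [weyl_mul_neg, mul_one]

variable (I) in
/-- The automorphism `a ↦ W(ζ) a W(ζ)*` of the local algebra. -/
def adWeyl (ζ : OneParticle F) : Endo F I where
  toFun a := ⟨weyl ζ * a.1 * weyl (-ζ), weyl_conj_mem ζ a.2⟩
  map_one' := Subtype.ext (by
    change weyl ζ * 1 * weyl (-ζ) = 1
    rw [mul_one, weyl_mul_neg])
  map_mul' a b := Subtype.ext (by
    change weyl ζ * (a.1 * b.1) * weyl (-ζ) = weyl ζ * a.1 * weyl (-ζ) * (weyl ζ * b.1 * weyl (-ζ))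
    calc _ = weyl ζ * a.1 * 1 * b.1 * weyl (-ζ) := by simp only [mul_assoc, one_mul]
      _ = _ := by rw [← weyl_neg_mul ζ]; simp only [mul_assoc])
  map_zero' := Subtype.ext (by
    change weyl ζ * 0 * weyl (-ζ) = 0
    rw [mul_zero, zero_mul])
  map_add' a b := Subtype.ext (by
    change weyl ζ * (a.1 + b.1) * weyl (-ζ) = weyl ζ * a.1 * weyl (-ζ) + weyl ζ * b.1 * weyl (-ζ)
    rw [mul_add, add_mul])
  commutes' r := Subtype.ext (by
    change weyl ζ * (algebraMap ℂ _ r) * weyl (-ζ) = algebraMap ℂ _ r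
    rw [← Algebra.commutes, mul_assoc, weyl_mul_neg, mul_one])
  map_star' a := Subtype.ext (by
    change weyl ζ * star a.1 * weyl (-ζ) = star (weyl ζ * a.1 * weyl (-ζ))
    rw [star_mul, star_mul, star_weyl, star_weyl, neg_neg, mul_assoc])

theorem coe_adWeyl (ζ : OneParticle F) (a : Alg F I) :
    (adWeyl I ζ a).1 = weyl ζ * a.1 * weyl (-ζ) := rfl

theorem adWeyl_neg_adWeyl (ζ : OneParticle F) (a : Alg F I) :
    adWeyl I (-ζ) (adWeyl I ζ a) = a := by
  refine Subtype.ext ?_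
  rw [coe_adWeyl, coe_adWeyl, neg_neg]
  calc weyl (-ζ) * (weyl ζ * a.1 * weyl (-ζ)) * weyl ζ
      = weyl (-ζ) * weyl ζ * a.1 * (weyl (-ζ) * weyl ζ) := by simp only [mul_assoc]
    _ = a.1 := by rw [weyl_neg_mul, one_mul, mul_one]

theorem bijective_adWeyl (ζ : OneParticle F) : Function.Bijective (adWeyl I ζ) :=
  Function.bijective_iff_has_inverse.2 ⟨adWeyl I (-ζ), adWeyl_neg_adWeyl ζ, fun a => by
    have := adWeyl_neg_adWeyl (-ζ) a
    rwa [neg_neg] at this⟩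

omit [FiniteDimensional ℝ F] in
theorem inner_weyl_left (ζ : OneParticle F) (x y : Fock (ModeIndex F)) :
    inner ℂ (weyl (-ζ) x) y = inner ℂ x (weyl ζ y) := by
  rw [← star_weyl, ContinuousLinearMap.star_eq_adjoint, ContinuousLinearMap.adjoint_inner_left]

theorem inner_adWeyl (ζ : OneParticle F) (a : Alg F I) (x y : Fock (ModeIndex F)) :
    inner ℂ x ((adWeyl I ζ a).1 y) = inner ℂ (weyl (-ζ) x) (a.1 (weyl (-ζ) y)) := by
  rw [inner_weyl_left]
  rfl

theorem isNormal_adWeyl (ζ : OneParticle F) : IsNormal (adWeyl I ζ) := by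
  intro x y
  refine ⟨lp.single 2 0 (weyl (-ζ) x), lp.single 2 0 (weyl (-ζ) y), fun a => ?_⟩
  rw [inner_adWeyl, tsum_eq_single 0]
  · rw [lp.single_apply_self, lp.single_apply_self]
  · intro n hn
    rw [lp.single_apply_ne _ _ _ hn, inner_zero_left]

theorem adWeyl_weyl (ζ ξ : OneParticle F) (w : Alg F I) (hw : w.1 = weyl ξ) :
    adWeyl I ζ w = Complex.exp (-(2 * Complex.I * ((inner ℂ ζ ξ).im : ℂ))) • w := by
  refine Subtype.ext ?_
  rw [coe_adWeyl, hw, weyl_conj, ← hw]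
  rfl

/-- A normal endomorphism is determined by its values on the Weyl operators. -/
theorem eq_adWeyl_of_isNormal (ζ : OneParticle F) (ρ : Endo F I) (hρ : IsNormal ρ)
    (h : ∀ ξ ∈ localSubspace F I, ∀ w : Alg F I, w.1 = weyl ξ → ρ w = adWeyl I ζ w) :
    ρ = adWeyl I ζ := by
  refine StarAlgHom.ext fun a => Subtype.ext (ContinuousLinearMap.ext fun y =>
    ext_inner_left ℂ fun x => ?_)
  obtain ⟨ξ, η, hξη⟩ := hρ x y
  rw [hξη, inner_adWeyl]
  -- Normality turns the matrix elements of `ρ` into a normal functional, and those of `Ad W(ζ)` are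
  -- a vector functional. The Weyl operators are closed under products up to phases, as the density
  -- theorem needs.
  refine tsum_inner_eq_inner_of_bicommutant (weyl '' (localSubspace F I : Set (OneParticle F)))
    ?_ ⟨0, (localSubspace F I).zero_mem, weyl_zero⟩ ?_ a.1 (fun T hT => ?_) ξ η _ _ ?_
  · rintro _ ⟨ξ, hξ, rfl⟩
    exact ⟨-ξ, (localSubspace F I).neg_mem hξ, (star_weyl ξ).symm⟩
  · rintro _ ⟨ξ, hξ, rfl⟩ _ ⟨η, hη, rfl⟩
    exact ⟨_, _, ⟨ξ + η, (localSubspace F I).add_mem hξ hη, rfl⟩, weyl_mul_weyl ξ η⟩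
  · exact (mem_localAlgebra_iff _).1 a.2 T fun ξ hξ => hT _ ⟨ξ, hξ, rfl⟩
  · rintro _ ⟨ν, hν, rfl⟩
    have := hξη ⟨weyl ν, weyl_mem_localAlgebra hν⟩
    rw [h ν hν _ rfl, inner_adWeyl] at this
    exact this.symm

omit [FiniteDimensional ℝ F] in
theorem weyl_add_commute {ζ μ : OneParticle F} {T : Fock (ModeIndex F) →L[ℂ] Fock (ModeIndex F)}
    (h : Commute T (weyl (ζ + μ))) : Commute T (weyl ζ * weyl μ) := by
  rw [weyl_mul_weyl]
  exact h.smul_right _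

omit [FiniteDimensional ℝ F] in
-- `W(x + y)` is a multiple of `W(x) W(y)`.
theorem commute_weyl_sup {X Y : Submodule ℝ (OneParticle F)}
    {T : Fock (ModeIndex F) →L[ℂ] Fock (ModeIndex F)} (hX : ∀ ξ ∈ X, Commute T (weyl ξ))
    (hY : ∀ ξ ∈ Y, Commute T (weyl ξ)) : ∀ ξ ∈ X ⊔ Y, Commute T (weyl ξ) := by
  intro ξ hξ
  obtain ⟨x, hx, y, hy, rfl⟩ := Submodule.mem_sup.1 hξ
  have h1 : weyl (x + y) = Complex.exp (Complex.I * ((inner ℂ x y).im : ℂ)) •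
      (weyl x * weyl y) := by
    rw [weyl_mul_weyl, smul_smul, ← Complex.exp_add, add_neg_cancel, Complex.exp_zero, one_smul]
  rw [h1]
  exact ((hX x hx).mul_right (hY y hy)).smul_right _

/-- A charge transporter is, up to a Weyl operator, localized. -/
theorem commute_transporter {J K : Arc} {ζ μ : OneParticle F} {ρ' : Endo F I} {u : Alg F I}
    (hρ' : IsLocalizedIn ρ' J) (hu : u ∈ intertwiners (adWeyl I ζ) ρ') (hK : K.Sub I)
    (hKJ : K.Before J ∨ J.Before K)
    (h0 : ∀ ξ ∈ localSubspace F K, (inner ℂ (ζ + μ) ξ).im = 0) :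
    ∀ ξ ∈ localSubspace F K, Commute (u.1 * weyl (-μ)) (weyl ξ) := by
  intro ξ hξ
  have hx : weyl ξ ∈ localAlgebra F I := weyl_mem_localAlgebra (localSubspace_mono hK hξ)
  -- The target `ρ'` fixes `W(ξ)`.
  have h1 : u.1 * (weyl ζ * weyl ξ * weyl (-ζ)) = weyl ξ * u.1 := by
    have := hu ⟨weyl ξ, hx⟩
    rw [hρ'.2 K hK hKJ ⟨weyl ξ, hx⟩ (weyl_mem_localAlgebra hξ)] at this
    exact congrArg Subtype.val this
  have h2 : weyl ξ * (weyl μ * weyl ζ) = weyl μ * weyl ζ * weyl ξ := by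
    have := (commute_weyl _ _ (h0 ξ hξ)).symm
    rw [add_comm] at this
    exact (weyl_add_commute this).eq
  -- As `W(ζ + μ)` commutes with `W(ξ)`, conjugation by `W(ζ)` and by `W(-μ)` agree there.
  have h3 : weyl ζ * weyl ξ * weyl (-ζ) = weyl (-μ) * weyl ξ * weyl μ := by
    calc weyl ζ * weyl ξ * weyl (-ζ)
        = weyl (-μ) * weyl μ * weyl ζ * weyl ξ * weyl (-ζ) := by
          rw [weyl_neg_mul, one_mul]
      _ = weyl (-μ) * (weyl μ * weyl ζ * weyl ξ) * weyl (-ζ) := by simp only [mul_assoc]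
      _ = weyl (-μ) * weyl ξ * weyl μ * (weyl ζ * weyl (-ζ)) := by
          rw [← h2]; simp only [mul_assoc]
      _ = weyl (-μ) * weyl ξ * weyl μ := by rw [weyl_mul_neg, mul_one]
  rw [h3] at h1
  rw [commute_iff_eq]
  calc u.1 * weyl (-μ) * weyl ξ = u.1 * (weyl (-μ) * weyl ξ * weyl μ) * weyl (-μ) := by
        simp only [mul_assoc, weyl_mul_neg, mul_one]
    _ = weyl ξ * (u.1 * weyl (-μ)) := by rw [h1, mul_assoc]

omit [FiniteDimensional ℝ F] in
theorem isTotal_of_le {X Y : Submodule ℝ (OneParticle F)} (hX : IsTotal (X : Set (OneParticle F)))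
    (h : X ≤ Y) : IsTotal (Y : Set (OneParticle F)) :=
  fun v hv => hX v fun x hx => hv x (h hx)

/-- Haag duality for three consecutive arcs. -/
theorem commute_of_arcs (J₁ J₂ J₃ : Arc) (h12 : J₁.hi = J₂.lo) (h23 : J₂.hi = J₃.lo)
    (h31 : J₃.hi = J₁.lo + 2 * Real.pi) {a c : Fock (ModeIndex F) →L[ℂ] Fock (ModeIndex F)}
    (ha : ∀ ξ ∈ localSubspace F J₁, Commute a (weyl ξ))
    (hc2 : ∀ ξ ∈ localSubspace F J₂, Commute c (weyl ξ))
    (hc3 : ∀ ξ ∈ localSubspace F J₃, Commute c (weyl ξ)) : Commute a c :=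
  commute_of_isDual (isDual_localSubspace J₁ J₂ J₃ h12 h23 h31) (isTotal_localSubspace J₁)
    (isTotal_of_le (isTotal_localSubspace J₂) le_sup_left) a c ha (commute_weyl_sup hc2 hc3)

/-- The complement of an arc. -/
def Arc.compl (I : Arc) : Arc :=
  ⟨I.hi, I.lo + 2 * Real.pi, I.hi_lt, by linarith [I.lo_lt_hi]⟩

theorem commute_of_mem_localAlgebra {a : Fock (ModeIndex F) →L[ℂ] Fock (ModeIndex F)}
    (ha : a ∈ localAlgebra F I) : ∀ ξ ∈ localSubspace F I.compl, Commute a (weyl ξ) := by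
  rintro _ ⟨g, hg, rfl⟩
  refine ((mem_localAlgebra_iff a).1 ha _ ?_).symm
  rintro _ ⟨f, hf, rfl⟩
  exact (commute_weyl _ _ (im_inner_oneParticle_eq_zero hf hg le_rfl le_rfl)).symm

/-- Supports depend on angles only modulo `2π`, so the circle may be cut open at another end point
when the three arcs are listed. -/
theorem localSubspace_shift_le {J K : Arc} (h1 : K.lo = J.lo + 2 * Real.pi)
    (h2 : K.hi = J.hi + 2 * Real.pi) : localSubspace F K ≤ localSubspace F J := by
  rintro _ ⟨f, hf, rfl⟩
  refine ⟨f, fun θ hθ => ?_, rfl⟩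
  obtain ⟨k, hk⟩ := hf hθ
  refine ⟨k - 1, ?_⟩
  push_cast
  constructor <;> linarith [hk.1, hk.2]

/-- The value of the braiding of two inner-implemented automorphisms, for any choice of charge
transporters. -/
theorem braiding_expression_eq {J₁ J₂ : Arc} {ρ' σ' : Endo F I} {u v : Alg F I}
    (ζ₁ ζ₂ μ₁ μ₂ : OneParticle F) (hμ₁ : μ₁ ∈ localSubspace F I) (hμ₂ : μ₂ ∈ localSubspace F I)
    (hJ₁ : J₁.Sub I) (hJ₂ : J₂.Sub I) (hJ : J₂.Before J₁) (hρ' : IsLocalizedIn ρ' J₁)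
    (hσ' : IsLocalizedIn σ' J₂) (hu : u ∈ unitary (Alg F I)) (hv : v ∈ unitary (Alg F I))
    (hui : u ∈ intertwiners (adWeyl I ζ₁) ρ') (hvi : v ∈ intertwiners (adWeyl I ζ₂) σ')
    (h1 : ∀ K : Arc, K.Sub I → K.Before J₁ → ∀ ξ ∈ localSubspace F K,
      (inner ℂ (ζ₁ + μ₁) ξ).im = 0)
    (h2 : ∀ K : Arc, K.Sub I → J₂.Before K → ∀ ξ ∈ localSubspace F K,
      (inner ℂ (ζ₂ + μ₂) ξ).im = 0) :
    adWeyl I ζ₂ (star u) * star v * u * adWeyl I ζ₁ v =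
      Complex.exp (Complex.I * ((2 * ((inner ℂ ζ₁ ζ₂).im -
        (inner ℂ (ζ₁ + μ₁) (ζ₂ + μ₂)).im) : ℝ) : ℂ)) • (1 : Alg F I) := by
  have l1 := J₁.lo_lt_hi
  have l2 := J₂.lo_lt_hi
  have lI := I.hi_lt
  obtain ⟨s1, s1'⟩ := hJ₁
  obtain ⟨s2, s2'⟩ := hJ₂
  have hJ' : J₂.hi ≤ J₁.lo := hJ
  -- The interval is cut at the lower end of `J₁`, so that `J₂` lies in `A` and `J₁` in `B`. The arc
  -- `A'` is `A` one turn later, for use in the cyclic order `B`, complement of `I`, `A`.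
  let A : Arc := ⟨I.lo, J₁.lo, by linarith, by linarith⟩
  let B : Arc := ⟨J₁.lo, I.hi, by linarith, by linarith⟩
  let A' : Arc := ⟨I.lo + 2 * Real.pi, J₁.lo + 2 * Real.pi, by linarith, by linarith⟩
  have hA : A.Sub I := ⟨le_rfl, by simp only [A]; linarith⟩
  have hB : B.Sub I := ⟨by simp only [B]; linarith, le_rfl⟩
  set U := weyl μ₁ with hU
  set V := weyl μ₂ with hV
  set w₁ := u.1 * weyl (-μ₁) with hw₁
  set w₂ := v.1 * weyl (-μ₂) with hw₂
  have hw₁A : ∀ ξ ∈ localSubspace F A, Commute w₁ (weyl ξ) :=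
    commute_transporter hρ' hui hA (Or.inl le_rfl) (h1 A hA le_rfl)
  have hw₂B : ∀ ξ ∈ localSubspace F B, Commute w₂ (weyl ξ) :=
    commute_transporter hσ' hvi hB (Or.inr hJ') (h2 B hB hJ')
  have hw₁I : ∀ ξ ∈ localSubspace F I.compl, Commute w₁ (weyl ξ) :=
    commute_of_mem_localAlgebra (mul_mem u.2
      (weyl_mem_localAlgebra ((localSubspace F I).neg_mem hμ₁)))
  have hw₂I : ∀ ξ ∈ localSubspace F I.compl, Commute w₂ (weyl ξ) :=
    commute_of_mem_localAlgebra (mul_mem v.2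
      (weyl_mem_localAlgebra ((localSubspace F I).neg_mem hμ₂)))
  -- The remainders behave as if `w₁` belonged to `B` and `w₂` to `A`: each commutes with the Weyl
  -- operators of the other arc and of the complement of `I`.
  have c12 : Commute w₁ w₂ := commute_of_arcs A B I.compl rfl rfl rfl hw₁A hw₂B hw₂I
  -- The operator `W(μ₁ + ζ₁)` need not commute with loops outside `I`, because of the compensating
  -- charge. Duality requires only that it commute with those in `A`; the symmetric statement `cL2`
  -- uses `B`.
  have cL1 : Commute (weyl (μ₁ + ζ₁)) w₂ := commute_of_arcs A B I.compl rfl rfl rfl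
    (fun ξ hξ => commute_weyl _ _ (by rw [add_comm]; exact h1 A hA le_rfl ξ hξ)) hw₂B hw₂I
  have cL2 : Commute (weyl (μ₂ + ζ₂)) w₁ := commute_of_arcs B I.compl A' rfl rfl rfl
    (fun ξ hξ => commute_weyl _ _ (by rw [add_comm]; exact h2 B hB hJ' ξ hξ)) hw₁I
    (fun ξ hξ => hw₁A ξ (localSubspace_shift_le (J := A) rfl rfl hξ))
  have hu1 : star u.1 * u.1 = 1 := congrArg Subtype.val (Unitary.mem_iff.1 hu).1
  have hv1 : star v.1 * v.1 = 1 := congrArg Subtype.val (Unitary.mem_iff.1 hv).1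
  have eu : u.1 = w₁ * U := by rw [hw₁, mul_assoc, weyl_neg_mul, mul_one]
  have ev : v.1 = w₂ * V := by rw [hw₂, mul_assoc, weyl_neg_mul, mul_one]
  have eus : star u.1 = weyl (-μ₁) * star w₁ := by rw [eu, star_mul, star_weyl]
  have evs : star v.1 = weyl (-μ₂) * star w₂ := by rw [ev, star_mul, star_weyl]
  have hw11 : star w₁ * w₁ = 1 := by
    rw [hw₁, star_mul, star_weyl, neg_neg, mul_assoc, ← mul_assoc (star u.1), hu1, one_mul,
      weyl_mul_neg]
  have hw22 : star w₂ * w₂ = 1 := by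
    rw [hw₂, star_mul, star_weyl, neg_neg, mul_assoc, ← mul_assoc (star v.1), hv1, one_mul,
      weyl_mul_neg]
  -- The remainders form a group commutator once they have been moved together, and it is trivial.
  -- What is left contains Weyl operators only.
  have hC : star w₁ * star w₂ * w₁ * w₂ = 1 := by
    rw [mul_assoc, c12.eq, ← mul_assoc, mul_assoc (star w₁), hw22, mul_one, hw11]
  have hAc : star w₁ * (weyl (-ζ₂) * weyl (-μ₂)) = weyl (-ζ₂) * weyl (-μ₂) * star w₁ := by
    have h3 := cL2.symm.star_star
    rw [star_weyl, neg_add_rev] at h3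
    exact (weyl_add_commute h3).eq
  have hBc : U * weyl ζ₁ * w₂ = w₂ * (U * weyl ζ₁) := (weyl_add_commute cL1.symm).eq.symm
  refine Subtype.ext ?_
  change weyl ζ₂ * star u.1 * weyl (-ζ₂) * star v.1 * u.1 * (weyl ζ₁ * v.1 * weyl (-ζ₁)) =
    Complex.exp _ • (1 : Fock (ModeIndex F) →L[ℂ] Fock (ModeIndex F))
  have e1 := weyl_conj ζ₂ (-μ₁)
  have e2 := weyl_conj ζ₁ μ₂
  have e3 := weyl_conj (-μ₂) μ₁
  rw [neg_neg] at e3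
  have e4 : weyl (-μ₁) * weyl (-μ₂) * U * V =
      Complex.exp (-(2 * Complex.I * ((inner ℂ (-μ₂) μ₁).im : ℂ))) • 1 := by
    rw [mul_assoc (weyl (-μ₁)), mul_assoc (weyl (-μ₁)), e3, mul_smul_comm, weyl_neg_mul]
  calc weyl ζ₂ * star u.1 * weyl (-ζ₂) * star v.1 * u.1 * (weyl ζ₁ * v.1 * weyl (-ζ₁))
      = weyl ζ₂ * weyl (-μ₁) * (star w₁ * (weyl (-ζ₂) * weyl (-μ₂))) * star w₂ * w₁ *
          (U * weyl ζ₁ * w₂) * V * weyl (-ζ₁) := by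
        rw [eus, evs, eu, ev]; simp only [mul_assoc]
    _ = weyl ζ₂ * weyl (-μ₁) * weyl (-ζ₂) * weyl (-μ₂) * (star w₁ * star w₂ * w₁ * w₂) * U *
          (weyl ζ₁ * V * weyl (-ζ₁)) := by
        rw [hAc, hBc]; simp only [mul_assoc]
    _ = _ := by
        rw [hC, mul_one, e1, e2]
        simp only [smul_mul_assoc, mul_smul_comm]
        rw [e4, smul_smul, smul_smul, ← Complex.exp_add, ← Complex.exp_add]
        congr 2
        rw [← inner_conj_symm ζ₂ (-μ₁), ← inner_conj_symm (-μ₂) μ₁]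
        simp only [inner_neg_left, inner_neg_right, inner_add_left, inner_add_right,
          Complex.add_im, Complex.neg_im, Complex.conj_im]
        push_cast
        ring

/-- The inner-implemented automorphisms are localized by their commutation relations. -/
theorem isLocalizedIn_adWeyl {J : Arc} (ζ : OneParticle F)
    (h : ∀ K : Arc, K.Sub I → (K.Before J ∨ J.Before K) → ∀ ξ ∈ localSubspace F K,
      (inner ℂ ζ ξ).im = 0) : IsLocalizedIn (adWeyl I ζ) J := by
  refine ⟨isNormal_adWeyl ζ, fun K hK hKJ a ha => Subtype.ext ?_⟩
  have h1 : Commute (weyl ζ) a.1 := (mem_localAlgebra_iff a.1).1 ha _ fun ξ hξ =>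
    commute_weyl _ _ (h K hK hKJ ξ hξ)
  rw [coe_adWeyl, h1.eq, mul_assoc, weyl_mul_neg, mul_one]

theorem weyl_mem_unitary {μ : OneParticle F} (hμ : μ ∈ localSubspace F I) :
    (⟨weyl μ, weyl_mem_localAlgebra hμ⟩ : Alg F I) ∈ unitary (Alg F I) := by
  rw [Unitary.mem_iff]
  constructor <;> refine Subtype.ext ?_
  · change star (weyl μ) * weyl μ = 1
    rw [star_weyl, weyl_neg_mul]
  · change weyl μ * star (weyl μ) = 1
    rw [star_weyl, weyl_mul_neg]

/-- `W(ζ + μ)` is a phase times `W(μ) W(ζ)`, and the phase drops out under conjugation. -/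
theorem weyl_mem_intertwiners (ζ : OneParticle F) {μ : OneParticle F}
    (hμ : μ ∈ localSubspace F I) : (⟨weyl μ, weyl_mem_localAlgebra hμ⟩ : Alg F I) ∈
      intertwiners (adWeyl I ζ) (adWeyl I (ζ + μ)) := by
  intro x
  refine Subtype.ext ?_
  change weyl μ * (weyl ζ * x.1 * weyl (-ζ)) = weyl (ζ + μ) * x.1 * weyl (-(ζ + μ)) * weyl μ
  have h1 : weyl (ζ + μ) = Complex.exp (Complex.I * ((inner ℂ μ ζ).im : ℂ)) •
      (weyl μ * weyl ζ) := by
    rw [weyl_mul_weyl, smul_smul, ← Complex.exp_add, add_neg_cancel, Complex.exp_zero, one_smul,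
      add_comm]
  have h2 : weyl (-(ζ + μ)) * weyl μ =
      Complex.exp (-(Complex.I * ((inner ℂ μ ζ).im : ℂ))) • weyl (-ζ) := by
    rw [weyl_mul_weyl, neg_add_rev, neg_add_cancel_comm]
    congr 3
    rw [inner_add_left, inner_neg_left, inner_neg_left, inner_self_eq_norm_sq_to_K]
    have h3 : (inner ℂ ζ μ).im = -(inner ℂ μ ζ).im := by
      rw [← inner_conj_symm, Complex.conj_im]
    simp [← Complex.ofReal_pow, h3]
  rw [mul_assoc _ (weyl (-(ζ + μ))), h2, h1]
  simp only [smul_mul_assoc, mul_smul_comm, smul_smul, ← Complex.exp_add, neg_add_cancel,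
    Complex.exp_zero, one_smul, mul_assoc]

end LocalAlgebra

/-! ### Localized gauge automorphisms and the phase of their braiding -/

section Gauge

variable {F : Type*} [NormedAddCommGroup F] [InnerProductSpace ℝ F] [FiniteDimensional ℝ F]
  {I : Arc}

theorem Loop.SupportedIn.apply_eq_zero_of_le {E : Type*} [NormedAddCommGroup E] [NormedSpace ℝ E]
    {f : Loop E} {J : Arc} (hf : f.SupportedIn J) {θ : ℝ} (h1 : J.hi ≤ θ + 2 * Real.pi)
    (h2 : θ ≤ J.lo) : f θ = 0 := by
  rw [← f.periodic]
  exact hf.apply_eq_zero h1 (by linarith)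

/-- The symplectic form of a primitive with a loop that does not see a compensating loop. -/
theorem two_mul_im_inner_primitive {f ℓ k : Loop F} (h : charge (ℓ - k) = 0) (a : ℝ)
    (hfk : ∀ θ, f θ = 0 ∨ k θ = 0) :
    2 * (inner ℂ ((ℓ - k).primitive h a).oneParticle f.oneParticle).im =
      -((2 * Real.pi)⁻¹ * ∫ θ in (0 : ℝ)..(2 * Real.pi), inner ℝ (f θ) (ℓ θ)) := by
  rw [← inner_conj_symm, Complex.conj_im, im_inner_oneParticle, Loop.deriv_primitive,
    intervalIntegral.integral_congr (g := fun θ => inner ℝ (f θ) (ℓ θ))]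
  · ring
  · intro θ _
    rcases hfk θ with h0 | h0
    · simp only [h0, inner_zero_left]
    · simp only [Loop.sub_apply, h0, sub_zero]

/-- The compensating loop `k` makes a periodic primitive possible, and being supported outside `I`
it does not affect the phases of loops inside `I`. -/
theorem isGaugeAut_adWeyl {ℓ k : Loop F} (hk : k.SupportedIn I.compl) (h : charge (ℓ - k) = 0)
    (a : ℝ) : IsGaugeAut ℓ (adWeyl I ((ℓ - k).primitive h a).oneParticle) := by
  refine ⟨bijective_adWeyl _, isNormal_adWeyl _, fun f w hf hw => ?_⟩
  rw [adWeyl_weyl _ _ w hw]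
  congr 2
  have := two_mul_im_inner_primitive h a (hf.eq_zero_or_eq_zero hk le_rfl le_rfl)
  rw [← neg_eq_iff_eq_neg] at this
  rw [← this]
  push_cast
  ring

theorem IsGaugeAut.eq_adWeyl {ℓ k : Loop F} (hk : k.SupportedIn I.compl)
    (h : charge (ℓ - k) = 0) (a : ℝ) {ρ : Endo F I} (hρ : IsGaugeAut ℓ ρ) :
    ρ = adWeyl I ((ℓ - k).primitive h a).oneParticle := by
  refine eq_adWeyl_of_isNormal _ ρ hρ.2.1 ?_
  rintro _ ⟨f, hf, rfl⟩ w hw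
  rw [hρ.2.2 f w hf hw, (isGaugeAut_adWeyl hk h a).2.2 f w hf hw]

theorem existsUnique_isGaugeAut (ℓ : Loop F) : ∃! ρ : Endo F I, IsGaugeAut ℓ ρ := by
  obtain ⟨k, hk, hkq⟩ := exists_loop_charge_eq I.compl (charge ℓ)
  have h : charge (ℓ - k) = 0 := by rw [charge_sub, hkq, sub_self]
  exact ⟨_, isGaugeAut_adWeyl hk h I.lo, fun ρ hρ => hρ.eq_adWeyl hk h I.lo⟩

theorem Loop.primitive_add_primitive {ℓ ℓ' k : Loop F} (h : charge (ℓ - k) = 0)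
    (h' : charge (ℓ' - k) = 0) (hM : charge (ℓ' - ℓ) = 0) (a : ℝ) :
    (ℓ - k).primitive h a + (ℓ' - ℓ).primitive hM a = (ℓ' - k).primitive h' a := by
  refine Loop.ext fun θ => ?_
  rw [Loop.add_apply, Loop.primitive_apply, Loop.primitive_apply, Loop.primitive_apply,
    ← intervalIntegral.integral_add (Loop.intervalIntegrable _ _ _) (Loop.intervalIntegrable _ _ _)]
  refine intervalIntegral.integral_congr fun x _ => ?_
  simp only [Loop.sub_apply]
  abel

/-- The primitive of a loop with support in `J`, with a compensating charge outside `I`, is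
symplectically orthogonal to the loops supported in subintervals disjoint from `J`. -/
theorem im_inner_primitive_eq_zero {ℓ k : Loop F} {J : Arc} (hJ : J.Sub I)
    (hℓ : ℓ.SupportedIn J) (hk : k.SupportedIn I.compl) (h : charge (ℓ - k) = 0) (a : ℝ) (K : Arc)
    (hK : K.Sub I) (hKJ : K.Before J ∨ J.Before K) : ∀ ξ ∈ localSubspace F K,
      (inner ℂ ((ℓ - k).primitive h a).oneParticle ξ).im = 0 := by
  rintro _ ⟨f, hf, rfl⟩
  obtain ⟨a1, a2⟩ := hJ
  obtain ⟨b1, b2⟩ := hK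
  have hI := I.hi_lt
  have h0 : ∀ θ, f θ = 0 ∨ ℓ θ = 0 := by
    rcases hKJ with h1 | h1
    · exact hf.eq_zero_or_eq_zero hℓ h1 (by linarith)
    · exact fun θ => (hℓ.eq_zero_or_eq_zero hf h1 (by linarith) θ).symm
  have h1 := two_mul_im_inner_primitive h a ((hf.mono ⟨b1, b2⟩).eq_zero_or_eq_zero hk le_rfl le_rfl)
  rw [intervalIntegral.integral_congr (g := fun _ => (0 : ℝ))] at h1
  · simpa using h1
  · intro θ _
    rcases h0 θ with h2 | h2
    · simp only [h2, inner_zero_left]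
    · simp only [h2, inner_zero_right]

variable (I) in
/-- The phase of the braiding of two localized gauge automorphisms. -/
def braidingPhase (ℓ₁ ℓ₂ : Loop F) : ℝ :=
  (2 * Real.pi)⁻¹ * ∫ θ in I.lo..(I.lo + 2 * Real.pi), inner ℝ (∫ x in I.lo..θ, ℓ₁ x) (ℓ₂ θ)

theorem im_inner_oneParticle_eq (g f : Loop F) (a : ℝ) :
    2 * (inner ℂ g.oneParticle f.oneParticle).im =
      (2 * Real.pi)⁻¹ * ∫ θ in a..(a + 2 * Real.pi), inner ℝ (g θ) (f.deriv θ) := by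
  have hp : Function.Periodic (fun θ => inner ℝ (g θ) (f.deriv θ)) (2 * Real.pi) := fun θ => by
    simp only [g.periodic θ, f.deriv.periodic θ]
  rw [hp.intervalIntegral_add_eq a 0, zero_add, im_inner_oneParticle]
  ring

omit [FiniteDimensional ℝ F] in
theorem Loop.SupportedIn.eq_zero_of_compl {k : Loop F} (hk : k.SupportedIn I.compl) {θ : ℝ}
    (h1 : I.lo ≤ θ) (h2 : θ ≤ I.hi) : k θ = 0 :=
  hk.apply_eq_zero_of_le (by simp only [Arc.compl]; linarith) h2

theorem primitive_sub_apply {ℓ k : Loop F} (hk : k.SupportedIn I.compl) (h : charge (ℓ - k) = 0)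
    {θ : ℝ} (h1 : I.lo ≤ θ) (h2 : θ ≤ I.hi) :
    (ℓ - k).primitive h I.lo θ = ∫ x in I.lo..θ, ℓ x := by
  rw [Loop.primitive_apply]
  refine intervalIntegral.integral_congr fun x hx => ?_
  rw [Set.uIcc_of_le h1] at hx
  simp only [Loop.sub_apply]
  rw [hk.eq_zero_of_compl hx.1 (hx.2.trans h2), sub_zero]

/-- On `I` the loop `k₂` vanishes and the primitives are those of `ℓ₁` and `ℓ₁'`; the transported
term is zero because `ℓ₂'` lives before `ℓ₁'`. Outside `I` the loops `ℓ₂` and `ℓ₂'` vanish and the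
two primitives coincide, so the terms with `k₂` cancel. -/
theorem phase_eq_braidingPhase {ℓ₁ ℓ₂ ℓ₁' ℓ₂' k₁ k₂ : Loop F} {J₁ J₂ : Arc}
    (hJ₁ : J₁.Sub I) (hJ₂ : J₂.Sub I) (hJ : J₂.Before J₁) (hℓ₁ : ℓ₁.SupportedIn I)
    (hℓ₂ : ℓ₂.SupportedIn I) (hℓ₁' : ℓ₁'.SupportedIn J₁) (hℓ₂' : ℓ₂'.SupportedIn J₂)
    (hk₁ : k₁.SupportedIn I.compl) (hk₂ : k₂.SupportedIn I.compl) (h₁ : charge (ℓ₁ - k₁) = 0)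
    (h₂ : charge (ℓ₂ - k₂) = 0) (h₁' : charge (ℓ₁' - k₁) = 0) (h₂' : charge (ℓ₂' - k₂) = 0)
    (hM : charge (ℓ₁' - ℓ₁) = 0) :
    2 * ((inner ℂ ((ℓ₁ - k₁).primitive h₁ I.lo).oneParticle
        ((ℓ₂ - k₂).primitive h₂ I.lo).oneParticle).im -
      (inner ℂ ((ℓ₁' - k₁).primitive h₁' I.lo).oneParticle
        ((ℓ₂' - k₂).primitive h₂' I.lo).oneParticle).im) = braidingPhase I ℓ₁ ℓ₂ := by
  have hI := I.hi_lt
  have hI' := I.lo_lt_hi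
  have hi : ∀ f g : Loop F, IntervalIntegrable (fun θ => inner ℝ (f θ) (g θ)) MeasureTheory.volume
      I.lo (I.lo + 2 * Real.pi) := fun f g =>
    (f.continuous.inner g.continuous).intervalIntegrable _ _
  rw [mul_sub, im_inner_oneParticle_eq _ _ I.lo, im_inner_oneParticle_eq _ _ I.lo, ← mul_sub,
    ← intervalIntegral.integral_sub (hi _ _) (hi _ _), braidingPhase]
  congr 1
  refine intervalIntegral.integral_congr fun θ hθ => ?_
  rw [Set.uIcc_of_le (by linarith)] at hθ
  simp only [Loop.deriv_primitive, Loop.sub_apply]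
  rcases le_total θ I.hi with hle | hle
  · rw [hk₂.eq_zero_of_compl hθ.1 hle, sub_zero, sub_zero, primitive_sub_apply hk₁ h₁ hθ.1 hle,
      primitive_sub_apply hk₁ h₁' hθ.1 hle, sub_eq_self]
    rcases le_total θ J₁.lo with hc | hc
    · rw [intervalIntegral.integral_congr (g := fun _ => (0 : F)), intervalIntegral.integral_zero,
        inner_zero_left]
      intro x hx
      rw [Set.uIcc_of_le hθ.1] at hx
      exact hℓ₁'.apply_eq_zero_of_le (by linarith [hJ₁.2, hx.1]) (hx.2.trans hc)
    · rw [hℓ₂'.apply_eq_zero (le_trans hJ hc) (by linarith [hJ₂.1]), inner_zero_right]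
  · have e1 : ℓ₂ θ = 0 := hℓ₂.apply_eq_zero hle hθ.2
    have e2 : ℓ₂' θ = 0 := (hℓ₂'.mono hJ₂).apply_eq_zero hle hθ.2
    have e3 := ((((hℓ₁'.mono hJ₁).sub hℓ₁).primitive hM)).apply_eq_zero hle hθ.2
    have e4 := congrArg (fun f : Loop F => f θ)
      (Loop.primitive_add_primitive h₁ h₁' hM I.lo)
    simp only [Loop.add_apply, e3, add_zero] at e4
    rw [e1, e2, e4, sub_self, inner_zero_right]

/-- The braiding of two localized gauge automorphisms. -/
theorem isBraiding_of_isGaugeAut {ℓ₁ ℓ₂ : Loop F} (hℓ₁ : ℓ₁.SupportedIn I)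
    (hℓ₂ : ℓ₂.SupportedIn I) {ρ₁ ρ₂ : Endo F I} (hρ₁ : IsGaugeAut ℓ₁ ρ₁)
    (hρ₂ : IsGaugeAut ℓ₂ ρ₂) : IsBraiding ρ₁ ρ₂
      (Complex.exp (Complex.I * (braidingPhase I ℓ₁ ℓ₂ : ℂ)) • (1 : Alg F I)) := by
  obtain ⟨k₁, hk₁, hq₁⟩ := exists_loop_charge_eq I.compl (charge ℓ₁)
  obtain ⟨k₂, hk₂, hq₂⟩ := exists_loop_charge_eq I.compl (charge ℓ₂)
  have h₁ : charge (ℓ₁ - k₁) = 0 := by rw [charge_sub, hq₁, sub_self]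
  have h₂ : charge (ℓ₂ - k₂) = 0 := by rw [charge_sub, hq₂, sub_self]
  obtain rfl := hρ₁.eq_adWeyl hk₁ h₁ I.lo
  obtain rfl := hρ₂.eq_adWeyl hk₂ h₂ I.lo
  -- A loop of equal charge in `J` differs from `ℓ` by a neutral loop in `I`. The primitive of the
  -- difference gives the class `μ` of a transporter in the local algebra.
  have htr : ∀ (ℓ k : Loop F) (h : charge (ℓ - k) = 0) (J : Arc), ℓ.SupportedIn I →
      k.SupportedIn I.compl → charge k = charge ℓ → J.Sub I → ∃ ℓ' : Loop F, ℓ'.SupportedIn J ∧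
      ∃ (h' : charge (ℓ' - k) = 0) (hM : charge (ℓ' - ℓ) = 0),
        ((ℓ' - ℓ).primitive hM I.lo).oneParticle ∈ localSubspace F I ∧
        ((ℓ - k).primitive h I.lo).oneParticle + ((ℓ' - ℓ).primitive hM I.lo).oneParticle =
          ((ℓ' - k).primitive h' I.lo).oneParticle := by
    intro ℓ k h J hℓ hk hq hJ
    obtain ⟨ℓ', hℓ', hq'⟩ := exists_loop_charge_eq J (charge ℓ)
    have h' : charge (ℓ' - k) = 0 := by rw [charge_sub, hq, hq', sub_self]
    have hM : charge (ℓ' - ℓ) = 0 := by rw [charge_sub, hq', sub_self]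
    refine ⟨ℓ', hℓ', h', hM, Loop.oneParticle_mem_localSubspace
      (((hℓ'.mono hJ).sub hℓ).primitive hM), ?_⟩
    rw [← Loop.oneParticle_add, Loop.primitive_add_primitive h h' hM]
  have hval : ∀ (J₁ J₂ : Arc) (ρ' σ' : Endo F I) (u v : Alg F I), J₁.Sub I → J₂.Sub I →
      J₂.Before J₁ → IsLocalizedIn ρ' J₁ → IsLocalizedIn σ' J₂ → u ∈ unitary (Alg F I) →
      v ∈ unitary (Alg F I) →
      u ∈ intertwiners (adWeyl I ((ℓ₁ - k₁).primitive h₁ I.lo).oneParticle) ρ' →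
      v ∈ intertwiners (adWeyl I ((ℓ₂ - k₂).primitive h₂ I.lo).oneParticle) σ' →
      adWeyl I ((ℓ₂ - k₂).primitive h₂ I.lo).oneParticle (star u) * star v * u *
        adWeyl I ((ℓ₁ - k₁).primitive h₁ I.lo).oneParticle v =
      Complex.exp (Complex.I * (braidingPhase I ℓ₁ ℓ₂ : ℂ)) • (1 : Alg F I) := by
    intro J₁ J₂ ρ' σ' u v hJ₁ hJ₂ hJ hρ' hσ' hu hv hui hvi
    obtain ⟨ℓ₁', hℓ₁', h₁', hM₁, m₁, e₁⟩ := htr ℓ₁ k₁ h₁ J₁ hℓ₁ hk₁ hq₁ hJ₁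
    obtain ⟨ℓ₂', hℓ₂', h₂', hM₂, m₂, e₂⟩ := htr ℓ₂ k₂ h₂ J₂ hℓ₂ hk₂ hq₂ hJ₂
    rw [braiding_expression_eq _ _ _ _ m₁ m₂ hJ₁ hJ₂ hJ hρ' hσ' hu hv hui hvi
      (fun K hK hKJ => by
        rw [e₁]; exact im_inner_primitive_eq_zero hJ₁ hℓ₁' hk₁ h₁' I.lo K hK (Or.inl hKJ))
      (fun K hK hKJ => by
        rw [e₂]; exact im_inner_primitive_eq_zero hJ₂ hℓ₂' hk₂ h₂' I.lo K hK (Or.inr hKJ)),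
      e₁, e₂, phase_eq_braidingPhase hJ₁ hJ₂ hJ hℓ₁ hℓ₂ hℓ₁' hℓ₂' hk₁ hk₂ h₁ h₂ h₁' h₂' hM₁]
  refine Set.eq_singleton_iff_unique_mem.2 ⟨?_, ?_⟩
  · have hI := I.lo_lt_hi
    have hI' := I.hi_lt
    -- For existence, the upper and lower halves of `I` and Weyl operators as transporters suffice.
    let J₁ : Arc := ⟨(I.lo + I.hi) / 2, I.hi, by linarith, by linarith⟩
    let J₂ : Arc := ⟨I.lo, (I.lo + I.hi) / 2, by linarith, by linarith⟩
    have hJ₁ : J₁.Sub I := ⟨by simp only [J₁]; linarith, le_rfl⟩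
    have hJ₂ : J₂.Sub I := ⟨le_rfl, by simp only [J₂]; linarith⟩
    obtain ⟨ℓ₁', hℓ₁', h₁', hM₁, m₁, e₁⟩ := htr ℓ₁ k₁ h₁ J₁ hℓ₁ hk₁ hq₁ hJ₁
    obtain ⟨ℓ₂', hℓ₂', h₂', hM₂, m₂, e₂⟩ := htr ℓ₂ k₂ h₂ J₂ hℓ₂ hk₂ hq₂ hJ₂
    have l₁ := isLocalizedIn_adWeyl _ (im_inner_primitive_eq_zero hJ₁ hℓ₁' hk₁ h₁' I.lo)
    have l₂ := isLocalizedIn_adWeyl _ (im_inner_primitive_eq_zero hJ₂ hℓ₂' hk₂ h₂' I.lo)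
    rw [← e₁] at l₁
    rw [← e₂] at l₂
    exact ⟨J₁, J₂, _, _, _, _, hJ₁, hJ₂, le_rfl, l₁, l₂, weyl_mem_unitary m₁, weyl_mem_unitary m₂,
      weyl_mem_intertwiners _ m₁, weyl_mem_intertwiners _ m₂,
      (hval J₁ J₂ _ _ _ _ hJ₁ hJ₂ le_rfl l₁ l₂ (weyl_mem_unitary m₁) (weyl_mem_unitary m₂)
        (weyl_mem_intertwiners _ m₁) (weyl_mem_intertwiners _ m₂)).symm⟩
  · rintro _ ⟨J₁, J₂, ρ', σ', u, v, hJ₁, hJ₂, hJ, hρ', hσ', hu, hv, hui, hvi, rfl⟩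
    exact hval J₁ J₂ ρ' σ' u v hJ₁ hJ₂ hJ hρ' hσ' hu hv hui hvi

theorem integral_eq_smul_charge {E : Type*} [NormedAddCommGroup E] [NormedSpace ℝ E] (f : Loop E)
    (a : ℝ) : ∫ θ in a..(a + 2 * Real.pi), f θ = (2 * Real.pi) • charge f := by
  rw [charge_eq f a, smul_smul, mul_inv_cancel₀ Real.two_pi_pos.ne', one_smul]

/-- Where `ℓ₂` lives, the primitive of `ℓ₁` has already reached its full value `2π q(ℓ₁)`. -/
theorem braidingPhase_of_before {I₁ I₂ : Arc} (hI₁ : I₁.Sub I) (hI₂ : I₂.Sub I)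
    (h : I₁.Before I₂) {ℓ₁ ℓ₂ : Loop F} (hℓ₁ : ℓ₁.SupportedIn I₁) (hℓ₂ : ℓ₂.SupportedIn I₂) :
    braidingPhase I ℓ₁ ℓ₂ = 2 * Real.pi * inner ℝ (charge ℓ₁) (charge ℓ₂) := by
  have hI := I.hi_lt
  have hpi := Real.two_pi_pos
  have h' : I₁.hi ≤ I₂.lo := h
  have l1 := I₁.lo_lt_hi
  have h1 : ∫ θ in I.lo..(I.lo + 2 * Real.pi), inner ℝ (∫ x in I.lo..θ, ℓ₁ x) (ℓ₂ θ) =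
      ∫ θ in I.lo..(I.lo + 2 * Real.pi), inner ℝ ((2 * Real.pi) • charge ℓ₁) (ℓ₂ θ) := by
    refine intervalIntegral.integral_congr fun θ hθ => ?_
    rw [Set.uIcc_of_le (by linarith)] at hθ
    rcases le_total θ I₂.lo with hc | hc
    · simp only [hℓ₂.apply_eq_zero_of_le (by linarith [hI₂.2, hθ.1] : I₂.hi ≤ θ + 2 * Real.pi) hc,
        inner_zero_right]
    · have h2 : ∫ x in θ..(I.lo + 2 * Real.pi), ℓ₁ x = 0 := by
        rw [intervalIntegral.integral_congr (g := fun _ => (0 : F)), intervalIntegral.integral_zero]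
        intro x hx
        rw [Set.uIcc_of_le hθ.2] at hx
        exact hℓ₁.apply_eq_zero (by linarith [hx.1]) (by linarith [hx.2, hI₁.1])
      simp only [← integral_eq_smul_charge ℓ₁ I.lo]
      rw [← intervalIntegral.integral_add_adjacent_intervals (ℓ₁.intervalIntegrable I.lo θ)
        (ℓ₁.intervalIntegrable θ (I.lo + 2 * Real.pi)), h2, add_zero]
  have h3 := (innerSL ℝ ((2 * Real.pi) • charge ℓ₁)).intervalIntegral_comp_comm
    (ℓ₂.intervalIntegrable I.lo (I.lo + 2 * Real.pi))
  simp only [innerSL_apply_apply] at h3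
  rw [braidingPhase, h1, h3, integral_eq_smul_charge, inner_smul_left, inner_smul_right]
  simp only [conj_trivial]
  field_simp

omit [FiniteDimensional ℝ F] in
-- In this order the primitive of `ℓ₂` is still zero where `ℓ₁` lives.
theorem braidingPhase_of_after {I₁ I₂ : Arc} (hI₁ : I₁.Sub I) (hI₂ : I₂.Sub I)
    (h : I₁.Before I₂) {ℓ₁ ℓ₂ : Loop F} (hℓ₁ : ℓ₁.SupportedIn I₁) (hℓ₂ : ℓ₂.SupportedIn I₂) :
    braidingPhase I ℓ₂ ℓ₁ = 0 := by
  have hI := I.hi_lt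
  have hpi := Real.two_pi_pos
  have h' : I₁.hi ≤ I₂.lo := h
  rw [braidingPhase, intervalIntegral.integral_congr (g := fun _ => (0 : ℝ)),
    intervalIntegral.integral_zero, mul_zero]
  intro θ hθ
  rw [Set.uIcc_of_le (by linarith)] at hθ
  rcases le_total θ I₂.lo with hc | hc
  · simp only
    rw [intervalIntegral.integral_congr (g := fun _ => (0 : F)), intervalIntegral.integral_zero,
      inner_zero_left]
    intro x hx
    rw [Set.uIcc_of_le hθ.1] at hx
    exact hℓ₂.apply_eq_zero_of_le (by linarith [hI₂.2, hx.1]) (hx.2.trans hc)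
  · simp only [hℓ₁.apply_eq_zero (h'.trans hc) (by linarith [hθ.2, hI₁.1] : θ ≤ I₁.lo + 2 * Real.pi),
      inner_zero_right]

/-- The primitive `Λ` of `ℓ` grows from `0` to `2π` over one period, so `∫ Λ Λ' = (2π)² / 2`; this
is half of the value for ordered supports. -/
theorem braidingPhase_smulVec {ℓ : Loop ℝ} (hq : charge ℓ = 1) (p q : F) :
    braidingPhase I (ℓ.smulVec p) (ℓ.smulVec q) = Real.pi * inner ℝ p q := by
  have hpi := Real.two_pi_pos
  set Λ : ℝ → ℝ := fun θ => ∫ x in I.lo..θ, ℓ x with hΛ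
  have hd : ∀ θ, HasDerivAt Λ (ℓ θ) θ := fun θ =>
    (ℓ.continuous.integral_hasStrictDerivAt I.lo θ).hasDerivAt
  have h1 : ∀ θ, inner ℝ (∫ x in I.lo..θ, ℓ.smulVec p x) (ℓ.smulVec q θ) =
      inner ℝ p q * (Λ θ * ℓ θ) := by
    intro θ
    simp only [Loop.smulVec_apply]
    rw [intervalIntegral.integral_smul_const, inner_smul_left, inner_smul_right]
    simp only [conj_trivial, hΛ]
    ring
  have hc : Continuous Λ := continuous_iff_continuousAt.2 fun θ => (hd θ).continuousAt
  have h2 : ∫ θ in I.lo..(I.lo + 2 * Real.pi), Λ θ * ℓ θ = (2 * Real.pi) ^ 2 / 2 := by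
    rw [intervalIntegral.integral_eq_sub_of_hasDerivAt (f := fun θ => Λ θ ^ 2 / 2)
      (f' := fun θ => Λ θ * ℓ θ) (fun θ _ => by
        convert! ((hd θ).pow 2).div_const 2 using 1
        ring)
      ((hc.mul ℓ.continuous).intervalIntegrable _ _)]
    simp only [hΛ, integral_eq_smul_charge, hq, intervalIntegral.integral_same]
    simp
  simp only [braidingPhase, h1]
  rw [intervalIntegral.integral_const_mul, h2]
  field_simp

end Gauge

end FreeBoson

end

/-! ### The theorem -/

theorem mainTheorem5 (F : Type*) [NormedAddCommGroup F] [InnerProductSpace ℝ F]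
    [FiniteDimensional ℝ F] (I : Arc) :
    (∀ ℓ : Loop F, ℓ.SupportedIn I → ∃! ρ : Endo F I, IsGaugeAut ℓ ρ) ∧
    (∀ I₁ I₂ : Arc, I₁.Sub I → I₂.Sub I → I₁.Before I₂ →
      ∀ ℓ₁ ℓ₂ : Loop F, ℓ₁.SupportedIn I₁ → ℓ₂.SupportedIn I₂ →
      ∀ ρ₁ ρ₂ : Endo F I, IsGaugeAut ℓ₁ ρ₁ → IsGaugeAut ℓ₂ ρ₂ →
        IsBraiding ρ₁ ρ₂ (Complex.exp (2 * (Real.pi : ℂ) * Complex.I *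
          ((inner ℝ (charge ℓ₁) (charge ℓ₂) : ℝ) : ℂ)) • (1 : Alg F I)) ∧
        IsBraiding ρ₂ ρ₁ (1 : Alg F I)) ∧
    (∀ ℓ : Loop ℝ, ℓ.SupportedIn I → charge ℓ = 1 →
      (∀ p : F, charge (ℓ.smulVec p) = p) ∧
      ∀ (p q : F) (ρ σ : Endo F I),
        IsGaugeAut (ℓ.smulVec p) ρ → IsGaugeAut (ℓ.smulVec q) σ →
        IsBraiding ρ σ (Complex.exp (Complex.I * (Real.pi : ℂ) *
          ((inner ℝ p q : ℝ) : ℂ)) • (1 : Alg F I))) := by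
  refine ⟨fun ℓ _ => existsUnique_isGaugeAut ℓ, ?_, ?_⟩
  · intro I₁ I₂ hI₁ hI₂ h ℓ₁ ℓ₂ hℓ₁ hℓ₂ ρ₁ ρ₂ hρ₁ hρ₂
    have h1 := isBraiding_of_isGaugeAut (hℓ₁.mono hI₁) (hℓ₂.mono hI₂) hρ₁ hρ₂
    have h2 := isBraiding_of_isGaugeAut (hℓ₂.mono hI₂) (hℓ₁.mono hI₁) hρ₂ hρ₁
    rw [braidingPhase_of_before hI₁ hI₂ h hℓ₁ hℓ₂] at h1
    rw [braidingPhase_of_after hI₁ hI₂ h hℓ₁ hℓ₂, Complex.ofReal_zero, mul_zero,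
      Complex.exp_zero, one_smul] at h2
    refine ⟨?_, h2⟩
    convert h1 using 3
    push_cast
    ring
  · intro ℓ hℓ hq
    refine ⟨fun p => by rw [charge_smulVec, hq, one_smul], fun p q ρ σ hρ hσ => ?_⟩
    have h1 := isBraiding_of_isGaugeAut (hℓ.smulVec p) (hℓ.smulVec q) hρ hσ
    rw [braidingPhase_smulVec hq] at h1
    convert h1 using 3
    push_cast
    ring
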